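/- Let $k>1$, $\varepsilon>0$ and $\delta>0$ be real numbers. For real $X\ge 1$ and real $\alpha$ put \[ S_k(\alpha)=\sum_{\substack{p\ \mathrm{prime}\\ \delta X\le p^k\le X}} (\log p)\, e(p^k\alpha),\qquad e(x)=e^{2\pi i x}. \] Then there is a constant $C>0$, depending only on $k$, $\varepsilon$ and $\delta$, such that for every real $X\ge 1$, every real $\tau>0$ and every integer $n$, \[ \int_{-\tau}^{\tau}|S_k(\alpha)|^4\,d\alpha\le C\bigl(\tau X^{2/k}+X^{4/k-1}\bigr)X^{\varepsilon} \quad\text{and}\quad \int_{n}^{n+1}|S_k(\alpha)|^4\,d\alpha\le C\bigl(X^{2/k}+X^{4/k-1}\bigr)X^{\varepsilon}. \] -/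

import Mathlib

/-- The additive character `e(x) = exp(2πix)`. -/
noncomputable def expTwoPiI (x : ℝ) : ℂ :=
  Complex.exp (2 * (Real.pi : ℂ) * Complex.I * (x : ℂ))

/-- The finite set of primes `p` with `δX ≤ p^k ≤ X`, `k` a positive real exponent. The bound
`p ≤ ⌊X^(1/k)⌋` is implied by `p^k ≤ X` and only makes the set visibly finite. -/
noncomputable def primePowerRange (k δ X : ℝ) : Finset ℕ :=
  open Classical in
  (Finset.range (⌊X ^ (1 / k)⌋₊ + 1)).filter
    (fun p => p.Prime ∧ δ * X ≤ (p : ℝ) ^ k ∧ (p : ℝ) ^ k ≤ X)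

theorem mem_primePowerRange {k : ℝ} (hk : 0 < k) (δ X : ℝ) (p : ℕ) :
    p ∈ primePowerRange k δ X ↔ p.Prime ∧ δ * X ≤ (p : ℝ) ^ k ∧ (p : ℝ) ^ k ≤ X := by
  unfold primePowerRange
  rw [Finset.mem_filter, Finset.mem_range]
  refine ⟨fun h => h.2, fun h => ⟨?_, h⟩⟩
  have hp : (0 : ℝ) ≤ (p : ℝ) := Nat.cast_nonneg p
  have h1 : ((p : ℝ) ^ k) ^ (1 / k) ≤ X ^ (1 / k) :=
    Real.rpow_le_rpow (Real.rpow_nonneg hp k) h.2.2 (by positivity)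
  rw [← Real.rpow_mul hp, mul_one_div_cancel hk.ne', Real.rpow_one] at h1
  exact Nat.lt_succ_of_le (Nat.le_floor h1)

/-- `S_k(α) = ∑_{δX ≤ p^k ≤ X} log p · e(p^k α)`, the sum running over primes `p`. -/
noncomputable def primeExpSum (k δ X α : ℝ) : ℂ :=
  ∑ p ∈ primePowerRange k δ X, (Real.log p : ℂ) * expTwoPiI ((p : ℝ) ^ k * α)

open Finset MeasureTheory FourierTransform

/-! ### The additive character -/

/-! Of the primes only the coefficient bound `|c n| ≤ log n` is used: with `N = (δX)^(1/k)` the sum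
runs over integers of `[N, κN]`, and `exists_integral_pow_four_le` bounds the fourth moment of any
such sum over an interval of half-length `U`, wherever it is centred, by `A⁴ N^η (U N² + N^(4-k))`.

Cut `[N, κN]` into blocks of length `L`, a little shorter than `N`. Cauchy–Schwarz over the `O(N/L)`
blocks turns the fourth power into the square of a sum over pairs from a common block, with
frequencies `n₁^k - n₂^k`. The large sieve `integral_normSq_le_card_closePairs` then reduces
everything to the count `quadCount`, for which `(N/L)^B N²` with fixed `B > 3` is enough.

The count is in turn at most a mean value: since the Fejér kernel is nonnegative, it is controlled
by the average over `0 ≤ t ≤ T`, `T ≍ L/N^(k-1)`, of the squared energy `∑_j |block_j(t)|²` of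
smoothed blocks. Each block is transformed by Poisson summation and stationary phase
(`exists_smoothBlock_bounds`). For `t ≤ 1/(N^(k-2) L)` boundedly many frequencies survive and the
block is `O((t N^(k-2))^(-1/2))`. For larger `t` it becomes, up to `O(1)`, a sum of length about `t
N^(k-2) L` over `m ≍ t N^(k-1)`, with phase `m^(k/(k-1))` times a function of `t` alone and
amplitudes of bounded variation. No asymptotic formula for the amplitudes is needed: completion
removes them at the cost of logarithms. Distant blocks have distant dual ranges, so on `[t₀, 2t₀]`
the energy is dominated by that of dual blocks, and a second large sieve, in the dual parameter,
leads back to `quadCount` with `k, N, L` replaced by `k/(k-1), M, L₁`.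

The recursion closes because `L₁/M ≍ L/N` while `M ≤ C L`: every dualisation shrinks the main length
by a factor `L/N`, up to constants, and keeps the ratio (`exists_quadCount_le`). With `L ≈
N^(1-1/j)` the length is bounded after `j` steps and the trivial count suffices. All losses are
fixed powers of `N/L ≈ N^(1/j)` and logarithms, which `X^ε` absorbs. -/

theorem expTwoPiI_eq_exp_mul_I (x : ℝ) :
    expTwoPiI x = Complex.exp (((2 * Real.pi * x : ℝ) : ℂ) * Complex.I) := by
  unfold expTwoPiI
  congr 1
  push_cast
  ring

@[simp] theorem norm_expTwoPiI (x : ℝ) : ‖expTwoPiI x‖ = 1 := by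
  rw [expTwoPiI_eq_exp_mul_I, Complex.norm_exp_ofReal_mul_I]

@[simp] theorem expTwoPiI_zero : expTwoPiI 0 = 1 := by simp [expTwoPiI]

theorem expTwoPiI_add (x y : ℝ) : expTwoPiI (x + y) = expTwoPiI x * expTwoPiI y := by
  unfold expTwoPiI
  rw [← Complex.exp_add]
  congr 1
  push_cast
  ring

theorem expTwoPiI_neg (x : ℝ) : expTwoPiI (-x) = starRingEnd ℂ (expTwoPiI x) := by
  unfold expTwoPiI
  rw [← Complex.exp_conj]
  congr 1
  simp [Complex.conj_ofReal, Complex.conj_ofNat]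

theorem expTwoPiI_sub (x y : ℝ) :
    expTwoPiI (x - y) = expTwoPiI x * starRingEnd ℂ (expTwoPiI y) := by
  rw [sub_eq_add_neg, expTwoPiI_add, expTwoPiI_neg]

theorem hasDerivAt_expTwoPiI (x : ℝ) :
    HasDerivAt expTwoPiI (2 * Real.pi * Complex.I * expTwoPiI x) x := by
  have h1 : HasDerivAt (fun y : ℝ => 2 * (Real.pi : ℂ) * Complex.I * (y : ℂ))
      (2 * (Real.pi : ℂ) * Complex.I * 1) x :=
    (Complex.ofRealCLM.hasDerivAt (x := x)).const_mul _
  have h2 := h1.cexp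
  rw [mul_one, mul_comm (Complex.exp _)] at h2
  exact h2

theorem continuous_expTwoPiI : Continuous expTwoPiI :=
  continuous_iff_continuousAt.mpr fun x => (hasDerivAt_expTwoPiI x).continuousAt

@[fun_prop] theorem Continuous.expTwoPiI {α : Type*} [TopologicalSpace α] {f : α → ℝ}
    (hf : Continuous f) : Continuous fun x => expTwoPiI (f x) :=
  continuous_expTwoPiI.comp hf

theorem HasDerivAt.expTwoPiI {f : ℝ → ℝ} {f' x : ℝ} (hf : HasDerivAt f f' x) :
    HasDerivAt (fun y => expTwoPiI (f y)) (2 * Real.pi * Complex.I * f' * expTwoPiI (f x)) x := by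
  have := (hasDerivAt_expTwoPiI (f x)).scomp x hf
  convert! this using 1
  simp only [Complex.real_smul]
  ring

/-! ### Mean squares of exponential sums with real frequencies -/

/-- The Fejér-type kernel `|∫₀ᵀ e(ξx) dx|²`. -/
noncomputable def fejer (T ξ : ℝ) : ℝ := ‖∫ x in (0 : ℝ)..T, expTwoPiI (ξ * x)‖ ^ 2

/-- Averaging over both `x` and `y` turns each cross term into `|∫ e(ξx) dx|²`, a kernel that is
nonnegative and decays. Nonnegativity bounds the number of close pairs by the integral; decay gives
the reverse inequality, the large sieve. -/
theorem integral_integral_normSq_sum {ι : Type*} (s : Finset ι) (c : ι → ℂ) (ω : ι → ℝ) (T : ℝ) :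
    ∫ x in (0 : ℝ)..T, ∫ y in (0 : ℝ)..T, ‖∑ q ∈ s, c q * expTwoPiI (ω q * (x - y))‖ ^ 2 =
      (∑ p ∈ s ×ˢ s, c p.1 * starRingEnd ℂ (c p.2) * (fejer T (ω p.1 - ω p.2) : ℂ)).re := by
  have key : ∀ x y : ℝ, ((‖∑ q ∈ s, c q * expTwoPiI (ω q * (x - y))‖ ^ 2 : ℝ) : ℂ) =
      ∑ p ∈ s ×ˢ s, c p.1 * starRingEnd ℂ (c p.2) * (expTwoPiI ((ω p.1 - ω p.2) * x) *
        starRingEnd ℂ (expTwoPiI ((ω p.1 - ω p.2) * y))) := by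
    intro x y
    push_cast
    rw [← Complex.mul_conj', map_sum, Finset.sum_mul_sum, ← Finset.sum_product']
    refine Finset.sum_congr rfl fun p _ => ?_
    rw [map_mul, ← expTwoPiI_sub,
      show (ω p.1 - ω p.2) * x - (ω p.1 - ω p.2) * y = ω p.1 * (x - y) - ω p.2 * (x - y) by ring,
      expTwoPiI_sub]
    ring
  have h1 : ∀ x : ℝ, ((∫ y in (0 : ℝ)..T, ‖∑ q ∈ s, c q * expTwoPiI (ω q * (x - y))‖ ^ 2 : ℝ) : ℂ) =
      ∑ p ∈ s ×ˢ s, c p.1 * starRingEnd ℂ (c p.2) * (expTwoPiI ((ω p.1 - ω p.2) * x) *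
        starRingEnd ℂ (∫ y in (0 : ℝ)..T, expTwoPiI ((ω p.1 - ω p.2) * y))) := by
    intro x
    rw [← intervalIntegral.integral_ofReal]
    simp_rw [key]
    rw [intervalIntegral.integral_finsetSum]
    · refine Finset.sum_congr rfl fun p _ => ?_
      rw [intervalIntegral.integral_const_mul, intervalIntegral.integral_const_mul,
        intervalIntegral.intervalIntegral_eq_integral_uIoc,
        intervalIntegral.intervalIntegral_eq_integral_uIoc, integral_conj]
      split_ifs <;> simp
    · intro p _
      apply Continuous.intervalIntegrable
      have : Continuous (starRingEnd ℂ) := Complex.continuous_conj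
      fun_prop
  have h2 : ((∫ x in (0 : ℝ)..T, ∫ y in (0 : ℝ)..T,
      ‖∑ q ∈ s, c q * expTwoPiI (ω q * (x - y))‖ ^ 2 : ℝ) : ℂ) =
      ∑ p ∈ s ×ˢ s, c p.1 * starRingEnd ℂ (c p.2) * (fejer T (ω p.1 - ω p.2) : ℂ) := by
    rw [← intervalIntegral.integral_ofReal]
    simp_rw [h1]
    rw [intervalIntegral.integral_finsetSum]
    · refine Finset.sum_congr rfl fun p _ => ?_
      rw [intervalIntegral.integral_const_mul, intervalIntegral.integral_mul_const,
        Complex.mul_conj', fejer]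
      push_cast
      rfl
    · intro p _
      apply Continuous.intervalIntegrable
      fun_prop
  rw [← h2, Complex.ofReal_re]

theorem fejer_nonneg (T ξ : ℝ) : 0 ≤ fejer T ξ := by unfold fejer; positivity

theorem fejer_le_sq {T : ℝ} (hT : 0 ≤ T) (ξ : ℝ) : fejer T ξ ≤ T ^ 2 := by
  unfold fejer
  have := intervalIntegral.norm_integral_le_of_norm_le_const (a := 0) (b := T) (C := 1)
    (f := fun x => expTwoPiI (ξ * x)) (fun x _ => by simp)
  rw [sub_zero, abs_of_nonneg hT, one_mul] at this
  gcongr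

theorem fejer_le_inv_sq (T : ℝ) {ξ : ℝ} (hξ : ξ ≠ 0) : fejer T ξ ≤ 1 / ξ ^ 2 := by
  unfold fejer
  have hder : ∀ x ∈ Set.uIcc 0 T, HasDerivAt
      (fun x => expTwoPiI (ξ * x) / (2 * Real.pi * Complex.I * ξ)) (expTwoPiI (ξ * x)) x := by
    intro x _
    have := (((hasDerivAt_id x).const_mul ξ).expTwoPiI).div_const (2 * Real.pi * Complex.I * ξ)
    convert! this using 1
    have : (2 * Real.pi * Complex.I * ξ : ℂ) ≠ 0 := by
      simp [Real.pi_ne_zero, hξ]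
    simp only [id, mul_one]
    rw [mul_div_cancel_left₀ _ this]
  rw [intervalIntegral.integral_eq_sub_of_hasDerivAt hder
    (Continuous.intervalIntegrable (by fun_prop) _ _), ← sub_div, norm_div]
  have hn : ‖(2 * Real.pi * Complex.I * ξ : ℂ)‖ = 2 * Real.pi * |ξ| := by
    simp [abs_of_pos Real.pi_pos]
  rw [hn]
  have h2 : ‖expTwoPiI (ξ * T) - expTwoPiI (ξ * 0)‖ ≤ 2 := by
    refine (norm_sub_le _ _).trans ?_
    simp; norm_num
  rw [div_pow, mul_pow, sq_abs]
  have hx2 : 0 < ξ ^ 2 := by positivity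
  rw [div_le_div_iff₀ (by positivity) hx2]
  have : ‖expTwoPiI (ξ * T) - expTwoPiI (ξ * 0)‖ ^ 2 ≤ (2 * Real.pi) ^ 2 := by
    gcongr
    nlinarith [Real.pi_gt_three]
  nlinarith

/-- For `0 ≤ x ≤ T` the angle `2πξx` is at most `π/4` in absolute value, so the integrand has real
part at least `√2/2`. -/
theorem half_sq_le_fejer {T ξ : ℝ} (hT : 0 < T) (hξ : |ξ| ≤ 1 / (8 * T)) :
    T ^ 2 / 2 ≤ fejer T ξ := by
  unfold fejer
  have hre : (∫ x in (0 : ℝ)..T, expTwoPiI (ξ * x)).re =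
      ∫ x in (0 : ℝ)..T, Real.cos (2 * Real.pi * (ξ * x)) := by
    have h := intervalIntegral.intervalIntegral_re (𝕜 := ℂ) (μ := volume) (a := 0) (b := T)
      (f := fun x => expTwoPiI (ξ * x)) (Continuous.intervalIntegrable (by fun_prop) _ _)
    refine h.symm.trans ?_
    refine intervalIntegral.integral_congr fun x _ => ?_
    simp only [expTwoPiI_eq_exp_mul_I]
    exact Complex.exp_ofReal_mul_I_re _
  have hlow : T * (√2 / 2) ≤ ∫ x in (0 : ℝ)..T, Real.cos (2 * Real.pi * (ξ * x)) := by
    have : ∫ x in (0 : ℝ)..T, (√2 / 2 : ℝ) ≤ ∫ x in (0 : ℝ)..T, Real.cos (2 * Real.pi * (ξ * x)) := by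
      refine intervalIntegral.integral_mono_on hT.le (by simp)
        (Continuous.intervalIntegrable (by fun_prop) _ _) fun x hx => ?_
      rw [← Real.cos_pi_div_four, ← Real.cos_abs (2 * Real.pi * (ξ * x))]
      refine Real.cos_le_cos_of_nonneg_of_le_pi (abs_nonneg _)
        (by linarith [Real.pi_pos]) ?_
      have h8 : |ξ * x| ≤ 1 / 8 := by
        rw [abs_mul, abs_of_nonneg hx.1]
        calc |ξ| * x ≤ 1 / (8 * T) * T := by
              apply mul_le_mul hξ hx.2 hx.1 (by positivity)
          _ = 1 / 8 := by field_simp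
      rw [abs_mul, abs_of_pos (by positivity : 0 < 2 * Real.pi)]
      nlinarith [Real.pi_pos]
    simpa [mul_div_assoc] using this
  have h3 : T * (√2 / 2) ≤ ‖∫ x in (0 : ℝ)..T, expTwoPiI (ξ * x)‖ :=
    (hlow.trans_eq hre.symm).trans (Complex.re_le_norm _)
  have h4 : (T * (√2 / 2)) ^ 2 ≤ ‖∫ x in (0 : ℝ)..T, expTwoPiI (ξ * x)‖ ^ 2 := by
    gcongr
  refine le_trans (le_of_eq ?_) h4
  rw [mul_pow, div_pow, Real.sq_sqrt (by norm_num)]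
  ring

/-- Quadruples, more precisely pairs of indices, with nearly equal frequencies. -/
noncomputable def closePairs {ι : Type*} (s : Finset ι) (ω : ι → ℝ) (η : ℝ) : Finset (ι × ι) :=
  open Classical in (s ×ˢ s).filter fun p => |ω p.1 - ω p.2| ≤ η

theorem mem_closePairs {ι : Type*} {s : Finset ι} {ω : ι → ℝ} {η : ℝ} {p : ι × ι} :
    p ∈ closePairs s ω η ↔ (p.1 ∈ s ∧ p.2 ∈ s) ∧ |ω p.1 - ω p.2| ≤ η := by
  unfold closePairs
  rw [Finset.mem_filter, Finset.mem_product]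

/-- With nonnegative coefficients and a nonnegative kernel, all pairs that are not close can be
discarded. On the other side `x - y` stays in `[-T, T]`, so each inner integral is at most the
integral over that interval. -/
theorem sum_closePairs_le_integral {ι : Type*} (s : Finset ι) (a ω : ι → ℝ)
    (ha : ∀ q ∈ s, 0 ≤ a q) {T : ℝ} (hT : 0 < T) :
    ∑ p ∈ closePairs s ω (1 / (8 * T)), a p.1 * a p.2 ≤
      2 / T * ∫ t in (-T)..T, ‖∑ q ∈ s, (a q : ℂ) * expTwoPiI (ω q * t)‖ ^ 2 := by
  set Φ : ℝ → ℝ := fun t => ‖∑ q ∈ s, (a q : ℂ) * expTwoPiI (ω q * t)‖ ^ 2 with hΦ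
  have hΦc : Continuous Φ := by fun_prop
  have hid := integral_integral_normSq_sum s (fun q => (a q : ℂ)) ω T
  have hup : ∫ x in (0 : ℝ)..T, ∫ y in (0 : ℝ)..T, Φ (x - y) ≤ T * ∫ t in (-T)..T, Φ t := by
    have : ∫ x in (0 : ℝ)..T, ∫ y in (0 : ℝ)..T, Φ (x - y) ≤
        ∫ x in (0 : ℝ)..T, ∫ t in (-T)..T, Φ t := by
      refine intervalIntegral.integral_mono_on hT.le ?_ (by simp) fun x hx => ?_
      · apply Continuous.intervalIntegrable
        apply intervalIntegral.continuous_parametric_intervalIntegral_of_continuous'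
        fun_prop
      · rw [intervalIntegral.integral_comp_sub_left (fun t => Φ t) x]
        refine intervalIntegral.integral_mono_interval (by linarith [hx.1]) (by linarith)
          (by linarith [hx.2]) (Filter.Eventually.of_forall fun t => ?_)
          (hΦc.intervalIntegrable _ _)
        simp only [hΦ, Pi.zero_apply]; positivity
    refine this.trans (le_of_eq ?_)
    simp
  have hlow : (T ^ 2 / 2) * ∑ p ∈ closePairs s ω (1 / (8 * T)), a p.1 * a p.2 ≤
      ∫ x in (0 : ℝ)..T, ∫ y in (0 : ℝ)..T, Φ (x - y) := by
    rw [hid, Complex.re_sum]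
    rw [Finset.mul_sum]
    have hterm : ∀ p ∈ s ×ˢ s, ((a p.1 : ℂ) * starRingEnd ℂ (a p.2 : ℂ) *
        (fejer T (ω p.1 - ω p.2) : ℂ)).re = a p.1 * a p.2 * fejer T (ω p.1 - ω p.2) := by
      intro p _
      rw [Complex.conj_ofReal, ← Complex.ofReal_mul, ← Complex.ofReal_mul, Complex.ofReal_re]
    rw [Finset.sum_congr rfl hterm]
    refine le_trans (Finset.sum_le_sum fun p hp => ?_)
      (Finset.sum_le_sum_of_subset_of_nonneg (s := closePairs s ω (1 / (8 * T)))
        (fun p hp => Finset.mem_product.mpr (mem_closePairs.mp hp).1) fun p hp _ => ?_)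
    · have hp := mem_closePairs.mp hp
      have := half_sq_le_fejer hT hp.2
      have h0 : 0 ≤ a p.1 * a p.2 := mul_nonneg (ha _ hp.1.1) (ha _ hp.1.2)
      nlinarith
    · rw [Finset.mem_product] at hp
      exact mul_nonneg (mul_nonneg (ha _ hp.1) (ha _ hp.2)) (fejer_nonneg _ _)
  have h := hlow.trans hup
  rw [div_mul_eq_mul_div, le_div_iff₀ hT]
  have h' : T * (T / 2 * ∑ p ∈ closePairs s ω (1 / (8 * T)), a p.1 * a p.2) ≤
      T * ∫ t in (-T)..T, Φ t := by
    refine le_trans (le_of_eq (by ring)) h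
  have := le_of_mul_le_mul_left h' hT
  linarith

/-! ### The large sieve upper bound. -/

theorem sum_int_inv_one_add_sq_bound :
    ∃ C : ℝ, 0 < C ∧ ∀ s : Finset ℤ, ∑ h ∈ s, 1 / (1 + (h : ℝ) ^ 2) ≤ C := by
  have hs : Summable fun h : ℤ => 1 / (1 + (h : ℝ) ^ 2) := by
    have h1 : Summable fun h : ℤ => 1 / (h : ℝ) ^ 2 :=
      Real.summable_one_div_int_pow.mpr (by norm_num)
    refine Summable.of_norm_bounded_eventually h1 ?_
    have : ∀ᶠ h : ℤ in Filter.cofinite, h ≠ 0 :=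
      (Set.finite_singleton (0 : ℤ)).compl_mem_cofinite
    filter_upwards [this] with h hh
    rw [Real.norm_of_nonneg (by positivity)]
    have : (0 : ℝ) < (h : ℝ) ^ 2 := by positivity
    gcongr
    linarith
  refine ⟨(∑' h : ℤ, 1 / (1 + (h : ℝ) ^ 2)) + 1, ?_, fun s => ?_⟩
  · have : 0 ≤ ∑' h : ℤ, 1 / (1 + (h : ℝ) ^ 2) := tsum_nonneg fun h => by positivity
    linarith
  · have := hs.sum_le_tsum s fun h _ => by positivity
    linarith

/-- Schur's test for a kernel depending on the difference of integer labels. -/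
theorem sum_label_kernel_le {ι : Type*} (s : Finset ι) (v : ι → ℤ) {C : ℝ}
    (hC : ∀ s : Finset ℤ, ∑ h ∈ s, 1 / (1 + (h : ℝ) ^ 2) ≤ C) :
    ∑ p ∈ s ×ˢ s, 1 / (1 + ((v p.1 - v p.2 : ℤ) : ℝ) ^ 2) ≤
      C * ((s ×ˢ s).filter fun p => v p.1 = v p.2).card := by
  classical
  set I := s.image v
  set n : ℤ → ℝ := fun i => ((s.filter fun q => v q = i).card : ℝ)
  have hmap : ∀ q ∈ s, v q ∈ I := fun q hq => Finset.mem_image_of_mem v hq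
  have hL : ∑ p ∈ s ×ˢ s, 1 / (1 + ((v p.1 - v p.2 : ℤ) : ℝ) ^ 2) =
      ∑ i ∈ I, ∑ j ∈ I, n i * n j * (1 / (1 + ((i - j : ℤ) : ℝ) ^ 2)) := by
    rw [Finset.sum_product, ← Finset.sum_fiberwise_of_maps_to hmap]
    refine Finset.sum_congr rfl fun i _ => ?_
    have : ∀ q ∈ s.filter (fun q => v q = i),
        ∑ y ∈ s, 1 / (1 + ((v q - v y : ℤ) : ℝ) ^ 2) =
        ∑ j ∈ I, n j * (1 / (1 + ((i - j : ℤ) : ℝ) ^ 2)) := by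
      intro q hq
      rw [(Finset.mem_filter.mp hq).2, ← Finset.sum_fiberwise_of_maps_to hmap]
      refine Finset.sum_congr rfl fun j _ => ?_
      rw [Finset.sum_congr rfl (g := fun _ => 1 / (1 + ((i - j : ℤ) : ℝ) ^ 2))
        fun y hy => by rw [(Finset.mem_filter.mp hy).2], Finset.sum_const, nsmul_eq_mul]
    rw [Finset.sum_congr rfl this, Finset.sum_const, nsmul_eq_mul, Finset.mul_sum]
    exact Finset.sum_congr rfl fun j _ => by ring
  have hR : (((s ×ˢ s).filter fun p => v p.1 = v p.2).card : ℝ) = ∑ i ∈ I, n i ^ 2 := by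
    rw [Finset.card_eq_sum_card_fiberwise (f := fun p => v p.1) (t := I)]
    · push_cast
      refine Finset.sum_congr rfl fun i _ => ?_
      have : ((s ×ˢ s).filter fun p => v p.1 = v p.2).filter (fun p => v p.1 = i) =
          (s.filter fun q => v q = i) ×ˢ (s.filter fun q => v q = i) := by
        ext p
        simp only [Finset.mem_filter, Finset.mem_product]
        constructor
        · rintro ⟨⟨⟨h1, h2⟩, h3⟩, h4⟩
          exact ⟨⟨h1, h4⟩, h2, h3 ▸ h4⟩
        · rintro ⟨⟨h1, h4⟩, h2, h3⟩
          exact ⟨⟨⟨h1, h2⟩, h4.trans h3.symm⟩, h4⟩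
      rw [this, Finset.card_product]
      push_cast
      ring
    · intro p hp
      simp only [Finset.coe_filter, Finset.mem_product, Set.mem_ofPred_eq] at hp
      exact hmap _ hp.1.1
  have hrow : ∀ i : ℤ, ∑ j ∈ I, 1 / (1 + ((i - j : ℤ) : ℝ) ^ 2) ≤ C := by
    intro i
    have := hC (I.image fun j => i - j)
    rwa [Finset.sum_image (fun a _ b _ h => by simpa using h)] at this
  rw [hL, hR]
  -- `n i` counts the indices with label `i`. The inequality `n_i n_j ≤ (n_i² + n_j²)/2` and the
  -- symmetry of the kernel reduce the double sum to `∑ n_i²` times a row sum.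
  calc ∑ i ∈ I, ∑ j ∈ I, n i * n j * (1 / (1 + ((i - j : ℤ) : ℝ) ^ 2))
      ≤ ∑ i ∈ I, ∑ j ∈ I, (n i ^ 2 / 2 * (1 / (1 + ((i - j : ℤ) : ℝ) ^ 2)) +
          n j ^ 2 / 2 * (1 / (1 + ((j - i : ℤ) : ℝ) ^ 2))) := by
        refine Finset.sum_le_sum fun i _ => Finset.sum_le_sum fun j _ => ?_
        have h1 : ((j - i : ℤ) : ℝ) ^ 2 = ((i - j : ℤ) : ℝ) ^ 2 := by push_cast; ring
        rw [h1, ← add_mul]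
        refine mul_le_mul_of_nonneg_right ?_ (by positivity)
        nlinarith [sq_nonneg (n i - n j)]
    _ = ∑ i ∈ I, n i ^ 2 * ∑ j ∈ I, 1 / (1 + ((i - j : ℤ) : ℝ) ^ 2) := by
        simp_rw [Finset.sum_add_distrib]
        rw [Finset.sum_comm (f := fun i j => n j ^ 2 / 2 * (1 / (1 + ((j - i : ℤ) : ℝ) ^ 2))),
          ← Finset.sum_add_distrib]
        refine Finset.sum_congr rfl fun i _ => ?_
        rw [← Finset.mul_sum, ← add_mul]
        ring
    _ ≤ ∑ i ∈ I, n i ^ 2 * C := by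
        refine Finset.sum_le_sum fun i _ => mul_le_mul_of_nonneg_left (hrow i) (by positivity)
    _ = C * ∑ i ∈ I, n i ^ 2 := by rw [← Finset.sum_mul, mul_comm]

/-- A large sieve inequality: the mean square is controlled by the number of close pairs. -/
theorem integral_normSq_le_card_closePairs :
    ∃ C : ℝ, 0 < C ∧ ∀ {ι : Type} (s : Finset ι) (c : ι → ℂ) (ω : ι → ℝ) (A U : ℝ), 0 < U →
      (∀ q ∈ s, ‖c q‖ ≤ A) → ∀ a : ℝ,
      ∫ t in (a - U)..(a + U), ‖∑ q ∈ s, c q * expTwoPiI (ω q * t)‖ ^ 2 ≤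
        C * A ^ 2 * U * (closePairs s ω (1 / U)).card := by
  obtain ⟨C, hC0, hC⟩ := sum_int_inv_one_add_sq_bound
  refine ⟨8 * C, by positivity, ?_⟩
  intro ι s c ω A U hU hc a
  classical
  -- The centre `a` of the interval only rotates the coefficients, so it may be taken to be `0`.
  set d : ι → ℂ := fun q => c q * expTwoPiI (ω q * a) with hd
  have hdn : ∀ q ∈ s, ‖d q‖ ≤ A := fun q hq => by simpa [hd] using hc q hq
  set Φ : ℝ → ℝ := fun t => ‖∑ q ∈ s, d q * expTwoPiI (ω q * t)‖ ^ 2 with hΦ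
  have hΦc : Continuous Φ := by fun_prop
  have hΦ0 : ∀ t, 0 ≤ Φ t := fun t => by simp only [hΦ]; positivity
  have hshift : ∫ t in (a - U)..(a + U), ‖∑ q ∈ s, c q * expTwoPiI (ω q * t)‖ ^ 2 =
      ∫ t in (-U)..U, Φ t := by
    rw [sub_eq_add_neg, add_comm a (-U), add_comm a U,
      ← intervalIntegral.integral_comp_add_right]
    refine intervalIntegral.integral_congr fun t _ => ?_
    simp only [hΦ, hd]
    congr 2
    refine Finset.sum_congr rfl fun q _ => ?_
    rw [mul_add, add_comm, expTwoPiI_add, mul_assoc]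
  have hint : ∀ x y, IntervalIntegrable Φ volume x y := fun x y => hΦc.intervalIntegrable _ _
  have hmono : ∀ {x y x' y' : ℝ}, x ≤ x' → x' ≤ y' → y' ≤ y →
      ∫ t in x'..y', Φ t ≤ ∫ t in x..y, Φ t := fun h1 h2 h3 =>
    intervalIntegral.integral_mono_interval h1 h2 h3
      (Filter.Eventually.of_forall fun t => hΦ0 t) (hint _ _)
  have hinner : ∀ x, ∫ y in (0 : ℝ)..(2 * U), Φ (x - y) = ∫ t in (x - 2 * U)..x, Φ t := by
    intro x
    rw [intervalIntegral.integral_comp_sub_left (fun t => Φ t) x, sub_zero]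
  have hcont : Continuous fun x => ∫ y in (0 : ℝ)..(2 * U), Φ (x - y) := by
    apply intervalIntegral.continuous_parametric_intervalIntegral_of_continuous'
    fun_prop
  -- The window `[x - 2U, x]` contains `[-U, 0]` when `0 ≤ x ≤ U` and `[0, U]` when `U ≤ x ≤ 2U`;
  -- each half of `[-U, U]` is thus covered for a set of `x` of length `U`.
  have hlow : U * ∫ t in (-U)..U, Φ t ≤
      ∫ x in (0 : ℝ)..(2 * U), ∫ y in (0 : ℝ)..(2 * U), Φ (x - y) := by
    rw [← intervalIntegral.integral_add_adjacent_intervals (b := U)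
      (hcont.intervalIntegrable _ _) (hcont.intervalIntegrable _ _),
      ← intervalIntegral.integral_add_adjacent_intervals (b := 0) (hint (-U) 0) (hint 0 U), mul_add]
    have e1 : ∫ x in (0 : ℝ)..U, ∫ t in (-U)..(0 : ℝ), Φ t ≤
        ∫ x in (0 : ℝ)..U, ∫ y in (0 : ℝ)..(2 * U), Φ (x - y) := by
      refine intervalIntegral.integral_mono_on hU.le (by simp) (hcont.intervalIntegrable _ _)
        fun x hx => ?_
      rw [hinner]
      exact hmono (by linarith [hx.2]) (by linarith) hx.1
    have e2 : ∫ x in U..(2 * U), ∫ t in (0 : ℝ)..U, Φ t ≤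
        ∫ x in U..(2 * U), ∫ y in (0 : ℝ)..(2 * U), Φ (x - y) := by
      refine intervalIntegral.integral_mono_on (by linarith) (by simp)
        (hcont.intervalIntegrable _ _) fun x hx => ?_
      rw [hinner]
      exact hmono (by linarith [hx.2]) hU.le hx.1
    simp only [intervalIntegral.integral_const, smul_eq_mul] at e1 e2
    have : 2 * U - U = U := by ring
    rw [this] at e2
    rw [sub_zero] at e1
    linarith
  have hid := integral_integral_normSq_sum s d ω (2 * U)
  set v : ι → ℤ := fun q => ⌊ω q * U⌋ with hv
  -- Labels are `⌊ωU⌋`. If they differ by `h` with `|h| ≤ 1`, the trivial bound `4U²` suffices; if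
  -- `|h| ≥ 2`, then `|ξ - η| U ≥ |h| - 1 ≥ |h|/2` and the inverse square decay applies.
  have hker : ∀ ξ η : ℝ, fejer (2 * U) (ξ - η) ≤
      8 * U ^ 2 * (1 / (1 + ((⌊ξ * U⌋ - ⌊η * U⌋ : ℤ) : ℝ) ^ 2)) := by
    intro ξ η
    set h : ℤ := ⌊ξ * U⌋ - ⌊η * U⌋ with hh
    have hb := fejer_le_sq (T := 2 * U) (by positivity) (ξ - η)
    have f1 := Int.floor_le (ξ * U)
    have f2 := Int.lt_floor_add_one (ξ * U)
    have f3 := Int.floor_le (η * U)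
    have f4 := Int.lt_floor_add_one (η * U)
    have hcast : (h : ℝ) = (⌊ξ * U⌋ : ℝ) - (⌊η * U⌋ : ℝ) := by rw [hh]; push_cast; ring
    rw [mul_one_div, le_div_iff₀ (by positivity)]
    by_cases h1 : (h : ℝ) ^ 2 ≤ 1
    · have := fejer_nonneg (2 * U) (ξ - η)
      nlinarith
    · have h2 : 2 ≤ |h| := by
        by_contra hcon
        have : |h| ≤ 1 := by omega
        apply h1
        have : |(h : ℝ)| ≤ 1 := by exact_mod_cast this
        rw [← sq_abs]; nlinarith [abs_nonneg (h : ℝ)]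
      have h2' : (2 : ℝ) ≤ |(h : ℝ)| := by exact_mod_cast h2
      have h3 : |(h : ℝ)| / 2 ≤ |(ξ - η) * U| := by
        have : |(h : ℝ) - (ξ - η) * U| ≤ 1 := by
          rw [hcast, abs_le]; constructor <;> nlinarith
        have h4 := abs_sub_abs_le_abs_sub (h : ℝ) ((ξ - η) * U)
        linarith
      have hne : ξ - η ≠ 0 := by
        intro h0
        rw [h0, zero_mul, abs_zero] at h3
        linarith
      have hf := fejer_le_inv_sq (2 * U) hne
      have hpos : 0 < (ξ - η) ^ 2 := by positivity
      have h5 : (h : ℝ) ^ 2 / 4 ≤ (ξ - η) ^ 2 * U ^ 2 := by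
        have : (|(h : ℝ)| / 2) ^ 2 ≤ |(ξ - η) * U| ^ 2 := by gcongr
        rw [sq_abs, div_pow, sq_abs, mul_pow] at this
        linarith
      rw [le_div_iff₀ hpos] at hf
      have h6 : 1 + (h : ℝ) ^ 2 ≤ 2 * (h : ℝ) ^ 2 := by linarith
      have h0 := fejer_nonneg (2 * U) (ξ - η)
      calc fejer (2 * U) (ξ - η) * (1 + (h : ℝ) ^ 2)
          ≤ fejer (2 * U) (ξ - η) * (8 * ((ξ - η) ^ 2 * U ^ 2)) := by
            gcongr; linarith
        _ = (fejer (2 * U) (ξ - η) * (ξ - η) ^ 2) * (8 * U ^ 2) := by ring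
        _ ≤ 1 * (8 * U ^ 2) := by gcongr
        _ = 8 * U ^ 2 := one_mul _
  have hA : ∀ p ∈ s ×ˢ s, (d p.1 * starRingEnd ℂ (d p.2) *
      (fejer (2 * U) (ω p.1 - ω p.2) : ℂ)).re ≤
      A ^ 2 * (8 * U ^ 2) * (1 / (1 + ((v p.1 - v p.2 : ℤ) : ℝ) ^ 2)) := by
    intro p hp
    rw [Finset.mem_product] at hp
    refine (Complex.re_le_norm _).trans ?_
    rw [norm_mul, norm_mul, RCLike.norm_conj, Complex.norm_real,
      Real.norm_of_nonneg (fejer_nonneg _ _), mul_assoc (A ^ 2), sq A]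
    have hA0 : 0 ≤ A := (norm_nonneg _).trans (hdn _ hp.1)
    exact mul_le_mul (mul_le_mul (hdn _ hp.1) (hdn _ hp.2) (norm_nonneg _) hA0) (hker _ _)
      (fejer_nonneg _ _) (by positivity)
  have hup : ∫ x in (0 : ℝ)..(2 * U), ∫ y in (0 : ℝ)..(2 * U), Φ (x - y) ≤
      A ^ 2 * (8 * U ^ 2) * (C * (closePairs s ω (1 / U)).card) := by
    rw [hid, Complex.re_sum]
    refine (Finset.sum_le_sum hA).trans ?_
    rw [← Finset.mul_sum]
    refine mul_le_mul_of_nonneg_left ?_ (by positivity)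
    refine (sum_label_kernel_le s v hC).trans ?_
    refine mul_le_mul_of_nonneg_left ?_ hC0.le
    norm_cast
    refine Finset.card_le_card fun p hp => ?_
    rw [Finset.mem_filter, Finset.mem_product] at hp
    refine mem_closePairs.mpr ⟨hp.1, ?_⟩
    have h1 := Int.abs_sub_lt_one_of_floor_eq_floor hp.2
    rw [← sub_mul, abs_mul, abs_of_pos hU] at h1
    rw [le_div_iff₀ hU]
    exact h1.le
  have h := hlow.trans hup
  rw [hshift]
  have h' : U * ∫ t in (-U)..U, Φ t ≤
      U * (8 * C * A ^ 2 * U * (closePairs s ω (1 / U)).card) := h.trans_eq (by ring)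
  exact le_of_mul_le_mul_left h' hU

/-! ### Oscillatory integrals -/

theorem norm_two_pi_I : ‖(2 * Real.pi * Complex.I : ℂ)‖ = 2 * Real.pi := by
  simp [abs_of_pos Real.pi_pos]

theorem two_pi_I_ne_zero : (2 * Real.pi * Complex.I : ℂ) ≠ 0 := by
  simp [Real.pi_ne_zero]

/-- Van der Corput's second derivative test with a smooth amplitude. -/
theorem norm_integral_amplitude_le {a b Λ M M₁ : ℝ} (hab : a ≤ b) (hΛ : 0 < Λ)
    {φ φ₁ φ₂ ψ ψ₁ : ℝ → ℝ}
    (hφ : ∀ x ∈ Set.Icc a b, HasDerivAt φ (φ₁ x) x)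
    (hφ₁ : ∀ x ∈ Set.Icc a b, HasDerivAt φ₁ (φ₂ x) x)
    (hφ₂ : ContinuousOn φ₂ (Set.Icc a b))
    (hψ : ∀ x ∈ Set.Icc a b, HasDerivAt ψ (ψ₁ x) x)
    (hψ₁ : ContinuousOn ψ₁ (Set.Icc a b))
    (hlow : ∀ x ∈ Set.Icc a b, Λ ≤ φ₂ x)
    (hM : ∀ x ∈ Set.Icc a b, |ψ x| ≤ M) (hM₁ : ∀ x ∈ Set.Icc a b, |ψ₁ x| ≤ M₁) :
    ‖∫ x in a..b, (ψ x : ℂ) * expTwoPiI (φ x)‖ ≤ 9 * (M + (b - a) * M₁) / √Λ := by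
  set s := √Λ with hs
  have hs0 : 0 < s := Real.sqrt_pos.mpr hΛ
  have hsq : s ^ 2 = Λ := Real.sq_sqrt hΛ.le
  -- `h = φ₁/(φ₁² + Λ)` replaces `1/φ₁` in the integration by parts. It is regular at a stationary
  -- point, so the interval need not be cut there; the price is the extra term `ψ Λ/D`, controlled
  -- by `φ₂/D` because `Λ ≤ φ₂`.
  set D : ℝ → ℝ := fun x => φ₁ x ^ 2 + s ^ 2 with hD
  have hD0 : ∀ x, 0 < D x := fun x => by simp only [hD]; positivity
  set h : ℝ → ℝ := fun x => φ₁ x / D x with hh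
  set h₁ : ℝ → ℝ := fun x => φ₂ x * (s ^ 2 - φ₁ x ^ 2) / D x ^ 2 with hh1
  have hcφ : ContinuousOn φ (Set.Icc a b) := fun x hx => (hφ x hx).continuousAt.continuousWithinAt
  have hcφ₁ : ContinuousOn φ₁ (Set.Icc a b) :=
    fun x hx => (hφ₁ x hx).continuousAt.continuousWithinAt
  have hcψ : ContinuousOn ψ (Set.Icc a b) := fun x hx => (hψ x hx).continuousAt.continuousWithinAt
  have hcD : ContinuousOn D (Set.Icc a b) := by fun_prop
  have hder_h : ∀ x ∈ Set.Icc a b, HasDerivAt h (h₁ x) x := by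
    intro x hx
    have h1 := (hφ₁ x hx)
    have h2 : HasDerivAt D (2 * φ₁ x * φ₂ x) x := by
      have := (h1.pow 2).add_const (s ^ 2)
      convert! this using 1
      simp
    convert! h1.div h2 (hD0 x).ne' using 1
    simp only [hh1, hD]
    congr 1
    ring
  have hh_le : ∀ x, |h x| ≤ 1 / (2 * s) := by
    intro x
    simp only [hh]
    rw [abs_div, abs_of_pos (hD0 x), div_le_div_iff₀ (hD0 x) (by positivity), one_mul]
    simp only [hD]
    rw [← sq_abs (φ₁ x)]
    nlinarith [sq_nonneg (|φ₁ x| - s)]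
  have hh1_le : ∀ x ∈ Set.Icc a b, |h₁ x| ≤ φ₂ x / D x := by
    intro x hx
    have hφpos : 0 < φ₂ x := hΛ.trans_le (hlow x hx)
    simp only [hh1]
    rw [abs_div, abs_mul, abs_of_pos hφpos, abs_of_pos (pow_pos (hD0 x) 2),
      div_le_div_iff₀ (pow_pos (hD0 x) 2) (hD0 x)]
    have : |s ^ 2 - φ₁ x ^ 2| ≤ D x := by
      simp only [hD]
      rw [abs_le]; constructor <;> nlinarith [sq_nonneg s, sq_nonneg (φ₁ x)]
    calc φ₂ x * |s ^ 2 - φ₁ x ^ 2| * D x ≤ φ₂ x * D x * D x := by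
          have := (hD0 x).le; gcongr
      _ = φ₂ x * D x ^ 2 := by ring
  set V : ℝ → ℂ := fun x => ((ψ x * h x : ℝ) : ℂ) * expTwoPiI (φ x) / (2 * Real.pi * Complex.I)
    with hV
  set V' : ℝ → ℂ := fun x => (((ψ₁ x * h x + ψ x * h₁ x : ℝ) : ℂ) * expTwoPiI (φ x) +
      ((ψ x * h x : ℝ) : ℂ) * (2 * Real.pi * Complex.I * φ₁ x * expTwoPiI (φ x))) /
      (2 * Real.pi * Complex.I) with hV'
  have hderV : ∀ x ∈ Set.uIcc a b, HasDerivAt V (V' x) x := by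
    intro x hx
    rw [Set.uIcc_of_le hab] at hx
    exact ((((hψ x hx).mul (hder_h x hx)).ofReal_comp).mul (hφ x hx).expTwoPiI).div_const _
  have hch : ContinuousOn h (Set.Icc a b) := fun x hx =>
    (hder_h x hx).continuousAt.continuousWithinAt
  have hch₁ : ContinuousOn h₁ (Set.Icc a b) := by
    apply ContinuousOn.div (by fun_prop) (by fun_prop)
    intro x _
    exact (pow_pos (hD0 x) 2).ne'
  have hce : ContinuousOn (fun x => expTwoPiI (φ x)) (Set.Icc a b) :=
    continuous_expTwoPiI.comp_continuousOn hcφ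
  have hofR : ∀ {f : ℝ → ℝ}, ContinuousOn f (Set.Icc a b) →
      ContinuousOn (fun x => (f x : ℂ)) (Set.Icc a b) := fun hf =>
    Complex.continuous_ofReal.comp_continuousOn hf
  have hcV' : ContinuousOn V' (Set.Icc a b) := by
    have e1 := hofR ((hψ₁.mul hch).add (hcψ.mul hch₁))
    have e2 := hofR (hcψ.mul hch)
    have e3 := hofR hcφ₁
    exact ((e1.mul hce).add (e2.mul ((continuousOn_const.mul e3).mul hce))).div_const _
  have hcf : ContinuousOn (fun x => (ψ x : ℂ) * expTwoPiI (φ x)) (Set.Icc a b) :=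
    (hofR hcψ).mul hce
  have hiV' : IntervalIntegrable V' volume a b := by
    apply ContinuousOn.intervalIntegrable; rwa [Set.uIcc_of_le hab]
  have hif : IntervalIntegrable (fun x => (ψ x : ℂ) * expTwoPiI (φ x)) volume a b := by
    apply ContinuousOn.intervalIntegrable; rwa [Set.uIcc_of_le hab]
  have hFTC := intervalIntegral.integral_eq_sub_of_hasDerivAt hderV hiV'
  have hsplit : ∫ x in a..b, (ψ x : ℂ) * expTwoPiI (φ x) =
      (V b - V a) - ∫ x in a..b, (V' x - (ψ x : ℂ) * expTwoPiI (φ x)) := by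
    rw [intervalIntegral.integral_sub hiV' hif, hFTC]; ring
  have hM0 : 0 ≤ M := (abs_nonneg _).trans (hM a ⟨le_rfl, hab⟩)
  have hM10 : 0 ≤ M₁ := (abs_nonneg _).trans (hM₁ a ⟨le_rfl, hab⟩)
  have hπ := Real.pi_gt_three
  have hVle : ∀ x ∈ Set.Icc a b, ‖V x‖ ≤ M / s := by
    intro x hx
    simp only [hV]
    rw [norm_div, norm_two_pi_I, norm_mul, norm_expTwoPiI, mul_one, Complex.norm_real,
      Real.norm_eq_abs, abs_mul]
    have : |ψ x| * |h x| ≤ M * (1 / (2 * s)) :=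
      mul_le_mul (hM x hx) (hh_le x) (abs_nonneg _) hM0
    calc |ψ x| * |h x| / (2 * Real.pi) ≤ M * (1 / (2 * s)) / (2 * Real.pi) := by gcongr
      _ = M / s * (1 / (4 * Real.pi)) := by field_simp; ring
      _ ≤ M / s * 1 := by
          gcongr
          rw [div_le_one (by positivity)]; linarith
      _ = M / s := mul_one _
  have hdiff : ∀ x ∈ Set.Icc a b, ‖V' x - (ψ x : ℂ) * expTwoPiI (φ x)‖ ≤
      M₁ / s + 2 * M * (φ₂ x / D x) := by
    intro x hx
    have hφpos : 0 < φ₂ x := hΛ.trans_le (hlow x hx)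
    have hDx := hD0 x
    have e : V' x - (ψ x : ℂ) * expTwoPiI (φ x) =
        (((ψ₁ x * h x + ψ x * h₁ x : ℝ) : ℂ) / (2 * Real.pi * Complex.I) -
          ((ψ x * (s ^ 2 / D x) : ℝ) : ℂ)) * expTwoPiI (φ x) := by
      have : (ψ x : ℂ) = ((ψ x * h x * φ₁ x + ψ x * (s ^ 2 / D x) : ℝ) : ℂ) := by
        congr 1
        simp only [hh]
        field_simp
        simp only [hD]
      simp only [hV']
      conv_lhs => rw [this]
      have h2 := two_pi_I_ne_zero
      have h3 : (Real.pi : ℂ) ≠ 0 := by simp [Real.pi_ne_zero]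
      push_cast
      field_simp
      ring
    rw [e, norm_mul, norm_expTwoPiI, mul_one]
    refine (norm_sub_le _ _).trans ?_
    rw [norm_div, norm_two_pi_I, Complex.norm_real, Complex.norm_real, Real.norm_eq_abs,
      Real.norm_eq_abs]
    have b1 : |ψ₁ x * h x + ψ x * h₁ x| ≤ M₁ * (1 / (2 * s)) + M * (φ₂ x / D x) := by
      refine (abs_add_le _ _).trans ?_
      rw [abs_mul, abs_mul]
      exact add_le_add (mul_le_mul (hM₁ x hx) (hh_le x) (abs_nonneg _) hM10)
        (mul_le_mul (hM x hx) (hh1_le x hx) (abs_nonneg _) hM0)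
    have b2 : |ψ x * (s ^ 2 / D x)| ≤ M * (φ₂ x / D x) := by
      rw [abs_mul, abs_of_pos (div_pos (pow_pos hs0 2) hDx)]
      refine mul_le_mul (hM x hx) ?_ (by positivity) hM0
      have := hlow x hx
      rw [hsq]
      gcongr
    have b3 : |ψ₁ x * h x + ψ x * h₁ x| / (2 * Real.pi) ≤ M₁ / s + M * (φ₂ x / D x) := by
      have hq : 0 ≤ M₁ * (1 / (2 * s)) + M * (φ₂ x / D x) := by positivity
      calc |ψ₁ x * h x + ψ x * h₁ x| / (2 * Real.pi)
          ≤ (M₁ * (1 / (2 * s)) + M * (φ₂ x / D x)) / (2 * Real.pi) := by gcongr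
        _ ≤ M₁ * (1 / (2 * s)) + M * (φ₂ x / D x) := div_le_self hq (by linarith)
        _ ≤ M₁ / s + M * (φ₂ x / D x) := by
            gcongr
            rw [mul_one_div]
            gcongr
            linarith
    linarith
  -- `φ₂/D` is the derivative of `arctan(φ₁/s)/s`, hence integrates to at most `π/s` whatever the
  -- size of `φ₂` and of the interval.
  have hatan : ∀ x ∈ Set.uIcc a b, HasDerivAt
      (fun x => M₁ / s * x + 2 * M * (Real.arctan (φ₁ x / s) / s))
      (M₁ / s + 2 * M * (φ₂ x / D x)) x := by
    intro x hx
    rw [Set.uIcc_of_le hab] at hx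
    have h1 := (((hφ₁ x hx).div_const s).arctan).div_const s
    have h2 := ((hasDerivAt_id x).const_mul (M₁ / s)).add (h1.const_mul (2 * M))
    convert! h2 using 1
    rw [mul_one]
    congr 2
    simp only [hD]
    field_simp
    ring
  have hcbd : ContinuousOn (fun x => M₁ / s + 2 * M * (φ₂ x / D x)) (Set.Icc a b) := by
    refine continuousOn_const.add (continuousOn_const.mul (hφ₂.div hcD fun x _ => (hD0 x).ne'))
  have hibd : IntervalIntegrable (fun x => M₁ / s + 2 * M * (φ₂ x / D x)) volume a b := by
    apply ContinuousOn.intervalIntegrable; rwa [Set.uIcc_of_le hab]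
  have hbound : ‖∫ x in a..b, (V' x - (ψ x : ℂ) * expTwoPiI (φ x))‖ ≤
      M₁ / s * (b - a) + 2 * M * (Real.pi / s) := by
    have := intervalIntegral.norm_integral_le_of_norm_le hab
      (Filter.Eventually.of_forall fun x hx => hdiff x (Set.Ioc_subset_Icc_self hx)) hibd
    refine this.trans ?_
    rw [intervalIntegral.integral_eq_sub_of_hasDerivAt hatan hibd]
    have h1 := Real.arctan_lt_pi_div_two (φ₁ b / s)
    have h2 := Real.neg_pi_div_two_lt_arctan (φ₁ a / s)
    have h3 : Real.arctan (φ₁ b / s) / s - Real.arctan (φ₁ a / s) / s ≤ Real.pi / s := by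
      rw [← sub_div]; gcongr; linarith
    have h4 := mul_le_mul_of_nonneg_left h3 (by positivity : 0 ≤ 2 * M)
    linarith
  have hba : 0 ≤ b - a := sub_nonneg.mpr hab
  rw [hsplit]
  refine (norm_sub_le _ _).trans ?_
  refine (add_le_add ((norm_sub_le _ _).trans
    (add_le_add (hVle b ⟨hab, le_rfl⟩) (hVle a ⟨le_rfl, hab⟩))) hbound).trans ?_
  -- The final constant `9` comes from `2 + 2π < 9`.
  have hπ4 := Real.pi_lt_d2
  have e : M / s + M / s + (M₁ / s * (b - a) + 2 * M * (Real.pi / s)) =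
      ((2 + 2 * Real.pi) * M + (b - a) * M₁) / s := by
    field_simp; ring
  rw [e]
  gcongr
  nlinarith [mul_nonneg hba hM10]

/-- Integration by parts against a phase without stationary points. -/
theorem integral_mul_expTwoPiI_by_parts {a b : ℝ} (hab : a ≤ b) {φ φ₁ φ₂ ψ ψ₁ : ℝ → ℝ}
    (hφ : ∀ x ∈ Set.Icc a b, HasDerivAt φ (φ₁ x) x)
    (hφ₁ : ∀ x ∈ Set.Icc a b, HasDerivAt φ₁ (φ₂ x) x)
    (hφ₂ : ContinuousOn φ₂ (Set.Icc a b))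
    (hψ : ∀ x ∈ Set.Icc a b, HasDerivAt ψ (ψ₁ x) x)
    (hψ₁ : ContinuousOn ψ₁ (Set.Icc a b))
    (hne : ∀ x ∈ Set.Icc a b, φ₁ x ≠ 0) (ha : ψ a = 0) (hb : ψ b = 0) :
    ∫ x in a..b, (ψ x : ℂ) * expTwoPiI (φ x) = -(1 / (2 * Real.pi * Complex.I)) *
      ∫ x in a..b, ((ψ₁ x / φ₁ x - ψ x * φ₂ x / φ₁ x ^ 2 : ℝ) : ℂ) * expTwoPiI (φ x) := by
  have hcφ : ContinuousOn φ (Set.Icc a b) := fun x hx => (hφ x hx).continuousAt.continuousWithinAt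
  have hcφ₁ : ContinuousOn φ₁ (Set.Icc a b) :=
    fun x hx => (hφ₁ x hx).continuousAt.continuousWithinAt
  have hcψ : ContinuousOn ψ (Set.Icc a b) := fun x hx => (hψ x hx).continuousAt.continuousWithinAt
  have hce : ContinuousOn (fun x => expTwoPiI (φ x)) (Set.Icc a b) :=
    continuous_expTwoPiI.comp_continuousOn hcφ
  have hofR : ∀ {f : ℝ → ℝ}, ContinuousOn f (Set.Icc a b) →
      ContinuousOn (fun x => (f x : ℂ)) (Set.Icc a b) := fun hf =>
    Complex.continuous_ofReal.comp_continuousOn hf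
  have hcont : ContinuousOn (fun x => ψ₁ x / φ₁ x - ψ x * φ₂ x / φ₁ x ^ 2) (Set.Icc a b) :=
    (hψ₁.div hcφ₁ hne).sub ((hcψ.mul hφ₂).div (hcφ₁.pow 2) fun x hx => pow_ne_zero 2 (hne x hx))
  have hder : ∀ x ∈ Set.uIcc a b, HasDerivAt
      (fun x => ((ψ x / φ₁ x : ℝ) : ℂ) * expTwoPiI (φ x) / (2 * Real.pi * Complex.I))
      ((ψ x : ℂ) * expTwoPiI (φ x) + (1 / (2 * Real.pi * Complex.I)) *
        (((ψ₁ x / φ₁ x - ψ x * φ₂ x / φ₁ x ^ 2 : ℝ) : ℂ) * expTwoPiI (φ x))) x := by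
    intro x hx
    rw [Set.uIcc_of_le hab] at hx
    have h1 := ((hψ x hx).div (hφ₁ x hx) (hne x hx)).ofReal_comp
    have h2 := (h1.mul (hφ x hx).expTwoPiI).div_const (2 * Real.pi * Complex.I)
    convert! h2 using 1
    have h3 : (φ₁ x : ℂ) ≠ 0 := by exact_mod_cast hne x hx
    have h4 := two_pi_I_ne_zero
    have h5 : (Real.pi : ℂ) ≠ 0 := by simp [Real.pi_ne_zero]
    simp only [Pi.div_apply]
    push_cast
    field_simp
    ring
  have hi1 : IntervalIntegrable (fun x => (ψ x : ℂ) * expTwoPiI (φ x)) volume a b := by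
    apply ContinuousOn.intervalIntegrable
    rw [Set.uIcc_of_le hab]
    exact (hofR hcψ).mul hce
  have hi2 : IntervalIntegrable (fun x => (1 / (2 * Real.pi * Complex.I)) *
      (((ψ₁ x / φ₁ x - ψ x * φ₂ x / φ₁ x ^ 2 : ℝ) : ℂ) * expTwoPiI (φ x))) volume a b := by
    apply ContinuousOn.intervalIntegrable
    rw [Set.uIcc_of_le hab]
    exact continuousOn_const.mul ((hofR hcont).mul hce)
  have h := intervalIntegral.integral_eq_sub_of_hasDerivAt hder (hi1.add hi2)
  rw [intervalIntegral.integral_add hi1 hi2, intervalIntegral.integral_const_mul, ha, hb] at h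
  simp only [zero_div, Complex.ofReal_zero, zero_mul, sub_zero] at h
  linear_combination h

/-- Two integrations by parts for a phase with large derivative. -/
theorem norm_integral_nonstationary_le {a b W X : ℝ} (hab : a ≤ b) (hX : 0 < X)
    {φ φ₁ φ₂ φ₃ w w₁ w₂ : ℝ → ℝ}
    (hφ : ∀ x ∈ Set.Icc a b, HasDerivAt φ (φ₁ x) x)
    (hφ₁ : ∀ x ∈ Set.Icc a b, HasDerivAt φ₁ (φ₂ x) x)
    (hφ₂ : ∀ x ∈ Set.Icc a b, HasDerivAt φ₂ (φ₃ x) x)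
    (hφ₃ : ContinuousOn φ₃ (Set.Icc a b))
    (hw : ∀ x ∈ Set.Icc a b, HasDerivAt w (w₁ x) x)
    (hw₁ : ∀ x ∈ Set.Icc a b, HasDerivAt w₁ (w₂ x) x)
    (hw₂ : ContinuousOn w₂ (Set.Icc a b))
    (ha : w a = 0) (hb : w b = 0) (ha₁ : w₁ a = 0) (hb₁ : w₁ b = 0)
    (hlow : ∀ x ∈ Set.Icc a b, X ≤ |φ₁ x|)
    (hup₂ : ∀ x ∈ Set.Icc a b, |φ₂ x| ≤ X) (hup₃ : ∀ x ∈ Set.Icc a b, |φ₃ x| ≤ X)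
    (hW : ∀ x ∈ Set.Icc a b, |w x| ≤ W) (hW₁ : ∀ x ∈ Set.Icc a b, |w₁ x| ≤ W)
    (hW₂ : ∀ x ∈ Set.Icc a b, |w₂ x| ≤ W) :
    ‖∫ x in a..b, (w x : ℂ) * expTwoPiI (φ x)‖ ≤ W * (b - a) / X ^ 2 := by
  have hne : ∀ x ∈ Set.Icc a b, φ₁ x ≠ 0 := fun x hx h0 => by
    have := hlow x hx
    rw [h0, abs_zero] at this
    linarith
  have hcφ₁ : ContinuousOn φ₁ (Set.Icc a b) :=
    fun x hx => (hφ₁ x hx).continuousAt.continuousWithinAt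
  have hcφ₂ : ContinuousOn φ₂ (Set.Icc a b) :=
    fun x hx => (hφ₂ x hx).continuousAt.continuousWithinAt
  have hcw : ContinuousOn w (Set.Icc a b) := fun x hx => (hw x hx).continuousAt.continuousWithinAt
  have hcw₁ : ContinuousOn w₁ (Set.Icc a b) :=
    fun x hx => (hw₁ x hx).continuousAt.continuousWithinAt
  set ψ : ℝ → ℝ := fun x => w₁ x / φ₁ x - w x * φ₂ x / φ₁ x ^ 2 with hψdef
  set ψ₁ : ℝ → ℝ := fun x => w₂ x / φ₁ x - 2 * w₁ x * φ₂ x / φ₁ x ^ 2 - w x * φ₃ x / φ₁ x ^ 2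
    + 2 * w x * φ₂ x ^ 2 / φ₁ x ^ 3 with hψ₁def
  have hψ : ∀ x ∈ Set.Icc a b, HasDerivAt ψ (ψ₁ x) x := by
    intro x hx
    have hn := hne x hx
    have h1 := (hw₁ x hx).div (hφ₁ x hx) hn
    have h2 := ((hw x hx).mul (hφ₂ x hx)).div ((hφ₁ x hx).pow 2) (pow_ne_zero 2 hn)
    convert! h1.sub h2 using 1
    simp only [hψ₁def, Pi.mul_apply, Pi.pow_apply]
    field_simp
    push_cast
    ring
  have hcψ₁ : ContinuousOn ψ₁ (Set.Icc a b) := by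
    have n2 : ∀ x ∈ Set.Icc a b, φ₁ x ^ 2 ≠ 0 := fun x hx => pow_ne_zero 2 (hne x hx)
    have n3 : ∀ x ∈ Set.Icc a b, φ₁ x ^ 3 ≠ 0 := fun x hx => pow_ne_zero 3 (hne x hx)
    refine (((hw₂.div hcφ₁ hne).sub (ContinuousOn.div (by fun_prop) (by fun_prop) n2)).sub
      (ContinuousOn.div (by fun_prop) (by fun_prop) n2)).add
      (ContinuousOn.div (by fun_prop) (by fun_prop) n3)
  -- The amplitude `ψ` after the first integration by parts is a combination of `w` and `w₁`, so it
  -- vanishes at both ends again and the second one has no boundary terms either.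
  rw [integral_mul_expTwoPiI_by_parts hab hφ hφ₁ hcφ₂ hw hcw₁ hne ha hb,
    integral_mul_expTwoPiI_by_parts (ψ := ψ) hab hφ hφ₁ hcφ₂ hψ hcψ₁ hne
      (by simp [hψdef, ha, ha₁]) (by simp [hψdef, hb, hb₁])]
  rw [norm_mul, norm_mul, norm_neg, norm_div, norm_one, norm_two_pi_I]
  have hWn : 0 ≤ W := (abs_nonneg _).trans (hW a ⟨le_rfl, hab⟩)
  have hfin : ∀ x ∈ Set.uIoc a b,
      ‖((ψ₁ x / φ₁ x - ψ x * φ₂ x / φ₁ x ^ 2 : ℝ) : ℂ) * expTwoPiI (φ x)‖ ≤ 8 * W / X ^ 2 := by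
    intro x hx
    rw [Set.uIoc_of_le hab] at hx
    have hx := Set.Ioc_subset_Icc_self hx
    rw [norm_mul, norm_expTwoPiI, mul_one, Complex.norm_real, Real.norm_eq_abs]
    have hl := hlow x hx
    have h2 := hup₂ x hx
    have h3 := hup₃ x hx
    have hz := hW x hx
    have hz₁ := hW₁ x hx
    have hz₂ := hW₂ x hx
    have hp : 0 < |φ₁ x| := hX.trans_le hl
    have t : ∀ {u v : ℝ}, |u| ≤ W → |v| ≤ 1 → |u * v| ≤ W := fun {u v} hu hv => by
      rw [abs_mul]; nlinarith [abs_nonneg u, abs_nonneg v]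
    have r2 : |φ₂ x / φ₁ x| ≤ 1 := by rw [abs_div, div_le_one hp]; linarith
    have r3 : |φ₃ x / φ₁ x| ≤ 1 := by rw [abs_div, div_le_one hp]; linarith
    have r22 : |(φ₂ x / φ₁ x) ^ 2| ≤ 1 := by
      rw [abs_pow]; exact pow_le_one₀ (abs_nonneg _) r2
    have hn := hne x hx
    have e : ψ₁ x / φ₁ x - ψ x * φ₂ x / φ₁ x ^ 2 =
        (w₂ x - 3 * (w₁ x * (φ₂ x / φ₁ x)) - w x * (φ₃ x / φ₁ x) +
          3 * (w x * (φ₂ x / φ₁ x) ^ 2)) / φ₁ x ^ 2 := by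
      simp only [hψdef, hψ₁def]
      field_simp
      ring
    rw [e, abs_div, abs_pow]
    -- All ratios `φ₂/φ₁`, `φ₃/φ₁` are at most `1` in size, which leaves `1 + 3 + 1 + 3 = 8`; the
    -- factor `1/(2π)²` from the two integrations by parts absorbs it.
    have hnum : |w₂ x - 3 * (w₁ x * (φ₂ x / φ₁ x)) - w x * (φ₃ x / φ₁ x) +
          3 * (w x * (φ₂ x / φ₁ x) ^ 2)| ≤ 8 * W := by
      have a1 := abs_le.mp (t hz₁ r2)
      have a2 := abs_le.mp (t hz r3)
      have a3 := abs_le.mp (t hz r22)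
      have a4 := abs_le.mp hz₂
      rw [abs_le]; constructor <;> linarith [a1.1, a1.2, a2.1, a2.2, a3.1, a3.2, a4.1, a4.2]
    gcongr
  have hI := intervalIntegral.norm_integral_le_of_norm_le_const hfin
  rw [abs_of_nonneg (sub_nonneg.mpr hab)] at hI
  have hπ := Real.pi_gt_three
  calc 1 / (2 * Real.pi) * (1 / (2 * Real.pi) * _)
      ≤ 1 / (2 * Real.pi) * (1 / (2 * Real.pi) * (8 * W / X ^ 2 * (b - a))) := by gcongr
    _ = W * (b - a) / X ^ 2 * (2 / Real.pi ^ 2) := by field_simp; ring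
    _ ≤ W * (b - a) / X ^ 2 * 1 := by
        have : 0 ≤ b - a := sub_nonneg.mpr hab
        gcongr
        rw [div_le_one (by positivity)]
        nlinarith
    _ = _ := mul_one _

/-! ### Smooth cut-off functions -/

/-- A smooth cut-off `w` with its first two derivatives, equal to `1` on `[-1, 1]` and supported
in `[-2, 2]`. -/
structure IsCutoff (w w₁ w₂ : ℝ → ℝ) (W : ℝ) : Prop where
  hasDerivAt : ∀ x, HasDerivAt w (w₁ x) x
  hasDerivAt₁ : ∀ x, HasDerivAt w₁ (w₂ x) x
  continuous₂ : Continuous w₂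
  nonneg : ∀ x, 0 ≤ w x
  eq_one : ∀ x, |x| ≤ 1 → w x = 1
  eq_zero : ∀ x, 2 ≤ |x| → w x = 0
  bound : ∀ x, |w x| ≤ W
  bound₁ : ∀ x, |w₁ x| ≤ W
  bound₂ : ∀ x, |w₂ x| ≤ W
  one_le : 1 ≤ W

theorem exists_isCutoff : ∃ (w w₁ w₂ : ℝ → ℝ) (W : ℝ), IsCutoff w w₁ w₂ W := by
  let f : ContDiffBump (0 : ℝ) := ⟨1, 2, one_pos, one_lt_two⟩
  have hf : ContDiff ℝ 2 f := f.contDiff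
  have hs : HasCompactSupport f := f.hasCompactSupport
  have h1 : ContDiff ℝ 1 (deriv f) := by
    have : ContDiff ℝ (1 + 1) f := by exact_mod_cast hf
    exact (contDiff_succ_iff_deriv.mp this).2.2
  have h2 : Continuous (deriv (deriv f)) := h1.continuous_deriv le_rfl
  obtain ⟨W0, hW0⟩ := f.continuous.bounded_above_of_compact_support hs
  obtain ⟨W1, hW1⟩ := h1.continuous.bounded_above_of_compact_support hs.deriv
  obtain ⟨W2, hW2⟩ := h2.bounded_above_of_compact_support hs.deriv.deriv
  refine ⟨f, deriv f, deriv (deriv f), |W0| + |W1| + |W2| + 1, ?_, ?_, h2, fun x => f.nonneg,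
    ?_, ?_, ?_, ?_, ?_, ?_⟩
  · exact fun x => (hf.differentiable (by norm_num) x).hasDerivAt
  · exact fun x => (h1.differentiable (by norm_num) x).hasDerivAt
  · intro x hx
    apply f.one_of_mem_closedBall
    simpa [Metric.mem_closedBall, Real.dist_eq] using hx
  · intro x hx
    have hx' : x ∉ Function.support f := by
      rw [f.support_eq]
      simpa [Metric.mem_ball, Real.dist_eq] using hx
    simpa using hx'
  · intro x
    have := hW0 x
    rw [Real.norm_eq_abs] at this
    linarith [le_abs_self W0, abs_nonneg W1, abs_nonneg W2]
  · intro x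
    have := hW1 x
    rw [Real.norm_eq_abs] at this
    linarith [le_abs_self W1, abs_nonneg W0, abs_nonneg W2]
  · intro x
    have := hW2 x
    rw [Real.norm_eq_abs] at this
    linarith [le_abs_self W2, abs_nonneg W0, abs_nonneg W1]
  · linarith [abs_nonneg W0, abs_nonneg W1, abs_nonneg W2]

namespace IsCutoff

variable {w w₁ w₂ : ℝ → ℝ} {W : ℝ}

theorem continuous (h : IsCutoff w w₁ w₂ W) : Continuous w :=
  continuous_iff_continuousAt.mpr fun x => (h.hasDerivAt x).continuousAt

theorem continuous₁ (h : IsCutoff w w₁ w₂ W) : Continuous w₁ :=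
  continuous_iff_continuousAt.mpr fun x => (h.hasDerivAt₁ x).continuousAt

/-- A zero of the nonnegative function `w` is a minimum. This covers the end points `|x| = 2` as
well. -/
theorem eq_zero₁ (h : IsCutoff w w₁ w₂ W) {x : ℝ} (hx : 2 ≤ |x|) : w₁ x = 0 := by
  refine IsLocalMin.hasDerivAt_eq_zero (f := w) ?_ (h.hasDerivAt x)
  refine Filter.Eventually.of_forall fun y => ?_
  rw [h.eq_zero x hx]
  exact h.nonneg y

end IsCutoff

/-! ### Averages of a function along a segment -/

/-- The moment `∫₀¹ θⁿ g(b + θ(y - b)) dθ`. -/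
noncomputable def segMoment (n : ℕ) (g : ℝ → ℝ) (b y : ℝ) : ℝ :=
  ∫ θ in (0 : ℝ)..1, θ ^ n * g (b + θ * (y - b))

theorem segment_mem_Ioo {Y b y θ : ℝ} (hb : b ∈ Set.Ioo (-Y) Y) (hy : y ∈ Set.Ioo (-Y) Y)
    (hθ : θ ∈ Set.Icc (0 : ℝ) 1) : b + θ * (y - b) ∈ Set.Ioo (-Y) Y := by
  have := (convex_Ioo (-Y) Y) hb hy (sub_nonneg.mpr hθ.2) hθ.1 (by ring : (1 - θ) + θ = 1)
  convert! this using 1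
  simp only [smul_eq_mul]
  ring

theorem continuousOn_segment {Y b y : ℝ} {g : ℝ → ℝ} (n : ℕ) (hg : ContinuousOn g (Set.Ioo (-Y) Y))
    (hb : b ∈ Set.Ioo (-Y) Y) (hy : y ∈ Set.Ioo (-Y) Y) :
    ContinuousOn (fun θ : ℝ => θ ^ n * g (b + θ * (y - b))) (Set.Icc 0 1) := by
  refine ContinuousOn.mul (by fun_prop) (hg.comp (by fun_prop) fun θ hθ => ?_)
  exact segment_mem_Ioo hb hy hθ

theorem aestronglyMeasurable_segment {Y b y : ℝ} {g : ℝ → ℝ} (n : ℕ)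
    (hg : ContinuousOn g (Set.Ioo (-Y) Y))
    (hb : b ∈ Set.Ioo (-Y) Y) (hy : y ∈ Set.Ioo (-Y) Y) :
    AEStronglyMeasurable (fun θ : ℝ => θ ^ n * g (b + θ * (y - b)))
      (volume.restrict (Set.uIoc (0 : ℝ) 1)) := by
  rw [Set.uIoc_of_le zero_le_one]
  exact ((continuousOn_segment n hg hb hy).mono Set.Ioc_subset_Icc_self).aestronglyMeasurable
    measurableSet_Ioc

theorem intervalIntegrable_segment {Y b y : ℝ} {g : ℝ → ℝ} (n : ℕ)
    (hg : ContinuousOn g (Set.Ioo (-Y) Y))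
    (hb : b ∈ Set.Ioo (-Y) Y) (hy : y ∈ Set.Ioo (-Y) Y) :
    IntervalIntegrable (fun θ : ℝ => θ ^ n * g (b + θ * (y - b))) volume 0 1 := by
  apply ContinuousOn.intervalIntegrable
  rw [Set.uIcc_of_le zero_le_one]
  exact continuousOn_segment n hg hb hy

theorem abs_segment_le {Y b y M θ : ℝ} {g : ℝ → ℝ} (n : ℕ)
    (hM : ∀ x ∈ Set.Ioo (-Y) Y, |g x| ≤ M)
    (hb : b ∈ Set.Ioo (-Y) Y) (hy : y ∈ Set.Ioo (-Y) Y) (hθ : θ ∈ Set.Icc (0 : ℝ) 1) :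
    |θ ^ n * g (b + θ * (y - b))| ≤ M := by
  have h1 := hM _ (segment_mem_Ioo hb hy hθ)
  rw [abs_mul, abs_pow, abs_of_nonneg hθ.1]
  have h2 : θ ^ n ≤ 1 := pow_le_one₀ hθ.1 hθ.2
  have h3 : 0 ≤ θ ^ n := pow_nonneg hθ.1 n
  nlinarith [abs_nonneg (g (b + θ * (y - b)))]

theorem abs_segMoment_le {Y b y M : ℝ} {g : ℝ → ℝ} (n : ℕ)
    (hM : ∀ x ∈ Set.Ioo (-Y) Y, |g x| ≤ M)
    (hb : b ∈ Set.Ioo (-Y) Y) (hy : y ∈ Set.Ioo (-Y) Y) : |segMoment n g b y| ≤ M := by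
  have := intervalIntegral.norm_integral_le_of_norm_le_const (a := 0) (b := 1) (C := M)
    (f := fun θ : ℝ => θ ^ n * g (b + θ * (y - b))) fun θ hθ => by
      rw [Set.uIoc_of_le zero_le_one] at hθ
      exact abs_segment_le n hM hb hy (Set.Ioc_subset_Icc_self hθ)
  simpa [segMoment] using this

/-- Differentiation under the integral sign: by the chain rule each derivative in `y` produces one
more factor `θ`. -/
theorem hasDerivAt_segMoment {Y b y M : ℝ} {g g₁ : ℝ → ℝ} (n : ℕ)
    (hg : ∀ x ∈ Set.Ioo (-Y) Y, HasDerivAt g (g₁ x) x)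
    (hg₁ : ContinuousOn g₁ (Set.Ioo (-Y) Y)) (hM : ∀ x ∈ Set.Ioo (-Y) Y, |g₁ x| ≤ M)
    (hb : b ∈ Set.Ioo (-Y) Y) (hy : y ∈ Set.Ioo (-Y) Y) :
    HasDerivAt (segMoment n g b) (segMoment (n + 1) g₁ b y) y := by
  have hgc : ContinuousOn g (Set.Ioo (-Y) Y) := fun x hx =>
    (hg x hx).continuousAt.continuousWithinAt
  refine (intervalIntegral.hasDerivAt_integral_of_dominated_loc_of_deriv_le (bound := fun _ => M)
    (F := fun y θ => θ ^ n * g (b + θ * (y - b)))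
    (F' := fun y θ => θ ^ (n + 1) * g₁ (b + θ * (y - b))) (isOpen_Ioo.mem_nhds hy)
    ?_ (intervalIntegrable_segment n hgc hb hy) (aestronglyMeasurable_segment _ hg₁ hb hy)
    ?_ (by simp) ?_).2
  · filter_upwards [isOpen_Ioo.mem_nhds hy] with x hx
    exact aestronglyMeasurable_segment n hgc hb hx
  · refine Filter.Eventually.of_forall fun θ hθ x hx => ?_
    rw [Set.uIoc_of_le zero_le_one] at hθ
    exact abs_segment_le _ hM hb hx (Set.Ioc_subset_Icc_self hθ)
  · refine Filter.Eventually.of_forall fun θ hθ x hx => ?_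
    rw [Set.uIoc_of_le zero_le_one] at hθ
    have h1 := hg _ (segment_mem_Ioo hb hx (Set.Ioc_subset_Icc_self hθ))
    have h2 : HasDerivAt (fun y => b + θ * (y - b)) θ x := by
      simpa using (((hasDerivAt_id x).sub_const b).const_mul θ).const_add b
    have h3 := (h1.comp x h2).const_mul (θ ^ n)
    convert! h3 using 1
    ring

theorem continuousOn_segMoment {Y b M : ℝ} {g : ℝ → ℝ} (n : ℕ)
    (hg : ContinuousOn g (Set.Ioo (-Y) Y)) (hM : ∀ x ∈ Set.Ioo (-Y) Y, |g x| ≤ M)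
    (hb : b ∈ Set.Ioo (-Y) Y) : ContinuousOn (segMoment n g b) (Set.Ioo (-Y) Y) := by
  intro y hy
  refine ContinuousAt.continuousWithinAt ?_
  refine intervalIntegral.continuousAt_of_dominated_interval (bound := fun _ => M) ?_ ?_ (by simp) ?_
  · filter_upwards [isOpen_Ioo.mem_nhds hy] with x hx
    exact aestronglyMeasurable_segment n hg hb hx
  · filter_upwards [isOpen_Ioo.mem_nhds hy] with x hx
    refine Filter.Eventually.of_forall fun θ hθ => ?_
    rw [Set.uIoc_of_le zero_le_one] at hθ
    exact abs_segment_le n hM hb hx (Set.Ioc_subset_Icc_self hθ)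
  · refine Filter.Eventually.of_forall fun θ hθ => ?_
    rw [Set.uIoc_of_le zero_le_one] at hθ
    have h1 := (hg.continuousAt (isOpen_Ioo.mem_nhds
      (segment_mem_Ioo hb hy (Set.Ioc_subset_Icc_self hθ))))
    have h2 : ContinuousAt (fun y => b + θ * (y - b)) y := by fun_prop
    exact continuousAt_const.mul (ContinuousAt.comp (f := fun y => b + θ * (y - b)) h1 h2)

/-- The zeroth moment of `g'` is the divided difference `(g y - g b)/(y - b)`, written so that it
remains differentiable, with explicit bounds, across `y = b`. -/
theorem sub_mul_segMoment {Y b y : ℝ} {g g₁ : ℝ → ℝ}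
    (hg : ∀ x ∈ Set.Ioo (-Y) Y, HasDerivAt g (g₁ x) x)
    (hg₁ : ContinuousOn g₁ (Set.Ioo (-Y) Y))
    (hb : b ∈ Set.Ioo (-Y) Y) (hy : y ∈ Set.Ioo (-Y) Y) :
    (y - b) * segMoment 0 g₁ b y = g y - g b := by
  have hder : ∀ θ ∈ Set.uIcc (0 : ℝ) 1, HasDerivAt (fun θ => g (b + θ * (y - b)))
      ((y - b) * (θ ^ 0 * g₁ (b + θ * (y - b)))) θ := by
    intro θ hθ
    rw [Set.uIcc_of_le zero_le_one] at hθ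
    have h1 := hg _ (segment_mem_Ioo hb hy hθ)
    have h2 : HasDerivAt (fun θ => b + θ * (y - b)) (y - b) θ := by
      simpa using ((hasDerivAt_id θ).mul_const (y - b)).const_add b
    have h3 := h1.comp θ h2
    convert! h3 using 1
    ring
  have h := intervalIntegral.integral_eq_sub_of_hasDerivAt hder
    ((intervalIntegrable_segment 0 hg₁ hb hy).const_mul _)
  rw [intervalIntegral.integral_const_mul] at h
  rw [segMoment, h]
  simp

theorem le_segMoment_zero {Y b y Λ : ℝ} {g : ℝ → ℝ} (hg : ContinuousOn g (Set.Ioo (-Y) Y))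
    (hΛ : ∀ x ∈ Set.Ioo (-Y) Y, Λ ≤ g x)
    (hb : b ∈ Set.Ioo (-Y) Y) (hy : y ∈ Set.Ioo (-Y) Y) : Λ ≤ segMoment 0 g b y := by
  have : ∫ θ in (0 : ℝ)..1, Λ ≤ segMoment 0 g b y := by
    refine intervalIntegral.integral_mono_on zero_le_one (by simp)
      (intervalIntegrable_segment 0 hg hb hy) fun θ hθ => ?_
    rw [pow_zero, one_mul]
    exact hΛ _ (segment_mem_Ioo hb hy hθ)
  simpa using this

/-! ### The amplitude of a stationary phase integral -/

/-- The oscillatory integral with stationary point `b`, normalised by its critical value. -/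
noncomputable def statAmp (w φ φ₁ : ℝ → ℝ) (b : ℝ) : ℂ :=
  ∫ y in (-2 : ℝ)..2, (w y : ℂ) * expTwoPiI (φ y - φ b - φ₁ b * (y - b))

/-- A phase on `(-Y, Y)` with four derivatives of size `Λ`. -/
structure IsPhase (φ φ₁ φ₂ φ₃ φ₄ : ℝ → ℝ) (Y Λ K : ℝ) : Prop where
  hasDerivAt : ∀ x ∈ Set.Ioo (-Y) Y, HasDerivAt φ (φ₁ x) x
  hasDerivAt₁ : ∀ x ∈ Set.Ioo (-Y) Y, HasDerivAt φ₁ (φ₂ x) x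
  hasDerivAt₂ : ∀ x ∈ Set.Ioo (-Y) Y, HasDerivAt φ₂ (φ₃ x) x
  hasDerivAt₃ : ∀ x ∈ Set.Ioo (-Y) Y, HasDerivAt φ₃ (φ₄ x) x
  continuousOn₄ : ContinuousOn φ₄ (Set.Ioo (-Y) Y)
  lower₂ : ∀ x ∈ Set.Ioo (-Y) Y, Λ ≤ φ₂ x
  upper₂ : ∀ x ∈ Set.Ioo (-Y) Y, |φ₂ x| ≤ K * Λ
  upper₃ : ∀ x ∈ Set.Ioo (-Y) Y, |φ₃ x| ≤ K * Λ
  upper₄ : ∀ x ∈ Set.Ioo (-Y) Y, |φ₄ x| ≤ K * Λ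
  pos : 0 < Λ
  one_le : 1 ≤ K
  two_lt : 2 < Y

namespace IsPhase

variable {φ φ₁ φ₂ φ₃ φ₄ w w₁ w₂ : ℝ → ℝ} {Y Λ K W : ℝ}

theorem Icc_subset (hp : IsPhase φ φ₁ φ₂ φ₃ φ₄ Y Λ K) :
    Set.Icc (-2 : ℝ) 2 ⊆ Set.Ioo (-Y) Y := fun x hx => by
  have := hp.two_lt
  exact ⟨by linarith [hx.1], by linarith [hx.2]⟩

theorem continuousOn (hp : IsPhase φ φ₁ φ₂ φ₃ φ₄ Y Λ K) : ContinuousOn φ (Set.Ioo (-Y) Y) :=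
  fun x hx => (hp.hasDerivAt x hx).continuousAt.continuousWithinAt

theorem continuousOn₁ (hp : IsPhase φ φ₁ φ₂ φ₃ φ₄ Y Λ K) : ContinuousOn φ₁ (Set.Ioo (-Y) Y) :=
  fun x hx => (hp.hasDerivAt₁ x hx).continuousAt.continuousWithinAt

theorem continuousOn₂ (hp : IsPhase φ φ₁ φ₂ φ₃ φ₄ Y Λ K) : ContinuousOn φ₂ (Set.Ioo (-Y) Y) :=
  fun x hx => (hp.hasDerivAt₂ x hx).continuousAt.continuousWithinAt

theorem continuousOn₃ (hp : IsPhase φ φ₁ φ₂ φ₃ φ₄ Y Λ K) : ContinuousOn φ₃ (Set.Ioo (-Y) Y) :=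
  fun x hx => (hp.hasDerivAt₃ x hx).continuousAt.continuousWithinAt

/-- The phase with its linear part removed. -/
theorem hasDerivAt_sub_linear (hp : IsPhase φ φ₁ φ₂ φ₃ φ₄ Y Λ K) (c μ b : ℝ) {x : ℝ}
    (hx : x ∈ Set.Ioo (-Y) Y) :
    HasDerivAt (fun y => φ y - c - μ * (y - b)) (φ₁ x - μ) x := by
  have h := ((hp.hasDerivAt x hx).sub_const c).sub
    (((hasDerivAt_id x).sub_const b).const_mul μ)
  convert! h using 1
  simp

/-- A linear term does not change the second derivative, so the bound is uniform in `c`, `μ` and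
`b`. It serves for the Fourier integrals at every frequency and for `statAmp`. -/
theorem norm_integral_sub_linear_le (hp : IsPhase φ φ₁ φ₂ φ₃ φ₄ Y Λ K) {ψ ψ₁ : ℝ → ℝ} {M M₁ : ℝ}
    (hψ : ∀ x ∈ Set.Icc (-2 : ℝ) 2, HasDerivAt ψ (ψ₁ x) x)
    (hψ₁ : ContinuousOn ψ₁ (Set.Icc (-2) 2))
    (hM : ∀ x ∈ Set.Icc (-2 : ℝ) 2, |ψ x| ≤ M) (hM₁ : ∀ x ∈ Set.Icc (-2 : ℝ) 2, |ψ₁ x| ≤ M₁)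
    (c μ b : ℝ) :
    ‖∫ y in (-2 : ℝ)..2, (ψ y : ℂ) * expTwoPiI (φ y - c - μ * (y - b))‖ ≤
      9 * (M + 4 * M₁) / √Λ := by
  have h := norm_integral_amplitude_le (a := -2) (b := 2) (by norm_num) hp.pos
    (φ := fun y => φ y - c - μ * (y - b)) (φ₁ := fun y => φ₁ y - μ) (φ₂ := φ₂)
    (fun x hx => hp.hasDerivAt_sub_linear c μ b (hp.Icc_subset hx))
    (fun x hx => (hp.hasDerivAt₁ x (hp.Icc_subset hx)).sub_const μ)
    (hp.continuousOn₂.mono hp.Icc_subset) hψ hψ₁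
    (fun x hx => hp.lower₂ x (hp.Icc_subset hx)) hM hM₁
  have e : (2 - (-2) : ℝ) = 4 := by norm_num
  rwa [e] at h

theorem norm_cutoff_integral_le (hp : IsPhase φ φ₁ φ₂ φ₃ φ₄ Y Λ K) (hw : IsCutoff w w₁ w₂ W)
    (c μ b : ℝ) :
    ‖∫ y in (-2 : ℝ)..2, (w y : ℂ) * expTwoPiI (φ y - c - μ * (y - b))‖ ≤ 45 * W / √Λ := by
  have h := hp.norm_integral_sub_linear_le (fun x _ => hw.hasDerivAt x) hw.continuous₁.continuousOn
    (fun x _ => hw.bound x) (fun x _ => hw.bound₁ x) c μ b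
  refine h.trans (le_of_eq ?_)
  ring

theorem norm_statAmp_le (hp : IsPhase φ φ₁ φ₂ φ₃ φ₄ Y Λ K) (hw : IsCutoff w w₁ w₂ W) (b : ℝ) :
    ‖statAmp w φ φ₁ b‖ ≤ 45 * W / √Λ :=
  hp.norm_cutoff_integral_le hw _ _ _

/-- In the derivative of the phase with respect to `b` the two terms `φ₁ b` cancel and only `-φ₂ b
(y - b)` remains. -/
theorem hasDerivAt_statAmp (hp : IsPhase φ φ₁ φ₂ φ₃ φ₄ Y Λ K) (hw : IsCutoff w w₁ w₂ W) {b : ℝ}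
    (hb : b ∈ Set.Ioo (-Y) Y) :
    HasDerivAt (statAmp w φ φ₁) (∫ y in (-2 : ℝ)..2, (w y : ℂ) * (2 * Real.pi * Complex.I *
      ((-(φ₂ b * (y - b)) : ℝ) : ℂ) * expTwoPiI (φ y - φ b - φ₁ b * (y - b)))) b := by
  have hsub := hp.Icc_subset
  have hY := hp.two_lt
  have hcw := hw.continuous
  have hφc := hp.continuousOn.mono hsub
  have hcont : ∀ b, ContinuousOn (fun y => (w y : ℂ) * expTwoPiI (φ y - φ b - φ₁ b * (y - b)))
      (Set.Icc (-2 : ℝ) 2) := by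
    intro b
    refine ContinuousOn.mul (Continuous.continuousOn (by fun_prop)) ?_
    exact continuous_expTwoPiI.comp_continuousOn (by fun_prop)
  have hcont' : ∀ b, ContinuousOn (fun y => (w y : ℂ) * (2 * Real.pi * Complex.I *
      ((-(φ₂ b * (y - b)) : ℝ) : ℂ) * expTwoPiI (φ y - φ b - φ₁ b * (y - b))))
      (Set.Icc (-2 : ℝ) 2) := by
    intro b
    refine ContinuousOn.mul (Continuous.continuousOn (by fun_prop)) ?_
    refine ContinuousOn.mul (Continuous.continuousOn (by fun_prop)) ?_
    exact continuous_expTwoPiI.comp_continuousOn (by fun_prop)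
  have hmeas : ∀ {f : ℝ → ℂ}, ContinuousOn f (Set.Icc (-2 : ℝ) 2) →
      AEStronglyMeasurable f (volume.restrict (Set.uIoc (-2 : ℝ) 2)) := by
    intro f hf
    rw [Set.uIoc_of_le (by norm_num)]
    exact (hf.mono Set.Ioc_subset_Icc_self).aestronglyMeasurable measurableSet_Ioc
  refine (intervalIntegral.hasDerivAt_integral_of_dominated_loc_of_deriv_le
    (bound := fun _ => W * (2 * Real.pi * (K * Λ * (Y + Y))))
    (F := fun b y => (w y : ℂ) * expTwoPiI (φ y - φ b - φ₁ b * (y - b)))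
    (F' := fun b y => (w y : ℂ) * (2 * Real.pi * Complex.I *
      ((-(φ₂ b * (y - b)) : ℝ) : ℂ) * expTwoPiI (φ y - φ b - φ₁ b * (y - b))))
    (isOpen_Ioo.mem_nhds hb) ?_ ?_ (hmeas (hcont' b)) ?_ (by simp) ?_).2
  · exact Filter.Eventually.of_forall fun b => hmeas (hcont b)
  · apply ContinuousOn.intervalIntegrable
    rw [Set.uIcc_of_le (by norm_num)]
    exact hcont b
  · refine Filter.Eventually.of_forall fun y hy x hx => ?_
    rw [Set.uIoc_of_le (by norm_num)] at hy
    have hy' := hsub (Set.Ioc_subset_Icc_self hy)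
    rw [norm_mul, norm_mul, norm_mul, norm_two_pi_I, norm_expTwoPiI, mul_one, Complex.norm_real,
      Complex.norm_real, Real.norm_eq_abs, Real.norm_eq_abs, abs_neg, abs_mul]
    have h1 := hw.bound y
    have h2 := hp.upper₂ x hx
    have h3 : |y - x| ≤ Y + Y := by
      rw [abs_le]; constructor <;> linarith [hx.1, hx.2, hy'.1, hy'.2]
    have h4 : |φ₂ x| * |y - x| ≤ K * Λ * (Y + Y) :=
      mul_le_mul h2 h3 (abs_nonneg _) ((abs_nonneg _).trans h2)
    have h5 : 0 ≤ 2 * Real.pi := by positivity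
    exact mul_le_mul h1 (mul_le_mul_of_nonneg_left h4 h5) (by positivity)
      (zero_le_one.trans hw.one_le)
  · refine Filter.Eventually.of_forall fun y hy x hx => ?_
    have h1 : HasDerivAt (fun b => φ y - φ b - φ₁ b * (y - b)) (-(φ₂ x * (y - x))) x := by
      have e1 := (hp.hasDerivAt x hx).const_sub (φ y)
      have e2 := (hp.hasDerivAt₁ x hx).mul ((hasDerivAt_id x).const_sub y)
      convert! e1.sub e2 using 1
      simp
    exact (h1.expTwoPiI).const_mul _

/-- The factor `y - b` vanishes at the stationary point and compensates the size of `φ₂ b`. Write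
`φ₁ y - φ₁ b = (y - b) p(y)` with a divided difference `p ≥ Λ`; then `2πi (y - b) e(R)` is `1/p`
times the derivative of `e(R)`, and integration by parts leaves the amplitude `(w/p)'`, of order
`1/Λ`. The derivative is therefore no larger in order than `statAmp` itself. -/
theorem norm_deriv_statAmp_le (hp : IsPhase φ φ₁ φ₂ φ₃ φ₄ Y Λ K) (hw : IsCutoff w w₁ w₂ W) {b : ℝ}
    (hb : b ∈ Set.Ioo (-Y) Y) :
    ‖∫ y in (-2 : ℝ)..2, (w y : ℂ) * (2 * Real.pi * Complex.I *
      ((-(φ₂ b * (y - b)) : ℝ) : ℂ) * expTwoPiI (φ y - φ b - φ₁ b * (y - b)))‖ ≤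
      234 * K ^ 3 * W / √Λ := by
  have hsub := hp.Icc_subset
  have hΛ := hp.pos
  have hK := hp.one_le
  have hW := hw.one_le
  set p : ℝ → ℝ := segMoment 0 φ₂ b with hpdef
  set p₁ : ℝ → ℝ := segMoment 1 φ₃ b
  set p₂ : ℝ → ℝ := segMoment 2 φ₄ b
  have hpd : ∀ x ∈ Set.Icc (-2 : ℝ) 2, HasDerivAt p (p₁ x) x := fun x hx =>
    hasDerivAt_segMoment 0 hp.hasDerivAt₂ hp.continuousOn₃ hp.upper₃ hb (hsub hx)
  have hpd₁ : ∀ x ∈ Set.Icc (-2 : ℝ) 2, HasDerivAt p₁ (p₂ x) x := fun x hx =>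
    hasDerivAt_segMoment 1 hp.hasDerivAt₃ hp.continuousOn₄ hp.upper₄ hb (hsub hx)
  have hpc₂ : ContinuousOn p₂ (Set.Icc (-2 : ℝ) 2) :=
    (continuousOn_segMoment 2 hp.continuousOn₄ hp.upper₄ hb).mono hsub
  have hplow : ∀ x ∈ Set.Icc (-2 : ℝ) 2, Λ ≤ p x := fun x hx =>
    le_segMoment_zero hp.continuousOn₂ hp.lower₂ hb (hsub hx)
  have hpos : ∀ x ∈ Set.Icc (-2 : ℝ) 2, 0 < p x := fun x hx => hΛ.trans_le (hplow x hx)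
  have hp₁up : ∀ x ∈ Set.Icc (-2 : ℝ) 2, |p₁ x| ≤ K * Λ := fun x hx =>
    abs_segMoment_le 1 hp.upper₃ hb (hsub hx)
  have hp₂up : ∀ x ∈ Set.Icc (-2 : ℝ) 2, |p₂ x| ≤ K * Λ := fun x hx =>
    abs_segMoment_le 2 hp.upper₄ hb (hsub hx)
  have hpid : ∀ x ∈ Set.Icc (-2 : ℝ) 2, (x - b) * p x = φ₁ x - φ₁ b := fun x hx =>
    sub_mul_segMoment hp.hasDerivAt₁ hp.continuousOn₂ hb (hsub hx)
  have hpc : ContinuousOn p (Set.Icc (-2 : ℝ) 2) :=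
    fun x hx => (hpd x hx).continuousAt.continuousWithinAt
  have hpc₁ : ContinuousOn p₁ (Set.Icc (-2 : ℝ) 2) :=
    fun x hx => (hpd₁ x hx).continuousAt.continuousWithinAt
  have hcw := hw.continuous
  have hcw₁ := hw.continuous₁
  have hcw₂ := hw.continuous₂
  set ψ : ℝ → ℝ := fun x => w₁ x / p x - w x * p₁ x / p x ^ 2 with hψdef
  set ψ₁ : ℝ → ℝ := fun x => w₂ x / p x - 2 * w₁ x * p₁ x / p x ^ 2 - w x * p₂ x / p x ^ 2
    + 2 * w x * p₁ x ^ 2 / p x ^ 3 with hψ₁def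
  have hwp : ∀ x ∈ Set.Icc (-2 : ℝ) 2, HasDerivAt (fun x => w x / p x) (ψ x) x := by
    intro x hx
    have hn := (hpos x hx).ne'
    convert! (hw.hasDerivAt x).div (hpd x hx) hn using 1
    simp only [hψdef]
    field_simp
  have hψ : ∀ x ∈ Set.Icc (-2 : ℝ) 2, HasDerivAt ψ (ψ₁ x) x := by
    intro x hx
    have hn := (hpos x hx).ne'
    have h1 := (hw.hasDerivAt₁ x).div (hpd x hx) hn
    have h2 := ((hw.hasDerivAt x).mul (hpd₁ x hx)).div ((hpd x hx).pow 2) (pow_ne_zero 2 hn)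
    convert! h1.sub h2 using 1
    simp only [hψ₁def, Pi.mul_apply, Pi.pow_apply]
    field_simp
    push_cast
    ring
  have n1 : ∀ x ∈ Set.Icc (-2 : ℝ) 2, p x ≠ 0 := fun x hx => (hpos x hx).ne'
  have n2 : ∀ x ∈ Set.Icc (-2 : ℝ) 2, p x ^ 2 ≠ 0 := fun x hx => pow_ne_zero 2 (n1 x hx)
  have n3 : ∀ x ∈ Set.Icc (-2 : ℝ) 2, p x ^ 3 ≠ 0 := fun x hx => pow_ne_zero 3 (n1 x hx)
  have hcψ : ContinuousOn ψ (Set.Icc (-2 : ℝ) 2) :=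
    fun x hx => (hψ x hx).continuousAt.continuousWithinAt
  have hcψ₁ : ContinuousOn ψ₁ (Set.Icc (-2 : ℝ) 2) :=
    (((ContinuousOn.div (by fun_prop) (by fun_prop) n1).sub
      (ContinuousOn.div (by fun_prop) (by fun_prop) n2)).sub
      (ContinuousOn.div (by fun_prop) (by fun_prop) n2)).add
      (ContinuousOn.div (by fun_prop) (by fun_prop) n3)
  have hinv : ∀ x ∈ Set.Icc (-2 : ℝ) 2, |1 / p x| ≤ 1 / Λ := by
    intro x hx
    rw [abs_of_pos (one_div_pos.mpr (hpos x hx))]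
    exact one_div_le_one_div_of_le hΛ (hplow x hx)
  have hr : ∀ {u : ℝ}, |u| ≤ K * Λ → ∀ x ∈ Set.Icc (-2 : ℝ) 2, |u / p x| ≤ K := by
    intro u hu x hx
    rw [abs_div, abs_of_pos (hpos x hx), div_le_iff₀ (hpos x hx)]
    exact hu.trans (mul_le_mul_of_nonneg_left (hplow x hx) (by linarith))
  have hprod : ∀ {u v B : ℝ}, |u| ≤ W → |v| ≤ B → |u * v| ≤ W * B := fun {u v B} hu hv => by
    rw [abs_mul]; exact mul_le_mul hu hv (abs_nonneg _) (by linarith)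
  have hKK : K ≤ K ^ 2 := by nlinarith
  have hM : ∀ x ∈ Set.Icc (-2 : ℝ) 2, |ψ x| ≤ 2 * W * K ^ 2 / Λ := by
    intro x hx
    have hn := n1 x hx
    have e : ψ x = (w₁ x - w x * (p₁ x / p x)) * (1 / p x) := by
      simp only [hψdef]; field_simp
    have a1 := abs_le.mp (hw.bound₁ x)
    have a2 := abs_le.mp (hprod (hw.bound x) (hr (hp₁up x hx) x hx))
    have h1 : |w₁ x - w x * (p₁ x / p x)| ≤ 2 * W * K ^ 2 := by
      rw [abs_le]; constructor <;> nlinarith [a1.1, a1.2, a2.1, a2.2]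
    rw [e, abs_mul, ← mul_one_div (2 * W * K ^ 2)]
    exact mul_le_mul h1 (hinv x hx) (abs_nonneg _) (by positivity)
  have hM₁ : ∀ x ∈ Set.Icc (-2 : ℝ) 2, |ψ₁ x| ≤ 6 * W * K ^ 2 / Λ := by
    intro x hx
    have hn := n1 x hx
    have e : ψ₁ x = (w₂ x - 2 * (w₁ x * (p₁ x / p x)) - w x * (p₂ x / p x) +
        2 * (w x * (p₁ x / p x) ^ 2)) * (1 / p x) := by
      simp only [hψ₁def]; field_simp
    have b1 := hr (hp₁up x hx) x hx
    have b11 : |(p₁ x / p x) ^ 2| ≤ K ^ 2 := by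
      rw [abs_pow]; gcongr
    have a1 := abs_le.mp (hw.bound₂ x)
    have a2 := abs_le.mp (hprod (hw.bound₁ x) b1)
    have a3 := abs_le.mp (hprod (hw.bound x) (hr (hp₂up x hx) x hx))
    have a4 := abs_le.mp (hprod (hw.bound x) b11)
    have hWK : W ≤ W * K := by nlinarith
    have hWKK : W * K ≤ W * K ^ 2 := by nlinarith
    have h1 : |w₂ x - 2 * (w₁ x * (p₁ x / p x)) - w x * (p₂ x / p x) +
        2 * (w x * (p₁ x / p x) ^ 2)| ≤ 6 * W * K ^ 2 := by
      rw [abs_le]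
      constructor <;> linarith [a1.1, a1.2, a2.1, a2.2, a3.1, a3.2, a4.1, a4.2]
    rw [e, abs_mul, ← mul_one_div (6 * W * K ^ 2)]
    exact mul_le_mul h1 (hinv x hx) (abs_nonneg _) (by positivity)
  have hosc := hp.norm_integral_sub_linear_le hψ hcψ₁ hM hM₁ (φ b) (φ₁ b) b
  set R : ℝ → ℝ := fun y => φ y - φ b - φ₁ b * (y - b) with hR
  have hcR : ContinuousOn R (Set.Icc (-2 : ℝ) 2) := by
    have := hp.continuousOn.mono hsub
    fun_prop
  have hce : ContinuousOn (fun y => expTwoPiI (R y)) (Set.Icc (-2 : ℝ) 2) :=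
    continuous_expTwoPiI.comp_continuousOn hcR
  have hder : ∀ x ∈ Set.uIcc (-2 : ℝ) 2, HasDerivAt
      (fun y => ((w y / p y : ℝ) : ℂ) * expTwoPiI (R y))
      ((ψ x : ℂ) * expTwoPiI (R x) +
        (w x : ℂ) * (2 * Real.pi * Complex.I * ((x - b : ℝ) : ℂ) * expTwoPiI (R x))) x := by
    intro x hx
    rw [Set.uIcc_of_le (by norm_num)] at hx
    have h1 := ((hwp x hx).ofReal_comp).mul
      (hp.hasDerivAt_sub_linear (φ b) (φ₁ b) b (hsub hx)).expTwoPiI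
    convert! h1 using 1
    congr 1
    rw [← hpid x hx]
    have hn : (p x : ℂ) ≠ 0 := by exact_mod_cast n1 x hx
    push_cast
    field_simp
    rfl
  have hofR : ∀ {f : ℝ → ℝ}, ContinuousOn f (Set.Icc (-2 : ℝ) 2) →
      ContinuousOn (fun x => (f x : ℂ)) (Set.Icc (-2 : ℝ) 2) := fun hf =>
    Complex.continuous_ofReal.comp_continuousOn hf
  have hi1 : IntervalIntegrable (fun x => (ψ x : ℂ) * expTwoPiI (R x)) volume (-2) 2 := by
    apply ContinuousOn.intervalIntegrable
    rw [Set.uIcc_of_le (by norm_num)]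
    exact (hofR hcψ).mul hce
  have hi2 : IntervalIntegrable (fun x => (w x : ℂ) * (2 * Real.pi * Complex.I * ((x - b : ℝ) : ℂ)
      * expTwoPiI (R x))) volume (-2) 2 := by
    apply ContinuousOn.intervalIntegrable
    rw [Set.uIcc_of_le (by norm_num)]
    refine ContinuousOn.mul (Continuous.continuousOn (by fun_prop)) (ContinuousOn.mul
      (Continuous.continuousOn (by fun_prop)) hce)
  have hFTC := intervalIntegral.integral_eq_sub_of_hasDerivAt hder (hi1.add hi2)
  rw [intervalIntegral.integral_add hi1 hi2, hw.eq_zero 2 (by norm_num),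
    hw.eq_zero (-2) (by norm_num)] at hFTC
  simp only [zero_div, Complex.ofReal_zero, zero_mul, sub_zero] at hFTC
  have hfin : ∫ y in (-2 : ℝ)..2, (w y : ℂ) * (2 * Real.pi * Complex.I *
      ((-(φ₂ b * (y - b)) : ℝ) : ℂ) * expTwoPiI (R y)) =
      (φ₂ b : ℂ) * ∫ y in (-2 : ℝ)..2, (ψ y : ℂ) * expTwoPiI (R y) := by
    have h1 : ∫ y in (-2 : ℝ)..2, (w y : ℂ) * (2 * Real.pi * Complex.I *
        ((-(φ₂ b * (y - b)) : ℝ) : ℂ) * expTwoPiI (R y)) = ∫ y in (-2 : ℝ)..2, -(φ₂ b : ℂ) *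
        ((w y : ℂ) * (2 * Real.pi * Complex.I * ((y - b : ℝ) : ℂ) * expTwoPiI (R y))) := by
      refine intervalIntegral.integral_congr fun y _ => ?_
      push_cast
      ring
    rw [h1, intervalIntegral.integral_const_mul]
    linear_combination (-(φ₂ b : ℂ)) * hFTC
  have hgoal : ‖(φ₂ b : ℂ) * ∫ y in (-2 : ℝ)..2, (ψ y : ℂ) * expTwoPiI (R y)‖ ≤
      234 * K ^ 3 * W / √Λ := by
    rw [norm_mul, Complex.norm_real, Real.norm_eq_abs]
    -- Here `234 = 9 (2 + 4 · 6)`, from the bounds `2WK²/Λ` and `6WK²/Λ` for `ψ` and `ψ₁`; the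
    -- factor `KΛ` bounds `φ₂ b`.
    refine (mul_le_mul (hp.upper₂ b hb) hosc (norm_nonneg _) (by positivity)).trans (le_of_eq ?_)
    field_simp
    ring
  rw [← hfin] at hgoal
  exact hgoal

theorem norm_statAmp_sub_le (hp : IsPhase φ φ₁ φ₂ φ₃ φ₄ Y Λ K) (hw : IsCutoff w w₁ w₂ W) {b b' : ℝ}
    (hb : b ∈ Set.Ioo (-Y) Y) (hb' : b' ∈ Set.Ioo (-Y) Y) :
    ‖statAmp w φ φ₁ b' - statAmp w φ φ₁ b‖ ≤ 234 * K ^ 3 * W / √Λ * |b' - b| := by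
  have := (convex_Ioo (-Y) Y).norm_image_sub_le_of_norm_hasDerivWithin_le
    (fun x hx => (hp.hasDerivAt_statAmp hw hx).hasDerivWithinAt)
    (fun x hx => hp.norm_deriv_statAmp_le hw hx) hb hb'
  simpa using this

end IsPhase

/-! ### Truncated Poisson summation -/

theorem summable_int_inv_one_add_sq (h₀ : ℤ) :
    Summable fun h : ℤ => 1 / (1 + ((h : ℝ) - h₀) ^ 2) := by
  obtain ⟨C, -, hC⟩ := sum_int_inv_one_add_sq_bound
  refine summable_of_sum_le (c := C) (fun h => by positivity) fun s => ?_
  have := hC (s.image fun h => h - h₀)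
  rw [Finset.sum_image (fun a _ b _ h => by simpa using h)] at this
  simpa using this

/-- Summability and the truncation error both follow from inverse square decay off `S`; the shift
`h₀` allows this decay to be centred at any integer. -/
theorem norm_tsum_sub_sum_le {J : ℤ → ℂ} {S : Finset ℤ} {E C : ℝ} (h₀ : ℤ) (hE : 0 ≤ E)
    (hC : ∀ s : Finset ℤ, ∑ h ∈ s, 1 / (1 + (h : ℝ) ^ 2) ≤ C)
    (hJ : ∀ m ∉ S, ‖J m‖ ≤ E * (1 / (1 + ((m : ℝ) - h₀) ^ 2))) :
    Summable J ∧ ‖∑' m, J m - ∑ m ∈ S, J m‖ ≤ E * C := by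
  have hs : Summable J := by
    refine Summable.of_norm_bounded_eventually ((summable_int_inv_one_add_sq h₀).mul_left E) ?_
    filter_upwards [S.finite_toSet.compl_mem_cofinite] with m hm
    exact hJ m (by simpa using hm)
  refine ⟨hs, ?_⟩
  have hlim : Filter.Tendsto (fun T : Finset ℤ => ‖∑ m ∈ T, J m - ∑ m ∈ S, J m‖) Filter.atTop
      (nhds ‖∑' m, J m - ∑ m ∈ S, J m‖) := (hs.hasSum.sub_const _).norm
  refine le_of_tendsto hlim ?_
  filter_upwards [Filter.eventually_ge_atTop S] with T hT
  rw [← Finset.sum_sdiff hT, add_sub_cancel_right]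
  refine (norm_sum_le _ _).trans ?_
  refine (Finset.sum_le_sum fun m hm => hJ m (Finset.mem_sdiff.mp hm).2).trans ?_
  rw [← Finset.mul_sum]
  refine mul_le_mul_of_nonneg_left ?_ hE
  have := hC ((T \ S).image fun h => h - h₀)
  rw [Finset.sum_image (fun a _ b _ h => by simpa using h)] at this
  simpa using this

/-- Compact support makes the decay hypothesis on the side of `g` trivial; only summability of the
transform has to be supplied. -/
theorem tsum_eq_tsum_fourier_of_support {g : ℝ → ℂ} {a b : ℝ} (hg : Continuous g)
    (hsupp : ∀ x, x ∉ Set.Icc a b → g x = 0) (hs : Summable fun n : ℤ => 𝓕 g n) :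
    ∑' n : ℤ, g n = ∑' n : ℤ, 𝓕 g n := by
  have hO : g =O[Filter.cocompact ℝ] fun x : ℝ => |x| ^ (-(2 : ℝ)) := by
    have : g =ᶠ[Filter.cocompact ℝ] fun _ => (0 : ℂ) := by
      filter_upwards [(isCompact_Icc (a := a) (b := b)).compl_mem_cocompact] with x hx
      exact hsupp x hx
    exact this.trans_isBigO (Asymptotics.isBigO_zero _ _)
  have h := Real.tsum_eq_tsum_fourier_of_rpow_decay_of_summable hg one_lt_two hO hs 0
  simpa using h

theorem fourier_eq_intervalIntegral {g : ℝ → ℂ} {a b : ℝ} (hab : a ≤ b)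
    (hsupp : ∀ x, x ∉ Set.Ioc a b → g x = 0) (ξ : ℝ) :
    𝓕 g ξ = ∫ x in a..b, expTwoPiI (-(ξ * x)) * g x := by
  rw [Real.fourier_eq', intervalIntegral.integral_of_le hab]
  have h0 : ∀ x, x ∉ Set.Ioc a b → expTwoPiI (-(ξ * x)) * g x = 0 := fun x hx => by
    rw [hsupp x hx, mul_zero]
  rw [setIntegral_eq_integral_of_forall_compl_eq_zero h0]
  refine integral_congr_ae (Filter.Eventually.of_forall fun x => ?_)
  simp only [smul_eq_mul]
  rw [expTwoPiI_eq_exp_mul_I]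
  congr 3
  simp

/-! ### Phases without stationary points -/

/-- On `[-2, 2]` the derivative `φ₁` moves by at most `2KΛ`, so it stays at distance at least `|φ₁ 0
- ν|/2` from `ν`. This bound also dominates the second and third derivatives, and two integrations
by parts apply. -/
theorem IsPhase.norm_cutoff_integral_le_inv_sq {φ φ₁ φ₂ φ₃ φ₄ w w₁ w₂ : ℝ → ℝ} {Y Λ K W : ℝ}
    (hp : IsPhase φ φ₁ φ₂ φ₃ φ₄ Y Λ K) (hw : IsCutoff w w₁ w₂ W) (ν : ℝ)
    (hν : 4 * K * Λ ≤ |φ₁ 0 - ν|) (c b : ℝ) :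
    ‖∫ y in (-2 : ℝ)..2, (w y : ℂ) * expTwoPiI (φ y - c - ν * (y - b))‖ ≤
      16 * W / (φ₁ 0 - ν) ^ 2 := by
  have hsub := hp.Icc_subset
  have hΛ := hp.pos
  have hK := hp.one_le
  have hKΛ : 0 < K * Λ := by positivity
  have hX : 0 < |φ₁ 0 - ν| / 2 := by linarith
  have h0 : (0 : ℝ) ∈ Set.Ioo (-Y) Y := hsub ⟨by norm_num, by norm_num⟩
  have hvar : ∀ x ∈ Set.Icc (-2 : ℝ) 2, |φ₁ x - φ₁ 0| ≤ 2 * (K * Λ) := by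
    intro x hx
    have := (convex_Ioo (-Y) Y).norm_image_sub_le_of_norm_hasDerivWithin_le
      (fun x hx => (hp.hasDerivAt₁ x hx).hasDerivWithinAt)
      (fun x hx => by simpa using hp.upper₂ x hx) h0 (hsub hx)
    rw [Real.norm_eq_abs, Real.norm_eq_abs, sub_zero] at this
    have h2 : |x| ≤ 2 := abs_le.mpr hx
    nlinarith
  have h := norm_integral_nonstationary_le (a := -2) (b := 2) (W := W) (X := |φ₁ 0 - ν| / 2)
    (by norm_num) hX (φ := fun y => φ y - c - ν * (y - b)) (φ₁ := fun y => φ₁ y - ν) (φ₂ := φ₂)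
    (φ₃ := φ₃) (w := w) (w₁ := w₁) (w₂ := w₂)
    (fun x hx => hp.hasDerivAt_sub_linear c ν b (hsub hx))
    (fun x hx => (hp.hasDerivAt₁ x (hsub hx)).sub_const ν)
    (fun x hx => hp.hasDerivAt₂ x (hsub hx))
    (hp.continuousOn₃.mono hsub) (fun x _ => hw.hasDerivAt x) (fun x _ => hw.hasDerivAt₁ x)
    hw.continuous₂.continuousOn (hw.eq_zero _ (by norm_num)) (hw.eq_zero _ (by norm_num))
    (hw.eq_zero₁ (by norm_num)) (hw.eq_zero₁ (by norm_num))
    (fun x hx => by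
      have h1 := hvar x hx
      have h2 : |φ₁ 0 - ν| ≤ |φ₁ x - ν| + |φ₁ x - φ₁ 0| := by
        have := abs_sub_abs_le_abs_sub (φ₁ 0 - ν) (φ₁ x - ν)
        have e : φ₁ 0 - ν - (φ₁ x - ν) = -(φ₁ x - φ₁ 0) := by ring
        rw [e, abs_neg] at this
        linarith
      linarith)
    (fun x hx => (hp.upper₂ x (hsub hx)).trans (by linarith))
    (fun x hx => (hp.upper₃ x (hsub hx)).trans (by linarith))
    (fun x _ => hw.bound x) (fun x _ => hw.bound₁ x) (fun x _ => hw.bound₂ x)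
  refine h.trans (le_of_eq ?_)
  rw [div_pow, sq_abs]
  have : (φ₁ 0 - ν) ≠ 0 := fun h0 => by rw [h0, abs_zero] at hX; linarith
  field_simp
  ring

/-! ### Power phases -/

/-- The ratio `x/N` lies between `1/(2κ)` and `2κ`; taking `|a|` in the constant treats both signs
of the exponent at once. -/
theorem rpow_comparable {κ : ℝ} (hκ : 1 ≤ κ) (a : ℝ) {N x : ℝ} (hN : 0 < N)
    (hx : x ∈ Set.Icc (N / 2) (2 * κ * N)) :
    N ^ a / (2 * κ) ^ |a| ≤ x ^ a ∧ x ^ a ≤ (2 * κ) ^ |a| * N ^ a := by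
  have hκ2 : 1 ≤ 2 * κ := by linarith
  have hx0 : 0 < x := lt_of_lt_of_le (by linarith) hx.1
  set u := x / N with hu
  have hu0 : 0 < u := div_pos hx0 hN
  have hxu : x = u * N := by rw [hu]; field_simp
  have hu1 : u ≤ 2 * κ := by rw [hu, div_le_iff₀ hN]; exact hx.2
  have hu2 : 1 / (2 * κ) ≤ u := by
    have : 1 / 2 ≤ u := by rw [hu, le_div_iff₀ hN]; linarith [hx.1]
    refine le_trans ?_ this
    gcongr
    linarith
  have key : (1 / (2 * κ)) ^ |a| ≤ u ^ a ∧ u ^ a ≤ (2 * κ) ^ |a| := by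
    rcases le_total 0 a with ha | ha
    · rw [abs_of_nonneg ha]
      exact ⟨Real.rpow_le_rpow (by positivity) hu2 ha, Real.rpow_le_rpow hu0.le hu1 ha⟩
    · rw [abs_of_nonpos ha]
      have e1 : u ^ a = (1 / u) ^ (-a) := by
        rw [one_div, Real.inv_rpow hu0.le, Real.rpow_neg hu0.le, inv_inv]
      rw [e1]
      refine ⟨Real.rpow_le_rpow (by positivity) ?_ (by linarith),
        Real.rpow_le_rpow (by positivity) ?_ (by linarith)⟩
      · exact one_div_le_one_div_of_le hu0 hu1
      · rw [one_div_le hu0 (by positivity)]; exact hu2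
  have hNa : 0 < N ^ a := Real.rpow_pos_of_pos hN a
  rw [hxu, Real.mul_rpow hu0.le hN.le]
  constructor
  · have : N ^ a / (2 * κ) ^ |a| = (1 / (2 * κ)) ^ |a| * N ^ a := by
      rw [Real.div_rpow zero_le_one (by positivity), Real.one_rpow]; ring
    rw [this]
    exact mul_le_mul_of_nonneg_right key.1 hNa.le
  · exact mul_le_mul_of_nonneg_right key.2 hNa.le

/-- The size of the first four derivatives of `x ^ k` on `[N / 2, 2κN]`. -/
theorem exists_rpow_deriv_bounds {k κ : ℝ} (hk : 1 < k) (hκ : 1 ≤ κ) :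
    ∃ K : ℝ, 1 ≤ K ∧ ∀ N x : ℝ, 0 < N → x ∈ Set.Icc (N / 2) (2 * κ * N) →
      (N ^ (k - 1) / K ≤ k * x ^ (k - 1) ∧ k * x ^ (k - 1) ≤ K * N ^ (k - 1)) ∧
      (N ^ (k - 2) / K ≤ k * (k - 1) * x ^ (k - 2) ∧
        k * (k - 1) * x ^ (k - 2) ≤ K * N ^ (k - 2)) ∧
      |k * (k - 1) * (k - 2) * x ^ (k - 3)| ≤ K * N ^ (k - 3) ∧
      |k * (k - 1) * (k - 2) * (k - 3) * x ^ (k - 4)| ≤ K * N ^ (k - 4) := by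
  set P : ℝ → ℝ := fun a => (2 * κ) ^ |a| with hP
  have hP1 : ∀ a, 1 ≤ P a := fun a => Real.one_le_rpow (by linarith) (abs_nonneg a)
  have hk1 : 0 < k - 1 := by linarith
  have low : ∀ {A a K N x : ℝ}, 0 < A → 0 < N → x ∈ Set.Icc (N / 2) (2 * κ * N) → 0 < K →
      P a / A ≤ K → N ^ a / K ≤ A * x ^ a := by
    intro A a K N x hA hN hx hK h
    have hNa : 0 < N ^ a := Real.rpow_pos_of_pos hN a
    have h1 := (rpow_comparable hκ a hN hx).1
    have hPa : 0 < P a := lt_of_lt_of_le one_pos (hP1 a)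
    calc N ^ a / K ≤ N ^ a / (P a / A) := by gcongr
      _ = A * (N ^ a / P a) := by field_simp
      _ ≤ A * x ^ a := by gcongr
  have up : ∀ {A a K N x : ℝ}, 0 < N → x ∈ Set.Icc (N / 2) (2 * κ * N) →
      |A| * P a ≤ K → |A * x ^ a| ≤ K * N ^ a := by
    intro A a K N x hN hx h
    have hNa : 0 < N ^ a := Real.rpow_pos_of_pos hN a
    have hx0 : 0 < x := lt_of_lt_of_le (by linarith) hx.1
    have h1 := (rpow_comparable hκ a hN hx).2
    rw [abs_mul, abs_of_pos (Real.rpow_pos_of_pos hx0 a)]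
    calc |A| * x ^ a ≤ |A| * (P a * N ^ a) := by gcongr
      _ = |A| * P a * N ^ a := by ring
      _ ≤ K * N ^ a := by gcongr
  have q : ∀ a, 0 < P a := fun a => lt_of_lt_of_le one_pos (hP1 a)
  set K := 1 + P (k - 1) / k + |k| * P (k - 1) + P (k - 2) / (k * (k - 1)) +
    |k * (k - 1)| * P (k - 2) + |k * (k - 1) * (k - 2)| * P (k - 3) +
    |k * (k - 1) * (k - 2) * (k - 3)| * P (k - 4) with hK
  have t1 : 0 < P (k - 1) / k := div_pos (q _) (by linarith)
  have t2 : 0 ≤ |k| * P (k - 1) := mul_nonneg (abs_nonneg _) (q _).le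
  have t3 : 0 < P (k - 2) / (k * (k - 1)) := div_pos (q _) (by nlinarith)
  have t4 : 0 ≤ |k * (k - 1)| * P (k - 2) := mul_nonneg (abs_nonneg _) (q _).le
  have t5 : 0 ≤ |k * (k - 1) * (k - 2)| * P (k - 3) := mul_nonneg (abs_nonneg _) (q _).le
  have t6 : 0 ≤ |k * (k - 1) * (k - 2) * (k - 3)| * P (k - 4) :=
    mul_nonneg (abs_nonneg _) (q _).le
  refine ⟨K, by linarith, fun N x hN hx => ⟨⟨?_, ?_⟩, ⟨?_, ?_⟩, ?_, ?_⟩⟩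
  · exact low (by linarith) hN hx (by linarith) (by linarith)
  · exact (le_abs_self _).trans (up hN hx (by linarith))
  · exact low (by nlinarith) hN hx (by linarith) (by linarith)
  · exact (le_abs_self _).trans (up hN hx (by linarith))
  · exact up hN hx (by linarith)
  · exact up hN hx (by linarith)

/-- The phase `t (c + L y) ^ k` and its derivatives. -/
theorem isPhase_rpow {k κ K N L c t Y : ℝ} (hK : 1 ≤ K) (hN : 0 < N)
    (hbd : ∀ N x : ℝ, 0 < N → x ∈ Set.Icc (N / 2) (2 * κ * N) →
      (N ^ (k - 1) / K ≤ k * x ^ (k - 1) ∧ k * x ^ (k - 1) ≤ K * N ^ (k - 1)) ∧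
      (N ^ (k - 2) / K ≤ k * (k - 1) * x ^ (k - 2) ∧
        k * (k - 1) * x ^ (k - 2) ≤ K * N ^ (k - 2)) ∧
      |k * (k - 1) * (k - 2) * x ^ (k - 3)| ≤ K * N ^ (k - 3) ∧
      |k * (k - 1) * (k - 2) * (k - 3) * x ^ (k - 4)| ≤ K * N ^ (k - 4))
    (hL : 0 < L) (hLN : L ≤ N) (ht : 0 < t) (hY : 2 < Y)
    (hin : ∀ y ∈ Set.Ioo (-Y) Y, c + L * y ∈ Set.Icc (N / 2) (2 * κ * N)) :
    IsPhase (fun y => t * (c + L * y) ^ k) (fun y => t * L * (k * (c + L * y) ^ (k - 1)))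
      (fun y => t * L ^ 2 * (k * (k - 1) * (c + L * y) ^ (k - 2)))
      (fun y => t * L ^ 3 * (k * (k - 1) * (k - 2) * (c + L * y) ^ (k - 3)))
      (fun y => t * L ^ 4 * (k * (k - 1) * (k - 2) * (k - 3) * (c + L * y) ^ (k - 4)))
      Y (t * N ^ (k - 2) * L ^ 2 / K) (K ^ 2) := by
  have hpos : ∀ y ∈ Set.Ioo (-Y) Y, 0 < c + L * y := fun y hy =>
    lt_of_lt_of_le (by linarith) (hin y hy).1
  have hlin : ∀ y, HasDerivAt (fun y => c + L * y) L y := fun y => by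
    simpa using ((hasDerivAt_id y).const_mul L).const_add c
  have hpow : ∀ (a : ℝ), ∀ y ∈ Set.Ioo (-Y) Y,
      HasDerivAt (fun y => (c + L * y) ^ a) (L * a * (c + L * y) ^ (a - 1)) y := fun a y hy =>
    (hlin y).rpow_const (Or.inl (hpos y hy).ne')
  have hNp : ∀ a : ℝ, 0 < N ^ a := fun a => Real.rpow_pos_of_pos hN a
  -- Each further derivative in `y` costs a factor of order `L/N ≤ 1`, so the third and fourth
  -- derivatives are no larger in order than the second.
  have e3 : L * N ^ (k - 3) ≤ N ^ (k - 2) := by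
    have : N ^ (k - 2) = N * N ^ (k - 3) := by
      rw [show k - 2 = 1 + (k - 3) by ring, Real.rpow_add hN, Real.rpow_one]
    rw [this]; exact mul_le_mul_of_nonneg_right hLN (hNp _).le
  have e4 : L * N ^ (k - 4) ≤ N ^ (k - 3) := by
    have : N ^ (k - 3) = N * N ^ (k - 4) := by
      rw [show k - 3 = 1 + (k - 4) by ring, Real.rpow_add hN, Real.rpow_one]
    rw [this]; exact mul_le_mul_of_nonneg_right hLN (hNp _).le
  have eK : K ^ 2 * (t * N ^ (k - 2) * L ^ 2 / K) = t * L ^ 2 * (K * N ^ (k - 2)) := by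
    field_simp
  have hK0 : 0 < K := by linarith
  constructor
  · intro y hy
    convert! (hpow k y hy).const_mul t using 1
    ring
  · intro y hy
    convert! ((hpow (k - 1) y hy).const_mul k).const_mul (t * L) using 1
    rw [show k - 1 - 1 = k - 2 by ring]; ring
  · intro y hy
    convert! ((hpow (k - 2) y hy).const_mul (k * (k - 1))).const_mul (t * L ^ 2) using 1
    rw [show k - 2 - 1 = k - 3 by ring]; ring
  · intro y hy
    convert! ((hpow (k - 3) y hy).const_mul (k * (k - 1) * (k - 2))).const_mul (t * L ^ 3) using 1
    rw [show k - 3 - 1 = k - 4 by ring]; ring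
  · intro y hy
    exact (((hpow (k - 4) y hy).const_mul _).const_mul _).continuousAt.continuousWithinAt
  · intro y hy
    have := (hbd N _ hN (hin y hy)).2.1.1
    calc t * N ^ (k - 2) * L ^ 2 / K = t * L ^ 2 * (N ^ (k - 2) / K) := by ring
      _ ≤ _ := by gcongr
  · intro y hy
    have h := (hbd N _ hN (hin y hy)).2.1
    have h0 : 0 < N ^ (k - 2) / K := div_pos (hNp _) hK0
    rw [eK, abs_mul, abs_of_pos (by positivity : 0 < t * L ^ 2), abs_of_pos (h0.trans_le h.1)]
    exact mul_le_mul_of_nonneg_left h.2 (by positivity)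
  · intro y hy
    have h := (hbd N _ hN (hin y hy)).2.2.1
    rw [eK, abs_mul, abs_of_pos (by positivity : 0 < t * L ^ 3)]
    calc _ ≤ t * L ^ 3 * (K * N ^ (k - 3)) := by gcongr
      _ = t * L ^ 2 * (K * (L * N ^ (k - 3))) := by ring
      _ ≤ _ := by gcongr
  · intro y hy
    have h := (hbd N _ hN (hin y hy)).2.2.2
    rw [eK, abs_mul, abs_of_pos (by positivity : 0 < t * L ^ 4)]
    calc _ ≤ t * L ^ 4 * (K * N ^ (k - 4)) := by gcongr
      _ = t * L ^ 3 * (K * (L * N ^ (k - 4))) := by ring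
      _ ≤ t * L ^ 3 * (K * N ^ (k - 3)) := by gcongr
      _ = t * L ^ 2 * (K * (L * N ^ (k - 3))) := by ring
      _ ≤ _ := by gcongr
  · have := hNp (k - 2); positivity
  · exact one_le_pow₀ hK
  · exact hY

/-! ### The B-process on short blocks -/

theorem sum_Ico_int_sub (f : ℤ → ℝ) {A B : ℤ} (hAB : A ≤ B) :
    ∑ m ∈ Finset.Ico A B, (f (m + 1) - f m) = f B - f A := by
  induction B, hAB using Int.leInduction with
  | base => simp
  | succ n hn ih =>
    have : Finset.Ico A (n + 1) = insert n (Finset.Ico A n) := by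
      ext x; simp only [Finset.mem_Ico, Finset.mem_insert]; omega
    rw [this, Finset.sum_insert (by simp), ih]
    ring

/-- The exponential sum over `n ^ k t` with smooth weights localised at distance `L` from `c`. -/
noncomputable def smoothBlock (w : ℝ → ℝ) (k L c t : ℝ) : ℂ :=
  ∑ n ∈ Finset.Icc ⌈c - 2 * L⌉ ⌊c + 2 * L⌋,
    (w (((n : ℝ) - c) / L) : ℂ) * expTwoPiI ((n : ℝ) ^ k * t)

/-- The parameter of the exponential sum dual to `∑ e(n ^ k t)`. -/
noncomputable def dualParam (k t : ℝ) : ℝ :=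
  -((k - 1) * k ^ (-(k / (k - 1)))) * t ^ (-(1 / (k - 1)))

/-! ### Fourier coefficients of a smooth block. -/

section

variable {w w₁ w₂ : ℝ → ℝ} {W k κ L c t : ℝ}

theorem cutoff_eq_zero_of_notMem (hw : IsCutoff w w₁ w₂ W) (hL : 0 < L) {x : ℝ}
    (hx : x ∉ Set.Ioo (c - 2 * L) (c + 2 * L)) : w ((x - c) / L) = 0 := by
  apply hw.eq_zero
  rw [abs_div, abs_of_pos hL, le_div_iff₀ hL]
  by_contra hcon
  rw [not_le, abs_lt] at hcon
  exact hx ⟨by linarith [hcon.1], by linarith [hcon.2]⟩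

theorem smoothBlock_eq_tsum (hw : IsCutoff w w₁ w₂ W) (hL : 0 < L) :
    smoothBlock w k L c t =
      ∑' n : ℤ, (fun x : ℝ => (w ((x - c) / L) : ℂ) * expTwoPiI (t * x ^ k)) n := by
  rw [smoothBlock, tsum_eq_sum (s := Finset.Icc ⌈c - 2 * L⌉ ⌊c + 2 * L⌋)]
  · refine Finset.sum_congr rfl fun n _ => ?_
    simp only [mul_comm t]
  · intro n hn
    have : ((n : ℤ) : ℝ) ∉ Set.Ioo (c - 2 * L) (c + 2 * L) := fun h =>
      hn (Finset.mem_Icc.mpr ⟨Int.ceil_le.mpr h.1.le, Int.le_floor.mpr h.2.le⟩)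
    simp [cutoff_eq_zero_of_notMem hw hL this]

theorem fourier_smoothBlock (hw : IsCutoff w w₁ w₂ W) (hL : 0 < L) (ξ : ℝ) :
    𝓕 (fun x : ℝ => (w ((x - c) / L) : ℂ) * expTwoPiI (t * x ^ k)) ξ =
      (L : ℂ) * expTwoPiI (-(ξ * c)) * ∫ y in (-2 : ℝ)..2,
        (w y : ℂ) * expTwoPiI (t * (c + L * y) ^ k - 0 - ξ * L * (y - 0)) := by
  rw [fourier_eq_intervalIntegral (a := c - 2 * L) (b := c + 2 * L) (by linarith)]
  · have h := intervalIntegral.integral_comp_mul_add (a := -2) (b := 2)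
      (fun x : ℝ => expTwoPiI (-(ξ * x)) * ((w ((x - c) / L) : ℂ) * expTwoPiI (t * x ^ k)))
      hL.ne' c
    have e1 : L * -2 + c = c - 2 * L := by ring
    have e2 : L * 2 + c = c + 2 * L := by ring
    rw [e1, e2] at h
    have h' : ∫ x in (c - 2 * L)..(c + 2 * L),
        expTwoPiI (-(ξ * x)) * ((w ((x - c) / L) : ℂ) * expTwoPiI (t * x ^ k)) =
        (L : ℂ) * ∫ y in (-2 : ℝ)..2, expTwoPiI (-(ξ * (L * y + c))) *
          ((w ((L * y + c - c) / L) : ℂ) * expTwoPiI (t * (L * y + c) ^ k)) := by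
      rw [h, Complex.real_smul, ← mul_assoc, ← Complex.ofReal_mul, mul_inv_cancel₀ hL.ne',
        Complex.ofReal_one, one_mul]
    rw [h', mul_assoc, ← intervalIntegral.integral_const_mul (expTwoPiI (-(ξ * c)))]
    congr 1
    refine intervalIntegral.integral_congr fun y _ => ?_
    have e3 : (L * y + c - c) / L = y := by field_simp; ring
    have e4 : t * (c + L * y) ^ k - 0 - ξ * L * (y - 0) = t * (c + L * y) ^ k + -(ξ * (L * y)) := by
      ring
    have e5 : -(ξ * (L * y + c)) = -(ξ * c) + -(ξ * (L * y)) := by ring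
    simp only [e3, e4, e5, expTwoPiI_add]
    rw [add_comm (L * y) c]
    ring
  · intro x hx
    have : x ∉ Set.Ioo (c - 2 * L) (c + 2 * L) := fun h => hx ⟨h.1, h.2.le⟩
    rw [cutoff_eq_zero_of_notMem hw hL this, Complex.ofReal_zero, zero_mul]

theorem continuous_smoothBlock_fun (hw : IsCutoff w w₁ w₂ W) (hk : 0 ≤ k) :
    Continuous fun x : ℝ => (w ((x - c) / L) : ℂ) * expTwoPiI (t * x ^ k) := by
  have h1 := hw.continuous
  have h2 : Continuous fun x : ℝ => x ^ k := Real.continuous_rpow_const hk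
  fun_prop

/-- Poisson summation for a smooth block, up to a bounded error. -/
theorem exists_norm_smoothBlock_sub_le (hw : IsCutoff w w₁ w₂ W) :
    ∃ E : ℝ, 0 < E ∧ ∀ {φ₁ φ₂ φ₃ φ₄ : ℝ → ℝ} {k L c t Y Λ K μ D : ℝ},
      IsPhase (fun y => t * (c + L * y) ^ k) φ₁ φ₂ φ₃ φ₄ Y Λ K → 0 ≤ k → 1 ≤ L →
      φ₁ 0 = μ * L → 1 ≤ D → 4 * K * Λ ≤ D * L →
      ‖smoothBlock w k L c t - ∑ m ∈ Finset.Icc ⌈μ - D⌉ ⌊μ + D⌋,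
        𝓕 (fun x : ℝ => (w ((x - c) / L) : ℂ) * expTwoPiI (t * x ^ k)) (m : ℝ)‖ ≤ E := by
  obtain ⟨C, hC0, hC⟩ := sum_int_inv_one_add_sq_bound
  have hW := hw.one_le
  refine ⟨80 * W * C, by positivity, ?_⟩
  intro φ₁ φ₂ φ₃ φ₄ k L c t Y Λ K μ D hp hk hL hμ hD1 hD
  have hL0 : 0 < L := by linarith
  set J : ℤ → ℂ := fun m =>
    𝓕 (fun x : ℝ => (w ((x - c) / L) : ℂ) * expTwoPiI (t * x ^ k)) (m : ℝ) with hJ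
  -- The condition `4KΛ ≤ D L` makes every frequency outside the window nonstationary. The scaling
  -- factor `L` meets `1/(L(μ - m))²`, and `1 ≤ L` leaves a bound independent of the block.
  have hJb : ∀ m ∉ Finset.Icc ⌈μ - D⌉ ⌊μ + D⌋,
      ‖J m‖ ≤ 80 * W * (1 / (1 + ((m : ℝ) - ⌊μ⌋) ^ 2)) := by
    intro m hm
    have hd : D ≤ |μ - m| := by
      by_contra hcon
      rw [not_le, abs_lt] at hcon
      exact hm (Finset.mem_Icc.mpr ⟨Int.ceil_le.mpr (by linarith [hcon.2]),
        Int.le_floor.mpr (by linarith [hcon.1])⟩)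
    have hφ : φ₁ 0 - m * L = (μ - m) * L := by rw [hμ]; ring
    have h4 : 4 * K * Λ ≤ |φ₁ 0 - m * L| := by
      rw [hφ, abs_mul, abs_of_pos hL0]
      exact hD.trans (mul_le_mul_of_nonneg_right hd hL0.le)
    have hI := hp.norm_cutoff_integral_le_inv_sq hw (m * L) h4 0 0
    have hd1 : 1 ≤ |μ - m| := hD1.trans hd
    have hsq : 0 < (μ - m) ^ 2 := by rw [← sq_abs]; positivity
    -- Since `1 ≤ D ≤ |μ - m|`, rounding `μ` to an integer costs at most a factor `2`.
    have hfl : ((m : ℝ) - ⌊μ⌋) ^ 2 ≤ (2 * |μ - m|) ^ 2 := by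
      rw [← sq_abs]
      have f1 := Int.floor_le μ
      have f2 := Int.lt_floor_add_one μ
      have : |(m : ℝ) - ⌊μ⌋| ≤ 2 * |μ - m| := by
        rw [abs_le]
        have := abs_le.mp (le_refl |μ - m|)
        constructor <;> linarith [this.1, this.2]
      gcongr
    have hfl' : 1 + ((m : ℝ) - ⌊μ⌋) ^ 2 ≤ 5 * (μ - m) ^ 2 := by
      rw [mul_pow, sq_abs] at hfl
      have : 1 ≤ (μ - m) ^ 2 := by rw [← sq_abs]; nlinarith
      linarith
    have hJm : J m = (L : ℂ) * expTwoPiI (-(m * c)) * ∫ y in (-2 : ℝ)..2,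
        (w y : ℂ) * expTwoPiI (t * (c + L * y) ^ k - 0 - m * L * (y - 0)) :=
      fourier_smoothBlock hw hL0 _
    rw [hJm, norm_mul, norm_mul, norm_expTwoPiI, mul_one, Complex.norm_real,
      Real.norm_of_nonneg hL0.le]
    calc L * _ ≤ L * (16 * W / (φ₁ 0 - m * L) ^ 2) := by gcongr
      _ = 16 * W / (L * (μ - m) ^ 2) := by rw [hφ]; field_simp
      _ ≤ 16 * W / (1 * ((1 + ((m : ℝ) - ⌊μ⌋) ^ 2) / 5)) := by
          gcongr
          linarith
      _ = 80 * W * (1 / (1 + ((m : ℝ) - ⌊μ⌋) ^ 2)) := by field_simp; ring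
  obtain ⟨hs, hle⟩ := norm_tsum_sub_sum_le ⌊μ⌋ (by positivity) hC hJb
  rw [smoothBlock_eq_tsum hw hL0, tsum_eq_tsum_fourier_of_support (a := c - 2 * L) (b := c + 2 * L)
    (continuous_smoothBlock_fun hw hk) _ hs]
  · exact hle
  · intro x hx
    have : x ∉ Set.Ioo (c - 2 * L) (c + 2 * L) := fun h => hx ⟨h.1.le, h.2.le⟩
    rw [cutoff_eq_zero_of_notMem hw hL0 this, Complex.ofReal_zero, zero_mul]

theorem norm_fourier_smoothBlock_le {φ₁ φ₂ φ₃ φ₄ : ℝ → ℝ} {Y Λ K : ℝ} (hw : IsCutoff w w₁ w₂ W)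
    (hp : IsPhase (fun y => t * (c + L * y) ^ k) φ₁ φ₂ φ₃ φ₄ Y Λ K) (hL : 0 < L) (ξ : ℝ) :
    ‖𝓕 (fun x : ℝ => (w ((x - c) / L) : ℂ) * expTwoPiI (t * x ^ k)) ξ‖ ≤ L * (45 * W / √Λ) := by
  rw [fourier_smoothBlock hw hL, norm_mul, norm_mul, norm_expTwoPiI, mul_one, Complex.norm_real,
    Real.norm_of_nonneg hL.le]
  exact mul_le_mul_of_nonneg_left (hp.norm_cutoff_integral_le hw _ _ _) hL.le

/-- The Fourier coefficient in terms of its stationary point. -/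
theorem fourier_smoothBlock_eq_statAmp (hw : IsCutoff w w₁ w₂ W) (hL : 0 < L) (hk : 1 < k)
    (ht : 0 < t) {b m : ℝ} (hx : 0 < c + L * b)
    (hb : t * L * (k * (c + L * b) ^ (k - 1)) = m * L) :
    c + L * b = (m / (k * t)) ^ (1 / (k - 1)) ∧
    𝓕 (fun x : ℝ => (w ((x - c) / L) : ℂ) * expTwoPiI (t * x ^ k)) m =
      (L : ℂ) * statAmp w (fun y => t * (c + L * y) ^ k)
        (fun y => t * L * (k * (c + L * y) ^ (k - 1))) b *
        expTwoPiI (m ^ (k / (k - 1)) * dualParam k t) := by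
  set x := c + L * b with hxdef
  have hk1 : 0 < k - 1 := by linarith
  have hk0 : 0 < k := by linarith
  have hm : m = t * k * x ^ (k - 1) := by
    have : (t * k * x ^ (k - 1)) * L = m * L := by rw [← hb]; ring
    exact (mul_right_cancel₀ hL.ne' this).symm
  have hxm : m / (k * t) = x ^ (k - 1) := by rw [hm]; field_simp
  refine ⟨?_, ?_⟩
  · rw [hxm, ← Real.rpow_mul hx.le, mul_one_div_cancel hk1.ne', Real.rpow_one]
  · have hm0 : 0 < m := by rw [hm]; have := Real.rpow_pos_of_pos hx (k - 1); positivity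
    have hxk : m * x = k * (t * x ^ k) := by
      have : x ^ k = x ^ (k - 1) * x := by
        conv_lhs => rw [show k = (k - 1) + 1 by ring, Real.rpow_add hx, Real.rpow_one]
      rw [hm, this]; ring
    -- The critical value of the phase at frequency `m` is `-(k - 1) t x^k` with `m = t k x^(k-1)`;
    -- eliminating `x` gives `m^(k/(k-1))` times a function of `t` alone.
    have hphase : m ^ (k / (k - 1)) * dualParam k t = t * x ^ k - m * x := by
      rw [hxk, dualParam, hm]
      rw [Real.mul_rpow (by positivity) (by positivity), Real.mul_rpow ht.le hk0.le,
        ← Real.rpow_mul hx.le, mul_div_cancel₀ _ hk1.ne']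
      have e1 : t ^ (k / (k - 1)) * t ^ (-(1 / (k - 1))) = t := by
        rw [← Real.rpow_add ht]
        have : k / (k - 1) + -(1 / (k - 1)) = 1 := by field_simp; ring
        rw [this, Real.rpow_one]
      have e2 : k ^ (k / (k - 1)) * k ^ (-(k / (k - 1))) = 1 := by
        rw [← Real.rpow_add hk0, add_neg_cancel, Real.rpow_zero]
      linear_combination (-(k - 1) * x ^ k * k ^ (k / (k - 1)) * k ^ (-(k / (k - 1)))) * e1 -
        (t * (k - 1) * x ^ k) * e2
    rw [fourier_smoothBlock hw hL, mul_assoc, mul_assoc, hphase, statAmp,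
      ← intervalIntegral.integral_const_mul, ← intervalIntegral.integral_mul_const]
    congr 1
    refine intervalIntegral.integral_congr fun y _ => ?_
    rw [mul_left_comm, ← expTwoPiI_add, mul_assoc (w y : ℂ), ← expTwoPiI_add]
    congr 2
    rw [hb, ← hxdef]
    rw [hxdef]
    ring

end

set_option maxHeartbeats 1000000 in
/-- Smooth blocks are short dual sums with amplitudes of bounded variation. -/
theorem exists_smoothBlock_bounds {w w₁ w₂ : ℝ → ℝ} {W k κ : ℝ} (hw : IsCutoff w w₁ w₂ W)
    (hk : 1 < k) (hκ : 1 ≤ κ) :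
    ∃ C ρ : ℝ, 1 ≤ C ∧ 0 < ρ ∧ ∀ N L c t : ℝ, 0 < N → 1 ≤ L → L ≤ ρ * N →
      c ∈ Set.Icc (N - L) (κ * N) → 0 < t →
      (t * N ^ (k - 2) ≤ 1 → t * N ^ (k - 2) * L ≤ 1 →
        ‖smoothBlock w k L c t‖ ≤ C / √(t * N ^ (k - 2))) ∧
      (1 / 2 ≤ t * N ^ (k - 2) * L → ∃ (A B : ℤ) (α : ℤ → ℂ),
        (∀ m ∈ Finset.Icc A B, |(m : ℝ) - t * (k * c ^ (k - 1))| ≤ C * (t * N ^ (k - 2) * L) ∧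
          t * N ^ (k - 1) / C ≤ m ∧ m ≤ C * (t * N ^ (k - 1))) ∧
        (∀ m ∈ Finset.Icc A B, ‖α m‖ ≤ C / √(t * N ^ (k - 2))) ∧
        ∑ m ∈ Finset.Ico A B, ‖α (m + 1) - α m‖ ≤ C / √(t * N ^ (k - 2)) ∧
        ‖smoothBlock w k L c t - ∑ m ∈ Finset.Icc A B,
          α m * expTwoPiI ((m : ℝ) ^ (k / (k - 1)) * dualParam k t)‖ ≤ C) := by
  obtain ⟨E, hE0, hE⟩ := exists_norm_smoothBlock_sub_le hw
  obtain ⟨K, hK1, hK⟩ := exists_rpow_deriv_bounds hk hκ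
  have hW := hw.one_le
  -- The stationary points of the retained frequencies may lie outside the support of `w`. They
  -- satisfy `|b| ≤ Y'` because `|m - μ| L ≤ 8K lam L² = Y' Λ`; the phase is therefore controlled on
  -- the larger interval `(-Y, Y)`.
  set Y' : ℝ := 8 * K ^ 2 with hY'
  have hY'8 : 8 ≤ Y' := by nlinarith
  set Y : ℝ := Y' + 1 with hY
  have hK0 : 0 < K := by linarith
  have hk1 : 0 < k - 1 := by linarith
  set C : ℝ := E + 8 * K + K + 9 * K * (45 * W * √K) +
    234 * (K ^ 2) ^ 3 * W * √K * (2 * Y') with hC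
  have hsK : 0 < √K := Real.sqrt_pos.mpr hK0
  have c1 : 0 < 9 * K * (45 * W * √K) := by positivity
  have c2 : 0 < 234 * (K ^ 2) ^ 3 * W * √K * (2 * Y') := by positivity
  have c3 : 45 * W * √K ≤ 9 * K * (45 * W * √K) := by
    have : 0 < 45 * W * √K := by positivity
    nlinarith
  -- This `ρ` gives `L (1 + Y) ≤ N/2`, so that `c + L y` stays in `[N/2, 2κN]` for all `|y| < Y`.
  refine ⟨C, 1 / (2 * (1 + Y)), by linarith, by positivity, ?_⟩
  intro N L c t hN hL hLN hc ht
  have hL0 : 0 < L := by linarith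
  have hLN' : L * (1 + Y) ≤ N / 2 := by
    have : L * (1 + Y) ≤ 1 / (2 * (1 + Y)) * N * (1 + Y) := by gcongr
    have hY1 : 0 < 1 + Y := by linarith
    refine this.trans (le_of_eq ?_)
    field_simp
  have hLY : 0 < L * Y := by positivity
  have hin : ∀ y ∈ Set.Ioo (-Y) Y, c + L * y ∈ Set.Icc (N / 2) (2 * κ * N) := by
    intro y hy
    have h1 : L * -Y ≤ L * y := mul_le_mul_of_nonneg_left hy.1.le hL0.le
    have h2 : L * y ≤ L * Y := mul_le_mul_of_nonneg_left hy.2.le hL0.le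
    have h3 : N ≤ κ * N := by nlinarith
    constructor
    · linarith [hc.1]
    · linarith [hc.2]
  have hphase := isPhase_rpow (t := t) hK1 hN hK hL0 (by nlinarith) ht (by linarith : 2 < Y) hin
  set lam := t * N ^ (k - 2) with hlam
  have hlam0 : 0 < lam := mul_pos ht (Real.rpow_pos_of_pos hN _)
  set Λ := lam * L ^ 2 / K with hΛ
  have hΛ0 : 0 < Λ := by positivity
  have hsΛ : √Λ = √lam * L / √K := by
    rw [hΛ, Real.sqrt_div (by positivity), Real.sqrt_mul hlam0.le, Real.sqrt_sq hL0.le]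
  have hsl : 0 < √lam := Real.sqrt_pos.mpr hlam0
  have hLΛ : ∀ a : ℝ, L * (a / √Λ) = a * √K / √lam := by
    intro a; rw [hsΛ]; field_simp
  set μ := t * (k * c ^ (k - 1)) with hμ
  have hφ0 : t * L * (k * (c + L * 0) ^ (k - 1)) = μ * L := by
    rw [mul_zero, add_zero, hμ]; ring
  set D : ℝ := max 1 (4 * K * lam * L) with hD
  have hKΛ : K ^ 2 * Λ = K * lam * L ^ 2 := by rw [hΛ]; field_simp
  have hDL : 4 * K ^ 2 * Λ ≤ D * L := by
    rw [mul_assoc, hKΛ]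
    have : 4 * K * lam * L * L ≤ D * L := mul_le_mul_of_nonneg_right (le_max_right _ _) hL0.le
    refine le_trans (le_of_eq (by ring)) this
  have hpois := hE hphase (by linarith) hL hφ0 (le_max_left _ _) hDL
  refine ⟨fun h1 h2 => ?_, fun h1 => ?_⟩
  -- Small `t`: the window holds at most `2D + 1 ≤ 9K` frequencies, each contributing
  -- `O(lam^(-1/2))`; the error `E` is of that order too since `lam ≤ 1`.
  · have hD4 : D ≤ 4 * K := max_le (by linarith) (by nlinarith)
    have hcard : ((Finset.Icc ⌈μ - D⌉ ⌊μ + D⌋).card : ℝ) ≤ 9 * K := by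
      rw [Int.card_Icc]
      have h3 : ((⌊μ + D⌋ + 1 - ⌈μ - D⌉ : ℤ) : ℝ) ≤ 9 * K := by
        push_cast
        linarith [Int.floor_le (μ + D), Int.le_ceil (μ - D)]
      rcases le_total 0 (⌊μ + D⌋ + 1 - ⌈μ - D⌉) with h | h
      · have : (((⌊μ + D⌋ + 1 - ⌈μ - D⌉).toNat : ℤ) : ℝ) ≤ 9 * K := by
          rw [Int.toNat_of_nonneg h]; exact h3
        exact_mod_cast this
      · rw [Int.toNat_of_nonpos h]; simp; linarith
    have hsum : ‖∑ m ∈ Finset.Icc ⌈μ - D⌉ ⌊μ + D⌋,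
        𝓕 (fun x : ℝ => (w ((x - c) / L) : ℂ) * expTwoPiI (t * x ^ k)) (m : ℝ)‖ ≤
        9 * K * (45 * W * √K / √lam) := by
      refine (norm_sum_le _ _).trans ((Finset.sum_le_sum fun (m : ℤ) _ =>
        norm_fourier_smoothBlock_le hw hphase hL0 (m : ℝ)).trans ?_)
      rw [Finset.sum_const, nsmul_eq_mul, hLΛ]
      gcongr
    have hs1 : √lam ≤ 1 := Real.sqrt_le_one.mpr h1
    have hE1 : E ≤ E / √lam := by
      rw [le_div_iff₀ hsl]; nlinarith
    have h3 := norm_le_norm_sub_add (smoothBlock w k L c t) (∑ m ∈ Finset.Icc ⌈μ - D⌉ ⌊μ + D⌋,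
        𝓕 (fun x : ℝ => (w ((x - c) / L) : ℂ) * expTwoPiI (t * x ^ k)) (m : ℝ))
    calc _ ≤ _ := h3
      _ ≤ E / √lam + 9 * K * (45 * W * √K / √lam) := add_le_add (hpois.trans hE1) hsum
      _ = (E + 9 * K * (45 * W * √K)) / √lam := by ring
      _ ≤ C / √lam := by gcongr; linarith
  · have hD8 : D ≤ 8 * K * (lam * L) := by
      have h2 : K * (1 / 2) ≤ K * (lam * L) := mul_le_mul_of_nonneg_left h1 hK0.le
      refine max_le (by linarith) ?_
      have : 4 * K * lam * L = 4 * (K * (lam * L)) := by ring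
      linarith
    set S := Finset.Icc ⌈μ - D⌉ ⌊μ + D⌋ with hS
    have hmS : ∀ m ∈ S, |(m : ℝ) - μ| ≤ D := by
      intro m hm
      rw [hS, Finset.mem_Icc, Int.ceil_le, Int.le_floor] at hm
      rw [abs_le]; constructor <;> linarith [hm.1, hm.2]
    have hsubY : Set.Icc (-Y') Y' ⊆ Set.Ioo (-Y) Y := fun x hx =>
      ⟨by linarith [hx.1], by linarith [hx.2]⟩
    have h0Y : (0 : ℝ) ∈ Set.Ioo (-Y) Y := hsubY ⟨by linarith, by linarith⟩
    -- The slope of `φ₁` is at least `Λ`, so between `0` and `±Y'` it moves by at least `Y' Λ`; the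
    -- intermediate value theorem then yields a stationary point for each frequency in the window.
    have hend : ∀ y ∈ Set.Ioo (-Y) Y, ∃ p, Λ ≤ p ∧ y * p =
        t * L * (k * (c + L * y) ^ (k - 1)) - μ * L := by
      intro y hy
      refine ⟨_, le_segMoment_zero hphase.continuousOn₂ hphase.lower₂ h0Y hy, ?_⟩
      have := sub_mul_segMoment hphase.hasDerivAt₁ hphase.continuousOn₂ h0Y hy
      rw [hφ0, sub_zero] at this
      exact this
    have hYΛ : Y' * Λ = 8 * K * (lam * L) * L := by rw [hY', hΛ]; field_simp
    have hstat : ∀ m ∈ S, ∃ b ∈ Set.Icc (-Y') Y',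
        t * L * (k * (c + L * b) ^ (k - 1)) = m * L := by
      intro m hm
      have hmD := (hmS m hm).trans hD8
      have hmL : |(m : ℝ) * L - μ * L| ≤ Y' * Λ := by
        rw [← sub_mul, abs_mul, abs_of_pos hL0, hYΛ]
        exact mul_le_mul_of_nonneg_right hmD hL0.le
      have hmL' := abs_le.mp hmL
      have hcont : ContinuousOn (fun y => t * L * (k * (c + L * y) ^ (k - 1))) (Set.Icc (-Y') Y') :=
        hphase.continuousOn₁.mono hsubY
      have himg := intermediate_value_Icc (by linarith : -Y' ≤ Y') hcont
      obtain ⟨p, hp, hpe⟩ := hend Y' (hsubY ⟨by linarith, le_rfl⟩)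
      obtain ⟨q, hq, hqe⟩ := hend (-Y') (hsubY ⟨le_rfl, by linarith⟩)
      have hmem : (m : ℝ) * L ∈ Set.Icc (t * L * (k * (c + L * -Y') ^ (k - 1)))
          (t * L * (k * (c + L * Y') ^ (k - 1))) := by
        have hYp : Y' * Λ ≤ Y' * p := by gcongr
        have hYq : Y' * Λ ≤ Y' * q := by gcongr
        constructor <;> nlinarith [hmL'.1, hmL'.2]
      obtain ⟨b, hb, hbe⟩ := himg hmem
      exact ⟨b, hb, hbe⟩
    -- The explicit formula for the stationary point is increasing in `m > 0`. Since `statAmp` is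
    -- Lipschitz, the variation of the amplitudes telescopes to the total displacement, at most
    -- `2Y'`.
    set bf : ℤ → ℝ := fun m => (((m : ℝ) / (k * t)) ^ (1 / (k - 1)) - c) / L with hbf
    have hfacts : ∀ m ∈ S, bf m ∈ Set.Icc (-Y') Y' ∧
        t * L * (k * (c + L * bf m) ^ (k - 1)) = m * L ∧
        𝓕 (fun x : ℝ => (w ((x - c) / L) : ℂ) * expTwoPiI (t * x ^ k)) (m : ℝ) =
        (L : ℂ) * statAmp w (fun y => t * (c + L * y) ^ k)
          (fun y => t * L * (k * (c + L * y) ^ (k - 1))) (bf m) *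
          expTwoPiI ((m : ℝ) ^ (k / (k - 1)) * dualParam k t) := by
      intro m hm
      obtain ⟨b, hb, hbe⟩ := hstat m hm
      have hx : 0 < c + L * b := lt_of_lt_of_le (by linarith) (hin b (hsubY hb)).1
      obtain ⟨e1, e2⟩ := fourier_smoothBlock_eq_statAmp hw hL0 hk ht hx hbe
      have : bf m = b := by
        simp only [hbf]; rw [← e1]; field_simp; ring
      rw [this]
      exact ⟨hb, hbe, e2⟩
    have hmrange : ∀ m ∈ S, t * N ^ (k - 1) / K ≤ m ∧ (m : ℝ) ≤ K * (t * N ^ (k - 1)) := by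
      intro m hm
      obtain ⟨hb, hbe, -⟩ := hfacts m hm
      have h3 := (hK N _ hN (hin _ (hsubY hb))).1
      have hme : (m : ℝ) = t * (k * (c + L * bf m) ^ (k - 1)) := by
        apply mul_right_cancel₀ hL0.ne'
        rw [← hbe]; ring
      rw [hme]
      constructor
      · rw [mul_div_assoc]; exact mul_le_mul_of_nonneg_left h3.1 ht.le
      · rw [mul_left_comm K]; exact mul_le_mul_of_nonneg_left h3.2 ht.le
    refine ⟨⌈μ - D⌉, ⌊μ + D⌋, fun m => (L : ℂ) * statAmp w (fun y => t * (c + L * y) ^ k)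
          (fun y => t * L * (k * (c + L * y) ^ (k - 1))) (bf m), ?_, ?_, ?_, ?_⟩
    · intro m hm
      have hlL : 0 < lam * L := by positivity
      have htN : 0 < t * N ^ (k - 1) := mul_pos ht (Real.rpow_pos_of_pos hN _)
      refine ⟨((hmS m hm).trans hD8).trans ?_, le_trans ?_ (hmrange m hm).1,
        (hmrange m hm).2.trans ?_⟩
      · gcongr; linarith
      · gcongr; linarith
      · gcongr; linarith
    · intro m hm
      rw [norm_mul, Complex.norm_real, Real.norm_of_nonneg hL0.le]
      refine (mul_le_mul_of_nonneg_left (hphase.norm_statAmp_le hw _) hL0.le).trans ?_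
      rw [hLΛ]
      gcongr
      linarith
    · have hstep : ∀ m ∈ Finset.Ico ⌈μ - D⌉ ⌊μ + D⌋,
          ‖(L : ℂ) * statAmp w (fun y => t * (c + L * y) ^ k)
          (fun y => t * L * (k * (c + L * y) ^ (k - 1))) (bf (m + 1)) -
          (L : ℂ) * statAmp w (fun y => t * (c + L * y) ^ k)
          (fun y => t * L * (k * (c + L * y) ^ (k - 1))) (bf m)‖ ≤
          234 * (K ^ 2) ^ 3 * W * √K / √lam * (bf (m + 1) - bf m) := by
        intro m hm
        rw [Finset.mem_Ico] at hm
        have hm1 : m ∈ S := Finset.mem_Icc.mpr ⟨hm.1, hm.2.le⟩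
        have hm2 : m + 1 ∈ S := Finset.mem_Icc.mpr ⟨by omega, by omega⟩
        have hb1 := hsubY (hfacts m hm1).1
        have hb2 := hsubY (hfacts (m + 1) hm2).1
        have hm0 : 0 < (m : ℝ) := lt_of_lt_of_le
          (div_pos (mul_pos ht (Real.rpow_pos_of_pos hN _)) hK0) (hmrange m hm1).1
        have hmono : bf m ≤ bf (m + 1) := by
          simp only [hbf]
          gcongr
          linarith
        rw [← mul_sub, norm_mul, Complex.norm_real, Real.norm_of_nonneg hL0.le]
        refine (mul_le_mul_of_nonneg_left (hphase.norm_statAmp_sub_le hw hb1 hb2) hL0.le).trans ?_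
        rw [← mul_assoc, hLΛ, abs_of_nonneg (sub_nonneg.mpr hmono)]
      refine (Finset.sum_le_sum hstep).trans ?_
      rw [← Finset.mul_sum]
      rcases le_or_gt ⌈μ - D⌉ ⌊μ + D⌋ with hAB | hAB
      · rw [sum_Ico_int_sub bf hAB]
        have b1 := (hfacts _ (Finset.mem_Icc.mpr ⟨hAB, le_rfl⟩)).1
        have b2 := (hfacts _ (Finset.mem_Icc.mpr ⟨le_rfl, hAB⟩)).1
        have h3 : bf ⌊μ + D⌋ - bf ⌈μ - D⌉ ≤ 2 * Y' := by linarith [b1.2, b2.1]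
        calc _ ≤ 234 * (K ^ 2) ^ 3 * W * √K / √lam * (2 * Y') := by gcongr
          _ = 234 * (K ^ 2) ^ 3 * W * √K * (2 * Y') / √lam := by ring
          _ ≤ C / √lam := by gcongr; linarith
      · rw [Finset.Ico_eq_empty (by omega), Finset.sum_empty, mul_zero]
        have : 0 < C := by linarith
        positivity
    · rw [Finset.sum_congr rfl fun m hm => (hfacts m hm).2.2] at hpois
      exact hpois.trans (by linarith)

/-! ### Completing incomplete sums -/

theorem expTwoPiI_nat_mul (r : ℕ) (x : ℝ) : expTwoPiI (r * x) = expTwoPiI x ^ r := by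
  unfold expTwoPiI
  rw [← Complex.exp_nat_mul]
  congr 1
  push_cast
  ring

theorem expTwoPiI_eq_one_iff {x : ℝ} : expTwoPiI x = 1 ↔ ∃ n : ℤ, x = n := by
  unfold expTwoPiI
  rw [Complex.exp_eq_one_iff]
  refine exists_congr fun n => ?_
  have h : (2 * (Real.pi : ℂ) * Complex.I) ≠ 0 := two_pi_I_ne_zero
  constructor
  · intro hn
    have : (x : ℂ) = ((n : ℝ) : ℂ) := by
      apply mul_left_cancel₀ h
      rw [hn]; push_cast; ring
    exact_mod_cast this
  · rintro rfl
    push_cast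
    ring

theorem sum_range_expTwoPiI_div {q : ℕ} (hq : 0 < q) {h : ℤ} (hh : |h| < q) :
    ∑ r ∈ Finset.range q, expTwoPiI ((r : ℝ) / q * h) = if h = 0 then (q : ℂ) else 0 := by
  have hq' : (q : ℝ) ≠ 0 := by positivity
  split_ifs with h0
  · subst h0; simp
  · have hterm : ∀ r ∈ Finset.range q, expTwoPiI ((r : ℝ) / q * h) = expTwoPiI ((h : ℝ) / q) ^ r := by
      intro r _
      rw [← expTwoPiI_nat_mul]
      congr 1
      field_simp
    rw [Finset.sum_congr rfl hterm]
    have hne : expTwoPiI ((h : ℝ) / q) ≠ 1 := by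
      rw [Ne, expTwoPiI_eq_one_iff]
      rintro ⟨n, hn⟩
      rw [div_eq_iff hq'] at hn
      have hn' : h = n * q := by exact_mod_cast hn
      have hn0 : n ≠ 0 := fun h1 => h0 (by rw [hn', h1, zero_mul])
      rw [hn', abs_mul, Nat.abs_cast] at hh
      have : 1 ≤ |n| := Int.one_le_abs hn0
      nlinarith
    rw [geom_sum_eq hne, ← expTwoPiI_nat_mul, mul_div_cancel₀ _ hq']
    have : expTwoPiI (h : ℝ) = 1 := expTwoPiI_eq_one_iff.mpr ⟨h, rfl⟩
    rw [this, sub_self, zero_div]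

/-- The weights in the completion of an incomplete sum modulo `q`. -/
noncomputable def completionWeight (q r : ℕ) : ℝ := 1 / ((r : ℝ) + 1) + 1 / ((q : ℝ) - r)

theorem completionWeight_nonneg {q r : ℕ} (hr : r < q) : 0 ≤ completionWeight q r := by
  have : (r : ℝ) < q := by exact_mod_cast hr
  have h2 : 0 < (q : ℝ) - r := by linarith
  unfold completionWeight
  positivity

theorem sum_completionWeight_le (q : ℕ) :
    ∑ r ∈ Finset.range q, completionWeight q r ≤ 2 * (1 + Real.log q) := by
  have hh : ∑ r ∈ Finset.range q, 1 / ((r : ℝ) + 1) ≤ 1 + Real.log q := by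
    have h := harmonic_le_one_add_log q
    rw [harmonic] at h
    push_cast at h
    simpa [one_div] using h
  have h2 : ∑ r ∈ Finset.range q, 1 / ((q : ℝ) - r) = ∑ r ∈ Finset.range q, 1 / ((r : ℝ) + 1) := by
    rw [← Finset.sum_range_reflect]
    refine Finset.sum_congr rfl fun r hr => ?_
    rw [Finset.mem_range] at hr
    have : ((q - 1 - r : ℕ) : ℝ) = q - 1 - r := by
      rw [Nat.cast_sub (by omega), Nat.cast_sub (by omega)]; simp
    rw [this]
    congr 1
    ring
  unfold completionWeight
  rw [Finset.sum_add_distrib, h2]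
  linarith

/-- The norm equals `2 sin(πr/q)`, and Jordan's inequality on the appropriate half of `[0, π]`
bounds it below by `4 min(r, q - r)/q`. -/
theorem one_le_norm_one_sub_expTwoPiI {q r : ℕ} (hr : 0 < r) (hrq : r < q) :
    1 ≤ ‖1 - expTwoPiI (-((r : ℝ) / q))‖ * ((q : ℝ) / 4 * (1 / (r : ℝ) + 1 / ((q : ℝ) - r))) := by
  have hr0 : (0 : ℝ) < r := by exact_mod_cast hr
  have hrq0 : (r : ℝ) < q := by exact_mod_cast hrq
  have hq0 : (0 : ℝ) < q := by linarith
  have hsub : (0 : ℝ) < (q : ℝ) - r := by linarith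
  have hπ := Real.pi_pos
  have hn : ‖1 - expTwoPiI (-((r : ℝ) / q))‖ = 2 * Real.sin (Real.pi * (r / q)) := by
    have h1 : expTwoPiI (-((r : ℝ) / q)) =
        Complex.exp (Complex.I * ((-(2 * Real.pi * (r / q)) : ℝ) : ℂ)) := by
      rw [expTwoPiI_eq_exp_mul_I, mul_comm]
      congr 3
      ring
    rw [norm_sub_rev, h1, Complex.norm_exp_I_mul_ofReal_sub_one]
    have h2 : -(2 * Real.pi * ((r : ℝ) / q)) / 2 = -(Real.pi * (r / q)) := by ring
    rw [h2, Real.sin_neg, Real.norm_eq_abs, mul_neg, abs_neg, abs_of_nonneg]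
    have : 0 ≤ Real.sin (Real.pi * (r / q)) := by
      apply Real.sin_nonneg_of_nonneg_of_le_pi (by positivity)
      have : (r : ℝ) / q ≤ 1 := by rw [div_le_one hq0]; exact hrq0.le
      nlinarith
    linarith
  rw [hn]
  rcases le_total (r / q : ℝ) (1 / 2) with h | h
  · have h1 := Real.mul_le_sin (x := Real.pi * (r / q)) (by positivity) (by nlinarith)
    have h2 : 2 / Real.pi * (Real.pi * (r / q)) = 2 * (r / q) := by field_simp
    rw [h2] at h1
    have h3 : 0 < 1 / ((q : ℝ) - r) := by positivity
    calc (1 : ℝ) = 2 * (2 * (r / q)) * (q / 4 * (1 / r)) := by field_simp; norm_num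
      _ ≤ 2 * Real.sin (Real.pi * (r / q)) * (q / 4 * (1 / r + 1 / (q - r))) := by
          have hfr : 0 ≤ (r : ℝ) / q := by positivity
          have hfs : 0 ≤ ((q : ℝ) - r) / q := by positivity
          refine mul_le_mul (by linarith) ?_ (by positivity) (by linarith)
          gcongr
          linarith
  · have h1 := Real.mul_le_sin (x := Real.pi - Real.pi * (r / q))
      (by have : (r : ℝ) / q ≤ 1 := by rw [div_le_one hq0]; exact hrq0.le
          nlinarith) (by nlinarith)
    rw [Real.sin_pi_sub] at h1
    have h2 : 2 / Real.pi * (Real.pi - Real.pi * (r / q)) = 2 * ((q - r) / q) := by field_simp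
    rw [h2] at h1
    have h3 : 0 < 1 / (r : ℝ) := by positivity
    calc (1 : ℝ) = 2 * (2 * ((q - r) / q)) * (q / 4 * (1 / (q - r))) := by field_simp; norm_num
      _ ≤ 2 * Real.sin (Real.pi * (r / q)) * (q / 4 * (1 / r + 1 / (q - r))) := by
          have hfr : 0 ≤ (r : ℝ) / q := by positivity
          have hfs : 0 ≤ ((q : ℝ) - r) / q := by positivity
          refine mul_le_mul (by linarith) ?_ (by positivity) (by linarith)
          gcongr
          linarith

/-- Abel summation, arranged so that only the end values and the variation of `α` appear. -/
theorem sum_Icc_mul_one_sub_geom (α : ℤ → ℂ) (θ : ℤ → ℂ) (ζ : ℂ) (hθ : ∀ m, θ (m + 1) = ζ * θ m)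
    {A B : ℤ} (hAB : A ≤ B) :
    (1 - ζ) * ∑ m ∈ Finset.Icc A B, α m * θ m =
      α A * θ A - α B * θ (B + 1) + ∑ m ∈ Finset.Ico A B, (α (m + 1) - α m) * θ (m + 1) := by
  induction B, hAB using Int.leInduction with
  | base =>
    simp only [Finset.Icc_self, Finset.sum_singleton, Finset.Ico_self, Finset.sum_empty]
    rw [hθ]; ring
  | succ n hn ih =>
    have h1 : Finset.Ico A (n + 1) = insert n (Finset.Ico A n) := by
      ext x; simp only [Finset.mem_Ico, Finset.mem_insert]; omega
    have h2 : Finset.Icc A (n + 1) = insert (n + 1) (Finset.Icc A n) := by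
      ext x; simp only [Finset.mem_Icc, Finset.mem_insert]; omega
    rw [h1, h2, Finset.sum_insert (by simp), Finset.sum_insert (by simp), mul_add, ih,
      hθ (n + 1)]
    ring

/-- An incomplete sum with amplitudes of bounded variation is bounded by complete twisted sums. -/
theorem norm_sum_filter_mul_le {q : ℕ} (hq : 0 < q) (S : Finset ℤ) (i : ℤ)
    (hS : ∀ m ∈ S, m / (q : ℤ) = i) (z α : ℤ → ℂ) {A B : ℤ} {V : ℝ}
    (hV : ∀ m ∈ Finset.Icc A B, ‖α m‖ ≤ V)
    (hvar : ∑ m ∈ Finset.Ico A B, ‖α (m + 1) - α m‖ ≤ V) :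
    ‖∑ m ∈ S with m ∈ Finset.Icc A B, α m * z m‖ ≤ 2 * V * ∑ r ∈ Finset.range q,
      completionWeight q r * ‖∑ m ∈ S, z m * expTwoPiI ((r : ℝ) / q * m)‖ := by
  have hq0 : (0 : ℝ) < q := by exact_mod_cast hq
  have hqz : (0 : ℤ) < q := by exact_mod_cast hq
  have hV0 : 0 ≤ V := le_trans (Finset.sum_nonneg fun _ _ => norm_nonneg _) hvar
  -- Within one block of `q` consecutive integers the condition `m ∈ [A, B]` again describes an
  -- interval, and distinct elements are distinct modulo `q`.
  set A' := max A (i * q) with hA'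
  set B' := min B (i * q + q - 1) with hB'
  set T := Finset.Icc A' B' with hT
  have hTsub : ∀ m ∈ T, m ∈ Finset.Icc A B := fun m hm => by
    rw [hT, Finset.mem_Icc] at hm; rw [Finset.mem_Icc]; omega
  have hTblock : ∀ m ∈ T, i * q ≤ m ∧ m < i * q + q := fun m hm => by
    rw [hT, Finset.mem_Icc] at hm; omega
  have hSblock : ∀ m ∈ S, i * q ≤ m ∧ m < i * q + q := fun m hm => by
    have h1 := hS m hm
    have h2 := Int.mul_ediv_add_emod m q
    have h3 := Int.emod_nonneg m hqz.ne'
    have h4 := Int.emod_lt_of_pos m hqz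
    rw [h1] at h2
    constructor <;> nlinarith
  -- The discrete Fourier coefficients modulo `q` of `α` restricted to `[A', B']`; orthogonality
  -- inverts them on the block.
  set bh : ℕ → ℂ := fun r => (1 / (q : ℂ)) * ∑ m' ∈ T, α m' * expTwoPiI (-((r : ℝ) / q) * m')
    with hbh
  have hident : ∑ m ∈ S with m ∈ Finset.Icc A B, α m * z m =
      ∑ r ∈ Finset.range q, bh r * ∑ m ∈ S, z m * expTwoPiI ((r : ℝ) / q * m) := by
    have hinv : ∀ m ∈ S, ∑ r ∈ Finset.range q, bh r * expTwoPiI ((r : ℝ) / q * m) =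
        if m ∈ Finset.Icc A B then α m else 0 := by
      intro m hm
      have h1 : ∀ r ∈ Finset.range q, bh r * expTwoPiI ((r : ℝ) / q * m) =
          ∑ m' ∈ T, (1 / (q : ℂ)) * α m' * expTwoPiI ((r : ℝ) / q * ((m - m' : ℤ) : ℝ)) := by
        intro r _
        simp only [hbh]
        rw [mul_assoc, Finset.sum_mul, Finset.mul_sum]
        refine Finset.sum_congr rfl fun m' _ => ?_
        have : (r : ℝ) / q * ((m - m' : ℤ) : ℝ) = -((r : ℝ) / q) * m' + (r : ℝ) / q * m := by
          push_cast; ring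
        rw [this, expTwoPiI_add]
        ring
      rw [Finset.sum_congr rfl h1, Finset.sum_comm]
      have hm2 := hSblock m hm
      have h2 : ∀ m' ∈ T, ∑ r ∈ Finset.range q,
          (1 / (q : ℂ)) * α m' * expTwoPiI ((r : ℝ) / q * ((m - m' : ℤ) : ℝ)) =
          if m' = m then α m else 0 := by
        intro m' hm'
        have hm3 := hTblock m' hm'
        rw [← Finset.mul_sum, sum_range_expTwoPiI_div hq (by rw [abs_lt]; omega)]
        by_cases h : m' = m
        · rw [if_pos h, if_pos (by omega), h]
          have : (q : ℂ) ≠ 0 := by exact_mod_cast hq.ne'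
          field_simp
        · rw [if_neg h, if_neg (by omega), mul_zero]
      rw [Finset.sum_congr rfl h2, Finset.sum_ite_eq' T m]
      have : m ∈ T ↔ m ∈ Finset.Icc A B := by
        rw [hT, Finset.mem_Icc, Finset.mem_Icc]; omega
      simp only [this]
    rw [Finset.sum_filter]
    have h3 : ∀ r ∈ Finset.range q, bh r * ∑ m ∈ S, z m * expTwoPiI ((r : ℝ) / q * m) =
        ∑ m ∈ S, z m * (bh r * expTwoPiI ((r : ℝ) / q * m)) := by
      intro r _
      rw [Finset.mul_sum]
      exact Finset.sum_congr rfl fun m _ => by ring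
    rw [Finset.sum_congr rfl h3, Finset.sum_comm]
    refine Finset.sum_congr rfl fun m hm => ?_
    rw [← Finset.mul_sum, hinv m hm]
    split_ifs <;> ring
  -- For `r = 0` there are at most `q` terms of size `V`. For `r > 0` Abel summation gives `3V/|1 -
  -- e(-r/q)|`, two thirds of it from the end values and one third from the variation.
  have hbound : ∀ r ∈ Finset.range q, ‖bh r‖ ≤ 2 * V * completionWeight q r := by
    intro r hr
    rw [Finset.mem_range] at hr
    have hrq : (r : ℝ) < q := by exact_mod_cast hr
    have hsub : (0 : ℝ) < (q : ℝ) - r := by linarith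
    simp only [hbh]
    rw [norm_mul, norm_div, norm_one, Complex.norm_natCast]
    rcases lt_or_ge B' A' with hlt | hAB
    · rw [hT, Finset.Icc_eq_empty (by omega), Finset.sum_empty, norm_zero, mul_zero]
      exact mul_nonneg (by positivity) (completionWeight_nonneg hr)
    rcases Nat.eq_zero_or_pos r with h0 | h0
    · subst h0
      have hcard : (T.card : ℝ) ≤ q := by
        rw [hT, Int.card_Icc]
        have : (B' + 1 - A').toNat ≤ q := by omega
        exact_mod_cast this
      have h1 : ‖∑ m' ∈ T, α m' * expTwoPiI (-(((0 : ℕ) : ℝ) / q) * m')‖ ≤ q * V := by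
        refine (norm_sum_le_of_le _ (f := fun m' => α m' * expTwoPiI (-(((0 : ℕ) : ℝ) / q) * m'))
          (n := fun _ => V) fun m hm => ?_).trans ?_
        · rw [norm_mul, norm_expTwoPiI, mul_one]; exact hV m (hTsub m hm)
        · rw [Finset.sum_const, nsmul_eq_mul]; gcongr
      have h2 : 1 ≤ completionWeight q 0 := by
        unfold completionWeight
        simp
      calc 1 / (q : ℝ) * _ ≤ 1 / (q : ℝ) * (q * V) := by gcongr
        _ = V := by field_simp
        _ ≤ 2 * V * completionWeight q 0 := by nlinarith
    · have hr0 : (0 : ℝ) < r := by exact_mod_cast h0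
      have habel := sum_Icc_mul_one_sub_geom α (fun m => expTwoPiI (-((r : ℝ) / q) * m))
        (expTwoPiI (-((r : ℝ) / q))) (fun m => by
          rw [← expTwoPiI_add]; congr 1; push_cast; ring) hAB
      have hup : ‖(1 - expTwoPiI (-((r : ℝ) / q))) *
          ∑ m ∈ T, α m * expTwoPiI (-((r : ℝ) / q) * m)‖ ≤ 3 * V := by
        rw [hT, habel]
        refine (norm_add_le _ _).trans ?_
        have e1 : ‖α A' * expTwoPiI (-((r : ℝ) / q) * A') -
            α B' * expTwoPiI (-((r : ℝ) / q) * ((B' + 1 : ℤ) : ℝ))‖ ≤ V + V := by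
          refine (norm_sub_le _ _).trans (add_le_add ?_ ?_)
          · rw [norm_mul, norm_expTwoPiI, mul_one]
            exact hV _ (hTsub _ (Finset.mem_Icc.mpr ⟨le_rfl, hAB⟩))
          · rw [norm_mul, norm_expTwoPiI, mul_one]
            exact hV _ (hTsub _ (Finset.mem_Icc.mpr ⟨hAB, le_rfl⟩))
        have e2 : ‖∑ m ∈ Finset.Ico A' B', (α (m + 1) - α m) *
            expTwoPiI (-((r : ℝ) / q) * ((m + 1 : ℤ) : ℝ))‖ ≤ V := by
          refine (norm_sum_le _ _).trans ?_
          refine le_trans ?_ hvar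
          refine (Finset.sum_le_sum fun m _ => ?_).trans (Finset.sum_le_sum_of_subset_of_nonneg
            (f := fun m => ‖α (m + 1) - α m‖) (s := Finset.Ico A' B') ?_ fun _ _ _ => norm_nonneg _)
          · rw [norm_mul, norm_expTwoPiI, mul_one]
          · intro m hm
            rw [Finset.mem_Ico] at hm ⊢
            omega
        linarith
      rw [norm_mul] at hup
      set P := ‖∑ m ∈ T, α m * expTwoPiI (-((r : ℝ) / q) * m)‖ with hP
      set G := ‖1 - expTwoPiI (-((r : ℝ) / q))‖ with hG
      have hone := one_le_norm_one_sub_expTwoPiI h0 hr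
      rw [← hG] at hone
      have hP0 : 0 ≤ P := norm_nonneg _
      have hr2 : 1 / (r : ℝ) ≤ 2 * (1 / ((r : ℝ) + 1)) := by
        rw [mul_one_div, div_le_div_iff₀ hr0 (by linarith)]
        have : (1 : ℝ) ≤ r := by exact_mod_cast h0
        linarith
      have hs0 : 0 < 1 / ((q : ℝ) - r) := by positivity
      have hr3 : 0 < 1 / ((r : ℝ) + 1) := by positivity
      calc 1 / (q : ℝ) * P ≤ 1 / (q : ℝ) * P *
            (G * ((q : ℝ) / 4 * (1 / (r : ℝ) + 1 / ((q : ℝ) - r)))) :=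
            le_mul_of_one_le_right (by positivity) hone
        _ = (G * P) * (1 / 4 * (1 / (r : ℝ) + 1 / ((q : ℝ) - r))) := by field_simp
        _ ≤ (3 * V) * (1 / 4 * (1 / (r : ℝ) + 1 / ((q : ℝ) - r))) := by gcongr
        _ ≤ (3 * V) * (1 / 4 * (2 * (1 / ((r : ℝ) + 1)) + 1 / ((q : ℝ) - r))) := by gcongr
        _ ≤ 2 * V * completionWeight q r := by
            unfold completionWeight
            nlinarith [mul_nonneg hV0 hs0.le, mul_nonneg hV0 hr3.le]
  rw [hident]
  refine (norm_sum_le _ _).trans ?_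
  rw [Finset.mul_sum]
  refine Finset.sum_le_sum fun r hr => ?_
  rw [norm_mul, ← mul_assoc]
  exact mul_le_mul_of_nonneg_right (hbound r hr) (norm_nonneg _)

/-! ### Mean squares in the dual parameter -/

/-- Take `u = dualParam k t` as variable. It increases from `-U` towards `0`, with `U ≍
t₀^(-1/(k-1))`, and its derivative is at least of order `U/t₀`; the large sieve on `[-2U, 0]` then
gives the count with tolerance `1/U`. -/
theorem exists_integral_dual_le {k : ℝ} (hk : 1 < k) :
    ∃ C a : ℝ, 0 < C ∧ 0 < a ∧ ∀ (s : Finset (ℤ × ℤ)) (c : ℤ × ℤ → ℂ) (ω : ℤ × ℤ → ℝ) (t₀ : ℝ),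
      0 < t₀ → (∀ q ∈ s, ‖c q‖ ≤ 1) →
      ∫ t in t₀..(2 * t₀), ‖∑ q ∈ s, c q * expTwoPiI (ω q * dualParam k t)‖ ^ 2 ≤
        C * t₀ * (closePairs s ω (a * t₀ ^ (1 / (k - 1)))).card := by
  obtain ⟨C₁, hC₁, hsieve⟩ := integral_normSq_le_card_closePairs
  have hk1 : 0 < k - 1 := by linarith
  set β := 1 / (k - 1) with hβ
  have hβ0 : 0 < β := by positivity
  set A := (k - 1) * k ^ (-(k / (k - 1))) with hA
  have hA0 : 0 < A := mul_pos hk1 (Real.rpow_pos_of_pos (by linarith) _)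
  refine ⟨C₁ * (2 ^ (β + 1) / β), 1 / A, by positivity, by positivity, ?_⟩
  intro s c ω t₀ ht₀ hc
  set U := A * t₀ ^ (-β) with hU
  have hU0 : 0 < U := mul_pos hA0 (Real.rpow_pos_of_pos ht₀ _)
  set H : ℝ → ℝ := fun u => ‖∑ q ∈ s, c q * expTwoPiI (ω q * u)‖ ^ 2 with hH
  have hHc : Continuous H := by fun_prop
  have hH0 : ∀ u, 0 ≤ H u := fun u => by simp only [hH]; positivity
  have hpos : ∀ t ∈ Set.uIcc t₀ (2 * t₀), 0 < t := fun t ht => by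
    rw [Set.uIcc_of_le (by linarith)] at ht; linarith [ht.1]
  have hder : ∀ t ∈ Set.uIcc t₀ (2 * t₀), HasDerivAt (dualParam k)
      (A * β * t ^ (-β - 1)) t := by
    intro t ht
    have h := (Real.hasDerivAt_rpow_const (p := -β) (Or.inl (hpos t ht).ne')).const_mul (-A)
    convert! h using 1
    ring
  have hcder : ContinuousOn (fun t : ℝ => A * β * t ^ (-β - 1)) (Set.uIcc t₀ (2 * t₀)) := by
    refine continuousOn_const.mul (ContinuousOn.rpow_const continuousOn_id fun t ht => ?_)
    exact Or.inl (hpos t ht).ne'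
  have hcdual : ContinuousOn (dualParam k) (Set.uIcc t₀ (2 * t₀)) := fun t ht =>
    (hder t ht).continuousAt.continuousWithinAt
  have hsub := intervalIntegral.integral_comp_mul_deriv' hder hcder (g := H) hHc.continuousOn
  have hlow : ∀ t ∈ Set.Icc t₀ (2 * t₀),
      β * U / (2 ^ (β + 1) * t₀) ≤ A * β * t ^ (-β - 1) := by
    intro t ht
    have ht0 : 0 < t := by linarith [ht.1]
    have h1 : (2 * t₀) ^ (-β - 1) ≤ t ^ (-β - 1) :=
      Real.rpow_le_rpow_of_nonpos ht0 ht.2 (by linarith)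
    have h2 : (2 * t₀) ^ (-β - 1) = t₀ ^ (-β) / (2 ^ (β + 1) * t₀) := by
      rw [Real.mul_rpow (by norm_num) ht₀.le, Real.rpow_sub ht₀, Real.rpow_one,
        show -β - 1 = -(β + 1) by ring, Real.rpow_neg (by norm_num)]
      field_simp
    rw [h2] at h1
    calc β * U / (2 ^ (β + 1) * t₀) = A * β * (t₀ ^ (-β) / (2 ^ (β + 1) * t₀)) := by
          rw [hU]; ring
      _ ≤ A * β * t ^ (-β - 1) := by gcongr
  have hiHd : IntervalIntegrable (fun t => H (dualParam k t)) volume t₀ (2 * t₀) :=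
    (hHc.comp_continuousOn hcdual).intervalIntegrable
  have hstep : β * U / (2 ^ (β + 1) * t₀) * ∫ t in t₀..(2 * t₀), H (dualParam k t) ≤
      ∫ u in (dualParam k t₀)..(dualParam k (2 * t₀)), H u := by
    rw [← hsub, ← intervalIntegral.integral_const_mul]
    refine intervalIntegral.integral_mono_on (by linarith) (hiHd.const_mul _)
      ((hHc.comp_continuousOn hcdual).mul hcder).intervalIntegrable fun t ht => ?_
    rw [Function.comp_apply, mul_comm]
    exact mul_le_mul_of_nonneg_left (hlow t ht) (hH0 _)
  -- With `dualParam k t₀ = -U`, the image of `[t₀, 2t₀]` lies in the interval of centre `-U` and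
  -- radius `U`.
  have he1 : dualParam k t₀ = -U := by simp only [dualParam, hU, hA]; ring
  have he2 : dualParam k (2 * t₀) ≤ 0 := by
    have h1 : (0 : ℝ) < (2 * t₀) ^ (-β) := Real.rpow_pos_of_pos (by linarith) _
    have : dualParam k (2 * t₀) = -(A * (2 * t₀) ^ (-β)) := by simp only [dualParam, hA, hβ]; ring
    rw [this]
    nlinarith [mul_pos hA0 h1]
  have he3 : -U ≤ dualParam k (2 * t₀) := by
    have h1 : (2 * t₀) ^ (-β) ≤ t₀ ^ (-β) :=
      Real.rpow_le_rpow_of_nonpos ht₀ (by linarith) (by linarith)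
    have : dualParam k (2 * t₀) = -(A * (2 * t₀) ^ (-β)) := by simp only [dualParam, hA, hβ]; ring
    rw [this, hU]
    nlinarith
  have hext : ∫ u in (dualParam k t₀)..(dualParam k (2 * t₀)), H u ≤
      ∫ u in (-U - U)..(-U + U), H u := by
    rw [he1]
    exact intervalIntegral.integral_mono_interval (by linarith) he3 (by linarith)
      (Filter.Eventually.of_forall fun t => hH0 t) (hHc.intervalIntegrable _ _)
  have hs := hsieve s c ω 1 U hU0 hc (-U)
  have h1U : 1 / U = 1 / A * t₀ ^ β := by
    rw [hU, Real.rpow_neg ht₀.le]; field_simp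
  rw [h1U] at hs
  have hfin := (hstep.trans hext).trans hs
  have hfac : 0 < β * U / (2 ^ (β + 1) * t₀) := by positivity
  rw [← le_div_iff₀' hfac] at hfin
  refine hfin.trans (le_of_eq ?_)
  have h2 : (0 : ℝ) < 2 ^ (β + 1) := Real.rpow_pos_of_pos (by norm_num) _
  field_simp

/-! ### Block decompositions -/

/-- The integers in `[N, κN]`. -/
noncomputable def intRange (N κ : ℝ) : Finset ℤ := Finset.Icc ⌈N⌉ ⌊κ * N⌋

theorem mem_intRange {N κ : ℝ} {n : ℤ} : n ∈ intRange N κ ↔ N ≤ n ∧ (n : ℝ) ≤ κ * N := by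
  rw [intRange, Finset.mem_Icc, Int.ceil_le, Int.le_floor]

/-- Pairs of elements of `S` in the same block of length `q`. -/
def blockPairs (S : Finset ℤ) (q : ℕ) : Finset (ℤ × ℤ) :=
  (S ×ˢ S).filter fun p => p.1 / (q : ℤ) = p.2 / (q : ℤ)

/-- The difference of the `k`-th powers of the two entries. -/
noncomputable def powDiff (k : ℝ) (p : ℤ × ℤ) : ℝ := (p.1 : ℝ) ^ k - (p.2 : ℝ) ^ k

/-- The number of quadruples in `[N, κN]` with `n₁, n₂` and `n₃, n₄` in common blocks of length
`L` and `|n₁ ^ k - n₂ ^ k - n₃ ^ k + n₄ ^ k| ≤ N ^ (k - 1) / L`. -/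
noncomputable def quadCount (k N κ : ℝ) (L : ℕ) : ℕ :=
  (closePairs (blockPairs (intRange N κ) L) (powDiff k) (N ^ (k - 1) / L)).card

theorem sum_normSq_blocks (S : Finset ℤ) (q : ℕ) (f : ℤ → ℂ) :
    ((∑ i ∈ S.image (· / (q : ℤ)), ‖∑ m ∈ S with m / (q : ℤ) = i, f m‖ ^ 2 : ℝ) : ℂ) =
      ∑ p ∈ blockPairs S q, f p.1 * starRingEnd ℂ (f p.2) := by
  rw [blockPairs, Finset.sum_filter, Finset.sum_product]
  push_cast
  have h1 : ∀ i ∈ S.image (· / (q : ℤ)), ((‖∑ m ∈ S with m / (q : ℤ) = i, f m‖ : ℝ) : ℂ) ^ 2 =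
      ∑ m ∈ S with m / (q : ℤ) = i,
        ∑ m' ∈ S, if m / (q : ℤ) = m' / (q : ℤ) then f m * starRingEnd ℂ (f m') else 0 := by
    intro i _
    rw [← Complex.mul_conj', map_sum, Finset.sum_mul]
    refine Finset.sum_congr rfl fun m hm => ?_
    rw [Finset.mul_sum, Finset.sum_filter]
    refine Finset.sum_congr rfl fun m' _ => ?_
    rw [(Finset.mem_filter.mp hm).2]
    simp only [eq_comm]
  rw [Finset.sum_congr rfl h1]
  exact Finset.sum_fiberwise_of_maps_to (fun m hm => Finset.mem_image_of_mem _ hm) _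

theorem closePairs_card_mono {ι : Type*} {s s' : Finset ι} {ω : ι → ℝ} {η η' : ℝ} (hs : s ⊆ s')
    (h : η ≤ η') : (closePairs s ω η).card ≤ (closePairs s' ω η').card := by
  refine Finset.card_le_card fun p hp => ?_
  rw [mem_closePairs] at hp ⊢
  exact ⟨⟨hs hp.1.1, hs hp.1.2⟩, hp.2.trans h⟩

theorem card_le_of_abs_sub_le {s : Finset ℤ} {D : ℝ} (hD : 0 ≤ D)
    (h : ∀ i ∈ s, ∀ j ∈ s, |(i : ℝ) - j| ≤ D) : (s.card : ℝ) ≤ D + 1 := by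
  rcases s.eq_empty_or_nonempty with rfl | hs
  · simp; linarith
  · set j₀ := s.min' hs with hj
    have hsub : s ⊆ Finset.Icc j₀ (j₀ + ⌊D⌋) := fun i hi => by
      have h1 := s.min'_le i hi
      have h2 := h i hi j₀ (s.min'_mem hs)
      rw [Finset.mem_Icc]
      refine ⟨h1, ?_⟩
      have h3 : i - j₀ ≤ ⌊D⌋ := Int.le_floor.mpr (by push_cast; exact (le_abs_self _).trans h2)
      linarith
    have h4 := Finset.card_le_card hsub
    rw [Int.card_Icc] at h4
    have h5 : (s.card : ℤ) ≤ ⌊D⌋ + 1 := by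
      have := Int.floor_nonneg.mpr hD
      omega
    have h6 : (s.card : ℝ) ≤ (⌊D⌋ : ℝ) + 1 := by exact_mod_cast h5
    linarith [Int.floor_le D]

theorem card_image_ediv_le {N κ : ℝ} {L : ℕ} (hκ : 1 ≤ κ) (hL : 1 ≤ L) (hLN : (L : ℝ) ≤ N) :
    (((intRange N κ).image (· / (L : ℤ))).card : ℝ) ≤ (κ + 1) * (N / L) := by
  have hL0 : (0 : ℝ) < L := by exact_mod_cast hL
  have hLz : (0 : ℤ) < L := by exact_mod_cast hL
  have hN : 0 < N := by linarith
  have h1 : 1 ≤ N / L := by rw [le_div_iff₀ hL0]; linarith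
  refine (card_le_of_abs_sub_le (D := κ * (N / L)) (by positivity) ?_).trans (by linarith)
  intro i hi j hj
  obtain ⟨m, hm, rfl⟩ := Finset.mem_image.mp hi
  obtain ⟨n, hn, rfl⟩ := Finset.mem_image.mp hj
  rw [mem_intRange] at hm hn
  have key : ∀ {m : ℤ}, N ≤ m ∧ (m : ℝ) ≤ κ * N →
      0 ≤ ((m / (L : ℤ) : ℤ) : ℝ) ∧ ((m / (L : ℤ) : ℤ) : ℝ) ≤ κ * (N / L) := by
    intro m hm
    have hm0 : (0 : ℤ) ≤ m := by
      have : (0 : ℝ) ≤ m := by linarith [hm.1]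
      exact_mod_cast this
    refine ⟨by exact_mod_cast Int.ediv_nonneg hm0 hLz.le, ?_⟩
    rw [← mul_div_assoc, le_div_iff₀ hL0]
    have : m / (L : ℤ) * L ≤ m := Int.ediv_mul_le m hLz.ne'
    have : ((m / (L : ℤ) : ℤ) : ℝ) * L ≤ m := by exact_mod_cast this
    linarith [hm.2]
  have a := key hm
  have b := key hn
  rw [abs_le]
  constructor <;> linarith [a.1, a.2, b.1, b.2]

/-- An interval with `B ≤ A + q` meets only the block of `A` and the next one. Each part is
completed modulo `q`, and Cauchy–Schwarz with the completion weights, whose sum is at most `K`,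
moves the square inside. -/
theorem norm_sum_Icc_mul_sq_le {q : ℕ} (hq : 0 < q) {S : Finset ℤ} (z α : ℤ → ℂ) {A B : ℤ}
    {V K : ℝ} (hV : ∀ m ∈ Finset.Icc A B, ‖α m‖ ≤ V)
    (hvar : ∑ m ∈ Finset.Ico A B, ‖α (m + 1) - α m‖ ≤ V) (hAB : B ≤ A + q)
    (hS : Finset.Icc A B ⊆ S) (hK : ∑ r ∈ Finset.range q, completionWeight q r ≤ K) :
    ‖∑ m ∈ Finset.Icc A B, α m * z m‖ ^ 2 ≤ 8 * V ^ 2 * K *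
      (∑ r ∈ Finset.range q, completionWeight q r *
          ‖∑ m ∈ S with m / (q : ℤ) = A / q, z m * expTwoPiI ((r : ℝ) / q * m)‖ ^ 2 +
        ∑ r ∈ Finset.range q, completionWeight q r *
          ‖∑ m ∈ S with m / (q : ℤ) = A / q + 1, z m * expTwoPiI ((r : ℝ) / q * m)‖ ^ 2) := by
  have hqz : (0 : ℤ) < q := by exact_mod_cast hq
  have hdisj : Disjoint ({m ∈ S | m / (q : ℤ) = A / q}.filter (· ∈ Finset.Icc A B))
      ({m ∈ S | m / (q : ℤ) = A / q + 1}.filter (· ∈ Finset.Icc A B)) := by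
    rw [Finset.disjoint_left]
    intro m hm hm'
    simp only [Finset.mem_filter] at hm hm'
    omega
  have hsplit : Finset.Icc A B = ({m ∈ S | m / (q : ℤ) = A / q}.filter (· ∈ Finset.Icc A B)) ∪
      ({m ∈ S | m / (q : ℤ) = A / q + 1}.filter (· ∈ Finset.Icc A B)) := by
    ext m
    simp only [Finset.mem_union, Finset.mem_filter]
    constructor
    · intro hm
      have hmS := hS hm
      have hm' := Finset.mem_Icc.mp hm
      have h1 : A / (q : ℤ) ≤ m / q := Int.ediv_le_ediv hqz hm'.1
      have h2 : m / (q : ℤ) ≤ (A + q) / q := Int.ediv_le_ediv hqz (hm'.2.trans hAB)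
      rw [Int.add_ediv_of_dvd_right (dvd_refl _), Int.ediv_self hqz.ne'] at h2
      rcases (by omega : m / (q : ℤ) = A / q ∨ m / (q : ℤ) = A / q + 1) with h | h
      · exact Or.inl ⟨⟨hmS, h⟩, hm⟩
      · exact Or.inr ⟨⟨hmS, h⟩, hm⟩
    · rintro (h | h) <;> exact h.2
  have hV0 : 0 ≤ V := le_trans (Finset.sum_nonneg fun _ _ => norm_nonneg _) hvar
  have hone : ∀ i : ℤ, ‖∑ m ∈ {m ∈ S | m / (q : ℤ) = i} with m ∈ Finset.Icc A B, α m * z m‖ ^ 2 ≤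
      4 * V ^ 2 * K * ∑ r ∈ Finset.range q, completionWeight q r *
          ‖∑ m ∈ S with m / (q : ℤ) = i, z m * expTwoPiI ((r : ℝ) / q * m)‖ ^ 2 := by
    intro i
    have h1 := norm_sum_filter_mul_le hq {m ∈ S | m / (q : ℤ) = i} i
      (fun m hm => (Finset.mem_filter.mp hm).2) z α hV hvar
    set d : ℕ → ℝ := fun r =>
      ‖∑ m ∈ S with m / (q : ℤ) = i, z m * expTwoPiI ((r : ℝ) / q * m)‖ with hd
    have hcs : (∑ r ∈ Finset.range q, completionWeight q r * d r) ^ 2 ≤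
        (∑ r ∈ Finset.range q, completionWeight q r) *
          ∑ r ∈ Finset.range q, completionWeight q r * d r ^ 2 :=
      Finset.sum_sq_le_sum_mul_sum_of_sq_le_mul _
        (fun r hr => completionWeight_nonneg (Finset.mem_range.mp hr))
        (fun r hr => mul_nonneg (completionWeight_nonneg (Finset.mem_range.mp hr)) (sq_nonneg _))
        (fun r _ => le_of_eq (by ring))
    have hQ : 0 ≤ ∑ r ∈ Finset.range q, completionWeight q r * d r ^ 2 :=
      Finset.sum_nonneg fun r hr =>
        mul_nonneg (completionWeight_nonneg (Finset.mem_range.mp hr)) (sq_nonneg _)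
    calc _ ≤ (2 * V * ∑ r ∈ Finset.range q, completionWeight q r * d r) ^ 2 := by gcongr
      _ = 4 * V ^ 2 * (∑ r ∈ Finset.range q, completionWeight q r * d r) ^ 2 := by ring
      _ ≤ 4 * V ^ 2 * (K * ∑ r ∈ Finset.range q, completionWeight q r * d r ^ 2) := by
          gcongr
          exact hcs.trans (mul_le_mul_of_nonneg_right hK hQ)
      _ = _ := by ring
  conv_lhs => rw [hsplit]
  rw [Finset.sum_union hdisj]
  have h2 : ∀ x y : ℂ, ‖x + y‖ ^ 2 ≤ 2 * ‖x‖ ^ 2 + 2 * ‖y‖ ^ 2 := fun x y => by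
    have h := norm_add_le x y
    have h' : ‖x + y‖ ^ 2 ≤ (‖x‖ + ‖y‖) ^ 2 := by gcongr
    nlinarith [sq_nonneg (‖x‖ - ‖y‖)]
  refine (h2 _ _).trans ?_
  have a := hone (A / q)
  have b := hone (A / q + 1)
  linarith

/-- The derivative of `k x^(k-1)` is at least of order `N^(k-2)`. This is what keeps the dual ranges
of distant blocks apart. -/
theorem exists_rpow_separation {k κ : ℝ} (hk : 1 < k) (hκ : 1 ≤ κ) :
    ∃ K : ℝ, 1 ≤ K ∧ ∀ N x y : ℝ, 0 < N → x ∈ Set.Icc (N / 2) (2 * κ * N) →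
      y ∈ Set.Icc (N / 2) (2 * κ * N) →
      N ^ (k - 2) * |x - y| ≤ K * |k * x ^ (k - 1) - k * y ^ (k - 1)| := by
  obtain ⟨K, hK1, hK⟩ := exists_rpow_deriv_bounds hk hκ
  refine ⟨K, hK1, ?_⟩
  have key : ∀ N x y : ℝ, 0 < N → x ∈ Set.Icc (N / 2) (2 * κ * N) →
      y ∈ Set.Icc (N / 2) (2 * κ * N) → x ≤ y →
      N ^ (k - 2) * (y - x) ≤ K * (k * y ^ (k - 1) - k * x ^ (k - 1)) := by
    intro N x y hN hx hy hxy
    have hder : ∀ u ∈ Set.Icc (N / 2) (2 * κ * N),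
        HasDerivAt (fun u => k * u ^ (k - 1)) (k * (k - 1) * u ^ (k - 2)) u := by
      intro u hu
      have hu0 : 0 < u := lt_of_lt_of_le (by linarith) hu.1
      have h := (Real.hasDerivAt_rpow_const (p := k - 1) (Or.inl hu0.ne')).const_mul k
      convert! h using 1
      rw [show k - 1 - 1 = k - 2 by ring]; ring
    have h := (convex_Icc (N / 2) (2 * κ * N)).mul_sub_le_image_sub_of_le_deriv
      (fun u hu => (hder u hu).continuousAt.continuousWithinAt)
      (fun u hu => (hder u (interior_subset hu)).differentiableAt.differentiableWithinAt)
      (C := N ^ (k - 2) / K)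
      (fun u hu => by
        rw [(hder u (interior_subset hu)).deriv]
        exact (hK N u hN (interior_subset hu)).2.1.1) x hx y hy hxy
    have hK0 : 0 < K := by linarith
    calc N ^ (k - 2) * (y - x) = K * (N ^ (k - 2) / K * (y - x)) := by field_simp
      _ ≤ _ := by gcongr
  intro N x y hN hx hy
  have hN2 : 0 < N ^ (k - 2) := Real.rpow_pos_of_pos hN _
  rcases le_total x y with h | h
  · have := key N x y hN hx hy h
    rw [abs_sub_comm, abs_of_nonneg (sub_nonneg.mpr h), abs_sub_comm (k * x ^ (k - 1))]
    exact this.trans (mul_le_mul_of_nonneg_left (le_abs_self _) (by linarith))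
  · have := key N y x hN hy hx h
    rw [abs_of_nonneg (sub_nonneg.mpr h)]
    exact this.trans (mul_le_mul_of_nonneg_left (le_abs_self _) (by linarith))

/-! ### The transformation from a mean value to a dual count -/

/-- Weighted mean square, over the blocks of length `q` in `S`, of the twisted sums of `z`. -/
noncomputable def twistedBlockSum (S : Finset ℤ) (q : ℕ) (z : ℤ → ℂ) : ℝ :=
  ∑ r ∈ Finset.range q, completionWeight q r * ∑ i ∈ S.image (· / (q : ℤ)),
    ‖∑ m ∈ S with m / (q : ℤ) = i, z m * expTwoPiI ((r : ℝ) / q * m)‖ ^ 2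

theorem sum_comp_le_of_fiber_card_le {J I : Finset ℤ} {g : ℤ → ℤ} {Q : ℤ → ℝ} {D : ℝ}
    (hQ : ∀ i, 0 ≤ Q i) (hQI : ∀ i, i ∉ I → Q i = 0)
    (hD : ∀ i, ((J.filter fun j => g j = i).card : ℝ) ≤ D) (hD0 : 0 ≤ D) :
    ∑ j ∈ J, Q (g j) ≤ D * ∑ i ∈ I, Q i := by
  rw [Finset.sum_comp Q g]
  have h1 : ∑ b ∈ J.image g, (J.filter fun j => g j = b).card • Q b ≤
      ∑ b ∈ J.image g, D * Q b := by
    refine Finset.sum_le_sum fun b _ => ?_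
    rw [nsmul_eq_mul]
    exact mul_le_mul_of_nonneg_right (hD b) (hQ b)
  refine h1.trans ?_
  rw [← Finset.mul_sum]
  refine mul_le_mul_of_nonneg_left ?_ hD0
  refine (Finset.sum_le_sum_of_subset_of_nonneg (Finset.subset_union_left (s₂ := I))
    (fun i _ _ => hQ i)).trans (le_of_eq ?_)
  exact (Finset.sum_subset (s₁ := I) (s₂ := J.image g ∪ I) Finset.subset_union_right
    fun i _ hi => hQI i hi).symm

/-- Each `F j` is dominated by the completed energies `Q` of two adjacent dual blocks. By `hsep` at
most `D + 1` indices `j` have dual intervals starting in the same block, so summing over `j` counts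
every dual block a bounded number of times. -/
theorem sum_normSq_le_twistedBlockSum {q : ℕ} (hq : 0 < q) {S J : Finset ℤ} (F z : ℤ → ℂ)
    (α : ℤ → ℤ → ℂ) (A B : ℤ → ℤ) {V K E D : ℝ} (hD : 0 ≤ D) (hK0 : 0 ≤ K)
    (hK : ∑ r ∈ Finset.range q, completionWeight q r ≤ K)
    (hV : ∀ j ∈ J, ∀ m ∈ Finset.Icc (A j) (B j), ‖α j m‖ ≤ V)
    (hvar : ∀ j ∈ J, ∑ m ∈ Finset.Ico (A j) (B j), ‖α j (m + 1) - α j m‖ ≤ V)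
    (hAB : ∀ j ∈ J, B j ≤ A j + q) (hS : ∀ j ∈ J, Finset.Icc (A j) (B j) ⊆ S)
    (hF : ∀ j ∈ J, ‖F j - ∑ m ∈ Finset.Icc (A j) (B j), α j m * z m‖ ≤ E)
    (hsep : ∀ i ∈ J, ∀ j ∈ J, A i ≤ B i → A j ≤ B j → A i / (q : ℤ) = A j / q →
      |(i : ℝ) - j| ≤ D) :
    ∑ j ∈ J, ‖F j‖ ^ 2 ≤ 2 * E ^ 2 * J.card +
      32 * V ^ 2 * K * (D + 1) * twistedBlockSum S q z := by
  classical
  set Q : ℤ → ℝ := fun i => ∑ r ∈ Finset.range q, completionWeight q r *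
    ‖∑ m ∈ S with m / (q : ℤ) = i, z m * expTwoPiI ((r : ℝ) / q * m)‖ ^ 2 with hQdef
  have hQ0 : ∀ i, 0 ≤ Q i := fun i => Finset.sum_nonneg fun r hr =>
    mul_nonneg (completionWeight_nonneg (Finset.mem_range.mp hr)) (sq_nonneg _)
  set I := S.image (· / (q : ℤ)) with hI
  have hQI : ∀ i, i ∉ I → Q i = 0 := by
    intro i hi
    have : S.filter (fun m => m / (q : ℤ) = i) = ∅ := by
      rw [Finset.filter_eq_empty_iff]
      intro m hm h
      exact hi (Finset.mem_image.mpr ⟨m, hm, h⟩)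
    simp only [hQdef, this]
    simp
  have htw : twistedBlockSum S q z = ∑ i ∈ I, Q i := by
    simp only [twistedBlockSum, hQdef, Finset.mul_sum]
    rw [Finset.sum_comm]
  -- An empty dual interval contributes only the error `E`; it has to be set aside because `hsep`
  -- concerns nonempty intervals only.
  set J' := J.filter fun j => A j ≤ B j with hJ'
  have hone : ∀ j ∈ J, ‖F j‖ ^ 2 ≤ 2 * E ^ 2 +
      (if A j ≤ B j then 16 * V ^ 2 * K * (Q (A j / q) + Q (A j / q + 1)) else 0) := by
    intro j hj
    set P := ∑ m ∈ Finset.Icc (A j) (B j), α j m * z m with hP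
    have h1 : ‖F j‖ ≤ E + ‖P‖ := by
      have := norm_add_le (F j - P) P
      rw [sub_add_cancel] at this
      linarith [hF j hj]
    have h2 : ‖F j‖ ^ 2 ≤ 2 * E ^ 2 + 2 * ‖P‖ ^ 2 := by
      have : ‖F j‖ ^ 2 ≤ (E + ‖P‖) ^ 2 := by gcongr
      nlinarith [sq_nonneg (E - ‖P‖)]
    split_ifs with h
    · have h3 := norm_sum_Icc_mul_sq_le hq z (α j) (hV j hj) (hvar j hj) (hAB j hj) (hS j hj) hK
      have h3' : ‖P‖ ^ 2 ≤ 8 * V ^ 2 * K * (Q (A j / q) + Q (A j / q + 1)) := h3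
      linarith
    · have h3 : P = 0 := by rw [hP, Finset.Icc_eq_empty h, Finset.sum_empty]
      rw [h3] at h2
      simpa using h2
  have hfib : ∀ (e i : ℤ), ((J'.filter fun j => A j / (q : ℤ) + e = i).card : ℝ) ≤ D + 1 := by
    intro e i
    refine card_le_of_abs_sub_le hD fun j hj j' hj' => ?_
    simp only [hJ', Finset.mem_filter] at hj hj'
    exact hsep j hj.1.1 j' hj'.1.1 hj.1.2 hj'.1.2 (by linarith [hj.2, hj'.2])
  have hs : ∀ e : ℤ, ∑ j ∈ J', Q (A j / q + e) ≤ (D + 1) * ∑ i ∈ I, Q i := fun e =>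
    sum_comp_le_of_fiber_card_le hQ0 hQI (hfib e) (by linarith)
  have hs0 := hs 0
  have hs1 := hs 1
  simp only [add_zero] at hs0
  have hV2 : 0 ≤ 16 * V ^ 2 * K := by positivity
  calc ∑ j ∈ J, ‖F j‖ ^ 2 ≤ ∑ j ∈ J, (2 * E ^ 2 +
      (if A j ≤ B j then 16 * V ^ 2 * K * (Q (A j / q) + Q (A j / q + 1)) else 0)) :=
        Finset.sum_le_sum hone
    _ = 2 * E ^ 2 * J.card + 16 * V ^ 2 * K *
        (∑ j ∈ J', Q (A j / q) + ∑ j ∈ J', Q (A j / q + 1)) := by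
        rw [Finset.sum_add_distrib, ← Finset.sum_filter, ← hJ', ← Finset.mul_sum (s := J') (f := fun j => Q (A j / q) + Q (A j / q + 1)),
          ← Finset.sum_add_distrib, Finset.sum_const, nsmul_eq_mul]
        ring
    _ ≤ 2 * E ^ 2 * J.card + 16 * V ^ 2 * K *
        ((D + 1) * ∑ i ∈ I, Q i + (D + 1) * ∑ i ∈ I, Q i) := by gcongr
    _ = _ := by rw [htw]; ring

theorem continuousOn_dualParam {k t₀ : ℝ} (ht₀ : 0 < t₀) :
    ContinuousOn (dualParam k) (Set.uIcc t₀ (2 * t₀)) := by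
  unfold dualParam
  refine continuousOn_const.mul (ContinuousOn.rpow_const continuousOn_id fun t ht => ?_)
  rw [Set.uIcc_of_le (by linarith)] at ht
  exact Or.inl (show t ≠ 0 by linarith [ht.1])

theorem continuous_twistedBlockSum (S : Finset ℤ) (q : ℕ) (k' : ℝ) :
    Continuous fun u => twistedBlockSum S q fun m => expTwoPiI ((m : ℝ) ^ k' * u) := by
  unfold twistedBlockSum
  fun_prop

/-- Cauchy–Schwarz in `r` reduces to a fixed twist. Its total energy is an exponential sum over
pairs in common blocks, with frequencies `powDiff` and unimodular coefficients carrying the twist,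
so the dual mean square applies and the twist disappears. -/
theorem exists_integral_twistedBlockSum_le {k : ℝ} (hk : 1 < k) :
    ∃ C a : ℝ, 0 < C ∧ 0 < a ∧ ∀ (S : Finset ℤ) (q : ℕ) (K k' t₀ : ℝ), 0 < t₀ →
      ∑ r ∈ Finset.range q, completionWeight q r ≤ K →
      ∫ t in t₀..(2 * t₀), (twistedBlockSum S q
        fun m => expTwoPiI ((m : ℝ) ^ k' * dualParam k t)) ^ 2 ≤
      C * t₀ * K ^ 2 * (closePairs (blockPairs S q) (powDiff k') (a * t₀ ^ (1 / (k - 1)))).card := by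
  obtain ⟨C, a, hC, ha, h⟩ := exists_integral_dual_le hk
  refine ⟨C, a, hC, ha, ?_⟩
  intro S q K k' t₀ ht₀ hK
  have hK0 : 0 ≤ K := (Finset.sum_nonneg fun r hr =>
    completionWeight_nonneg (Finset.mem_range.mp hr)).trans hK
  set R : ℝ :=
    (((closePairs (blockPairs S q) (powDiff k') (a * t₀ ^ (1 / (k - 1)))).card : ℕ) : ℝ) with hR
  set c : ℕ → ℤ × ℤ → ℂ := fun r p => expTwoPiI ((r : ℝ) / q * p.1) *
    starRingEnd ℂ (expTwoPiI ((r : ℝ) / q * p.2)) with hc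
  have hc1 : ∀ r, ∀ p ∈ blockPairs S q, ‖c r p‖ ≤ 1 := by
    intro r p _
    simp [hc]
  set H : ℕ → ℝ → ℝ := fun r u =>
    ‖∑ p ∈ blockPairs S q, c r p * expTwoPiI (powDiff k' p * u)‖ ^ 2 with hH
  have hpt : ∀ u : ℝ, (twistedBlockSum S q fun m => expTwoPiI ((m : ℝ) ^ k' * u)) ^ 2 ≤
      K * ∑ r ∈ Finset.range q, completionWeight q r * H r u := by
    intro u
    set X : ℕ → ℝ := fun r => ∑ i ∈ S.image (· / (q : ℤ)), ‖∑ m ∈ S with m / (q : ℤ) = i,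
      expTwoPiI ((m : ℝ) ^ k' * u) * expTwoPiI ((r : ℝ) / q * m)‖ ^ 2 with hX
    have hXH : ∀ r, X r ^ 2 = H r u := by
      intro r
      have h1 := sum_normSq_blocks S q
        (fun m => expTwoPiI ((m : ℝ) ^ k' * u) * expTwoPiI ((r : ℝ) / q * m))
      have hX0 : 0 ≤ X r := Finset.sum_nonneg fun _ _ => sq_nonneg _
      have h2 : X r = ‖((X r : ℝ) : ℂ)‖ := by
        rw [Complex.norm_real, Real.norm_of_nonneg hX0]
      rw [h2, h1, hH]
      congr 2
      refine Finset.sum_congr rfl fun p _ => ?_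
      simp only [hc, powDiff, sub_mul, expTwoPiI_sub, map_mul]
      ring
    have hcs : (∑ r ∈ Finset.range q, completionWeight q r * X r) ^ 2 ≤
        (∑ r ∈ Finset.range q, completionWeight q r) *
          ∑ r ∈ Finset.range q, completionWeight q r * X r ^ 2 :=
      Finset.sum_sq_le_sum_mul_sum_of_sq_le_mul _
        (fun r hr => completionWeight_nonneg (Finset.mem_range.mp hr))
        (fun r hr => mul_nonneg (completionWeight_nonneg (Finset.mem_range.mp hr)) (sq_nonneg _))
        (fun r _ => le_of_eq (by ring))
    have hQ : 0 ≤ ∑ r ∈ Finset.range q, completionWeight q r * X r ^ 2 :=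
      Finset.sum_nonneg fun r hr =>
        mul_nonneg (completionWeight_nonneg (Finset.mem_range.mp hr)) (sq_nonneg _)
    refine hcs.trans ((mul_le_mul_of_nonneg_right hK hQ).trans (le_of_eq ?_))
    simp only [hXH]
  have hd := continuousOn_dualParam (k := k) ht₀
  have hHc : ∀ r, Continuous (H r) := fun r => by simp only [hH]; fun_prop
  have hHi : ∀ r, IntervalIntegrable (fun t => H r (dualParam k t)) volume t₀ (2 * t₀) :=
    fun r => ((hHc r).comp_continuousOn hd).intervalIntegrable
  have hint1 : IntervalIntegrable (fun t => (twistedBlockSum S q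
      fun m => expTwoPiI ((m : ℝ) ^ k' * dualParam k t)) ^ 2) volume t₀ (2 * t₀) :=
    (((continuous_twistedBlockSum S q k').pow 2).comp_continuousOn hd).intervalIntegrable
  have hint2 : IntervalIntegrable (fun t => K * ∑ r ∈ Finset.range q, completionWeight q r *
      H r (dualParam k t)) volume t₀ (2 * t₀) := by
    have : Continuous fun u => K * ∑ r ∈ Finset.range q, completionWeight q r * H r u :=
      continuous_const.mul (continuous_finsetSum _ fun r _ => continuous_const.mul (hHc r))
    exact (this.comp_continuousOn hd).intervalIntegrable
  calc _ ≤ ∫ t in t₀..(2 * t₀), K * ∑ r ∈ Finset.range q, completionWeight q r *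
        H r (dualParam k t) :=
        intervalIntegral.integral_mono_on (by linarith) hint1 hint2 fun t _ => hpt _
    _ = K * ∑ r ∈ Finset.range q, completionWeight q r *
          ∫ t in t₀..(2 * t₀), H r (dualParam k t) := by
        rw [intervalIntegral.integral_const_mul, intervalIntegral.integral_finsetSum
          fun r _ => (hHi r).const_mul _]
        simp only [intervalIntegral.integral_const_mul]
    _ ≤ K * ∑ r ∈ Finset.range q, completionWeight q r * (C * t₀ * R) := by
        gcongr with r hr
        · exact completionWeight_nonneg (Finset.mem_range.mp hr)
        · exact h (blockPairs S q) (c r) (powDiff k') t₀ ht₀ (hc1 r)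
    _ ≤ K * (K * (C * t₀ * R)) := by
        rw [← Finset.sum_mul]
        gcongr
    _ = _ := by ring

theorem continuous_smoothBlock (w : ℝ → ℝ) (k L c : ℝ) : Continuous (smoothBlock w k L c) := by
  unfold smoothBlock
  fun_prop

theorem mul_ediv_mem_Icc {N κ : ℝ} {L : ℕ} (hL : 1 ≤ L) {j : ℤ}
    (hj : j ∈ (intRange N κ).image (· / (L : ℤ))) : ((j : ℝ) * L) ∈ Set.Icc (N - L) (κ * N) := by
  obtain ⟨n, hn, rfl⟩ := Finset.mem_image.mp hj
  rw [mem_intRange] at hn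
  have hLz : (0 : ℤ) < L := by exact_mod_cast hL
  have h1 : n / (L : ℤ) * L ≤ n := Int.ediv_mul_le n hLz.ne'
  have h2 : n < (n / (L : ℤ) + 1) * L := Int.lt_ediv_add_one_mul_self n hLz
  have h1' : ((n / (L : ℤ) : ℤ) : ℝ) * L ≤ n := by exact_mod_cast h1
  have h2' : (n : ℝ) < (((n / (L : ℤ) : ℤ) : ℝ) + 1) * L := by exact_mod_cast h2
  constructor <;> linarith [hn.1, hn.2]

set_option maxHeartbeats 1000000 in
-- The dual lengths are `M ≍ t₀ N^(k-1)` and `L₁ ≍ t₀ N^(k-2) L`. Hence `L₁/M ≍ L/N`, and the upper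
-- limit on `t₀` gives `M ≤ L`: the dual problem is shorter with the same ratio.
theorem exists_integral_smoothBlock_le {w w₁ w₂ : ℝ → ℝ} {W k κ : ℝ} (hw : IsCutoff w w₁ w₂ W)
    (hk : 1 < k) (hκ : 1 ≤ κ) :
    ∃ C ρ κ' : ℝ, 1 ≤ C ∧ 0 < ρ ∧ ρ ≤ 1 / 2 ∧ 1 ≤ κ' ∧ ∀ (N t₀ : ℝ) (L : ℕ), 0 < N → 1 ≤ L →
      (L : ℝ) ≤ ρ * N → 0 < t₀ → 1 / 2 ≤ t₀ * N ^ (k - 2) * L → t₀ ≤ L / (8 * N ^ (k - 1)) →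
      ∃ (M : ℝ) (L₁ : ℕ), 1 ≤ L₁ ∧ (L₁ : ℝ) ≤ M ∧ M ≤ C * L ∧ L₁ * N ≤ C * L * M ∧
        M * L ≤ C * N * L₁ ∧
        ∫ t in t₀..(2 * t₀), (∑ j ∈ (intRange N κ).image (· / (L : ℤ)),
            ‖smoothBlock w k L (j * L) t‖ ^ 2) ^ 2 ≤
          C * t₀ * ((N / L) ^ 2 +
            (1 + Real.log N) ^ 4 * (N / M) ^ 2 * quadCount (k / (k - 1)) M κ' L₁) := by
  obtain ⟨C₁, ρ₁, hC₁, hρ₁, hblock⟩ := exists_smoothBlock_bounds hw hk hκ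
  obtain ⟨K₂, hK₂, hsepK⟩ := exists_rpow_separation hk hκ
  obtain ⟨C₀, a, hC₀, ha, hdual⟩ := exists_integral_twistedBlockSum_le hk
  have hC₁0 : 0 < C₁ := by linarith
  have hk1 : 0 < k - 1 := by linarith
  set β : ℝ := 1 / (k - 1) with hβ
  have hβ0 : 0 < β := by positivity
  -- Since `lam L ≥ 1/2`, rounding up in the definition of `L₁` costs at most `2 lam L`.
  set C₄ : ℝ := 4 * C₁ + 2 with hC₄
  set D : ℝ := K₂ * (C₄ + 4 * C₁) with hD
  have hD0 : 0 ≤ D := by positivity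
  set P : ℝ := a * C₁ ^ β with hP
  have hP0 : 0 < P := mul_pos ha (Real.rpow_pos_of_pos hC₁0 _)
  -- The four terms ensure, in order, that the B-process applies, that `2L ≤ N`, that `L₁ ≤ M`, and
  -- that the tolerance of the dual count is at most `M^(k'-1)/L₁`.
  set ρ : ℝ := min (min ρ₁ (1 / 2)) (min (1 / (C₄ * C₁)) (1 / P)) with hρ
  have hρ0 : 0 < ρ := by
    refine lt_min (lt_min hρ₁ (by norm_num)) (lt_min (by positivity) (by positivity))
  have hρa : ρ ≤ ρ₁ := (min_le_left _ _).trans (min_le_left _ _)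
  have hρb : ρ ≤ 1 / 2 := (min_le_left _ _).trans (min_le_right _ _)
  have hρc : ρ * (C₄ * C₁) ≤ 1 := by
    rw [← le_div_iff₀ (by positivity)]
    exact (min_le_right _ _).trans (min_le_left _ _)
  have hρd : ρ * P ≤ 1 := by
    rw [← le_div_iff₀ hP0]
    exact (min_le_right _ _).trans (min_le_right _ _)
  set E₁ : ℝ := 8 * C₁ ^ 4 * (κ + 1) ^ 2 with hE₁
  set E₂ : ℝ := 2048 * C₁ ^ 2 * (D + 1) ^ 2 * 16 * C₀ with hE₂
  set C : ℝ := 1 + C₁ + C₄ * C₁ + E₁ + E₂ with hC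
  have hC₄0 : 0 < C₄ := by positivity
  have hE₁0 : 0 ≤ E₁ := by positivity
  have hE₂0 : 0 ≤ E₂ := by positivity
  have hC₄C₁ : 0 < C₄ * C₁ := by positivity
  refine ⟨C, ρ, 2 * C₁ ^ 2, by linarith, hρ0, hρb, by linarith [one_le_pow₀ hC₁ (n := 2)], ?_⟩
  intro N t₀ L hN hL hLρ ht₀ hlow hhigh
  have hL1 : (1 : ℝ) ≤ L := by exact_mod_cast hL
  have hL0 : (0 : ℝ) < L := by linarith
  have hNL : 2 * (L : ℝ) ≤ N := by linarith [mul_le_mul_of_nonneg_right hρb hN.le]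
  have hNk : 0 < N ^ (k - 1) := Real.rpow_pos_of_pos hN _
  have hNk2 : 0 < N ^ (k - 2) := Real.rpow_pos_of_pos hN _
  have hNkk : N ^ (k - 1) = N ^ (k - 2) * N := by
    rw [show k - 1 = (k - 2) + 1 by ring, Real.rpow_add hN, Real.rpow_one]
  set lam : ℝ := t₀ * N ^ (k - 2) with hlam
  have hlam0 : 0 < lam := by positivity
  have hlamN : t₀ * N ^ (k - 1) = lam * N := by rw [hNkk, hlam]; ring
  have hlamL : lam * N ≤ L / 8 := by
    rw [le_div_iff₀ (by positivity)] at hhigh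
    linarith
  -- For every `t` in `[t₀, 2t₀]` the dual variables lie in `[M, 2C₁² M]`, which fixes `κ' = 2C₁²`.
  set M : ℝ := lam * N / C₁ with hM
  have hM0 : 0 < M := by positivity
  have hMC : M * C₁ = lam * N := by rw [hM]; field_simp
  -- For `t ≤ 2t₀` a dual interval has length at most `2 C₁ (2 lam) L`.
  set L₁ : ℕ := ⌈4 * C₁ * (lam * L)⌉₊ with hL₁
  have hlL : 1 / 2 ≤ lam * L := hlow
  have hL₁lo : 4 * C₁ * (lam * L) ≤ L₁ := Nat.le_ceil _
  have hL₁hi : (L₁ : ℝ) ≤ C₄ * (lam * L) := by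
    have := (Nat.ceil_lt_add_one (a := 4 * C₁ * (lam * L)) (by positivity)).le
    rw [hC₄]; linarith
  have hL₁1 : 1 ≤ L₁ := Nat.one_le_iff_ne_zero.mpr fun h => by
    have h1 : 0 < 4 * C₁ * (lam * L) := by positivity
    rw [h, Nat.cast_zero] at hL₁lo
    linarith
  have hL₁0 : 0 < L₁ := hL₁1
  have hL₁M : (L₁ : ℝ) ≤ M := by
    rw [hM, le_div_iff₀ hC₁0]
    calc (L₁ : ℝ) * C₁ ≤ C₄ * (lam * L) * C₁ := by gcongr
      _ ≤ C₄ * (lam * (ρ * N)) * C₁ := by gcongr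
      _ = (ρ * (C₄ * C₁)) * (lam * N) := by ring
      _ ≤ 1 * (lam * N) := by gcongr
      _ = lam * N := one_mul _
  have hMlam : M ≤ lam * N := div_le_self (by positivity) hC₁
  have hML : M ≤ L := by linarith
  have hL₁N : (L₁ : ℝ) ≤ ρ * N := by linarith
  have hN1 : 1 ≤ N := by linarith
  refine ⟨M, L₁, hL₁1, hL₁M, ?_, ?_, ?_, ?_⟩
  · exact hML.trans (le_mul_of_one_le_left hL0.le (by linarith))
  · calc (L₁ : ℝ) * N ≤ C₄ * (lam * L) * N := by gcongr
      _ = C₄ * L * (M * C₁) := by rw [hMC]; ring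
      _ = (C₄ * C₁) * (L * M) := by ring
      _ ≤ C * (L * M) := by gcongr; linarith
      _ = _ := by ring
  · have h1 : M * L ≤ N * L₁ := by
      have h3 : lam * L ≤ L₁ :=
        (le_mul_of_one_le_left (by positivity) (by linarith)).trans hL₁lo
      calc M * L ≤ lam * N * L := by gcongr
        _ = N * (lam * L) := by ring
        _ ≤ N * L₁ := by gcongr
    have h4 : 0 ≤ N * L₁ := by positivity
    calc M * L ≤ N * L₁ := h1
      _ ≤ C * (N * L₁) := le_mul_of_one_le_left h4 (by linarith)
      _ = _ := by ring
  set J := (intRange N κ).image (· / (L : ℤ)) with hJ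
  set S := intRange M (2 * C₁ ^ 2) with hS
  set k' := k / (k - 1) with hk'
  have hk'1 : k' - 1 = β := by rw [hk', hβ]; field_simp; ring
  set K : ℝ := 2 * (1 + Real.log N) with hK
  have hlogN : 0 ≤ Real.log N := Real.log_nonneg hN1
  have hK0 : 0 ≤ K := by positivity
  have hKsum : ∑ r ∈ Finset.range L₁, completionWeight L₁ r ≤ K := by
    refine (sum_completionWeight_le L₁).trans ?_
    have h1 : Real.log L₁ ≤ Real.log N :=
      Real.log_le_log (by exact_mod_cast hL₁0) (by linarith)
    rw [hK]; linarith
  set V : ℝ := C₁ / √lam with hV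
  have hV2 : V ^ 2 = C₁ ^ 2 / lam := by rw [hV, div_pow, Real.sq_sqrt hlam0.le]
  set Y : ℝ → ℝ := fun t => twistedBlockSum S L₁
    fun m => expTwoPiI ((m : ℝ) ^ k' * dualParam k t) with hY
  have hcen : ∀ j ∈ J, ((j : ℝ) * L) ∈ Set.Icc (N - L) (κ * N) := fun j hj =>
    mul_ediv_mem_Icc hL hj
  have hpt : ∀ t ∈ Set.Icc t₀ (2 * t₀), ∑ j ∈ J, ‖smoothBlock w k L (j * L) t‖ ^ 2 ≤
      2 * C₁ ^ 2 * J.card + 32 * V ^ 2 * K * (D + 1) * Y t := by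
    intro t ht
    have ht0 : 0 < t := by linarith [ht.1]
    set mu : ℝ := t * N ^ (k - 2) with hmu
    have hmulo : lam ≤ mu := by rw [hlam, hmu]; gcongr; exact ht.1
    have hmuhi : mu ≤ 2 * lam := by
      rw [hlam, hmu, ← mul_assoc]; gcongr; exact ht.2
    have hmuL : 1 / 2 ≤ mu * L := hlL.trans (mul_le_mul_of_nonneg_right hmulo hL0.le)
    have hmuN : t * N ^ (k - 1) = mu * N := by rw [hNkk, hmu]; ring
    -- The dual data may depend on `t` in an arbitrary way; only the pointwise bound by `Y t`, which
    -- no longer mentions them, is integrated.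
    have hex : ∀ j : ℤ, ∃ (A B : ℤ) (α : ℤ → ℂ), j ∈ J →
        (∀ m ∈ Finset.Icc A B, |(m : ℝ) - t * (k * ((j : ℝ) * L) ^ (k - 1))| ≤ C₁ * (mu * L) ∧
          mu * N / C₁ ≤ m ∧ m ≤ C₁ * (mu * N)) ∧
        (∀ m ∈ Finset.Icc A B, ‖α m‖ ≤ C₁ / √mu) ∧
        ∑ m ∈ Finset.Ico A B, ‖α (m + 1) - α m‖ ≤ C₁ / √mu ∧
        ‖smoothBlock w k L (j * L) t - ∑ m ∈ Finset.Icc A B,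
          α m * expTwoPiI ((m : ℝ) ^ k' * dualParam k t)‖ ≤ C₁ := by
      intro j
      by_cases hj : j ∈ J
      · obtain ⟨A, B, α, h⟩ := (hblock N L (j * L) t hN hL1 (hLρ.trans (by gcongr))
          (hcen j hj) ht0).2 hmuL
        rw [hmuN] at h
        exact ⟨A, B, α, fun _ => h⟩
      · exact ⟨0, 0, 0, fun h => absurd h hj⟩
    choose A B α hABα using hex
    have hVmu : C₁ / √mu ≤ V := by
      rw [hV]
      gcongr
    have hmem : ∀ j, A j ≤ B j → A j ∈ Finset.Icc (A j) (B j) := fun j h =>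
      Finset.mem_Icc.mpr ⟨le_rfl, h⟩
    refine sum_normSq_le_twistedBlockSum hL₁0 (fun j => smoothBlock w k L (j * L) t) _
      α A B hD0 hK0 hKsum (fun j hj m hm => ((hABα j hj).2.1 m hm).trans hVmu)
      (fun j hj => (hABα j hj).2.2.1.trans hVmu) ?_ ?_ (fun j hj => (hABα j hj).2.2.2) ?_
    · intro j hj
      by_cases h : A j ≤ B j
      · have h1 := ((hABα j hj).1 _ (hmem j h)).1
        have h2 := ((hABα j hj).1 (B j) (Finset.mem_Icc.mpr ⟨h, le_rfl⟩)).1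
        rw [abs_le] at h1 h2
        have h3 : C₁ * (mu * L) ≤ C₁ * (2 * lam * L) := by gcongr
        have h4 : (B j : ℝ) ≤ A j + L₁ := by linarith [h1.1, h2.2]
        exact_mod_cast h4
      · push Not at h
        have : (0 : ℤ) ≤ L₁ := by positivity
        linarith
    · intro j hj m hm
      have h1 := ((hABα j hj).1 m hm).2
      rw [hS, mem_intRange]
      constructor
      · refine le_trans ?_ h1.1
        rw [hM]; gcongr
      · refine h1.2.trans ?_
        calc C₁ * (mu * N) ≤ C₁ * (2 * lam * N) := by gcongr
          _ = 2 * C₁ * (M * C₁) := by rw [hMC]; ring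
          _ = _ := by ring
    · intro i hi j hj hi' hj' hij
      have h1 := ((hABα i hi).1 _ (hmem i hi')).1
      have h2 := ((hABα j hj).1 _ (hmem j hj')).1
      have h3 : |(A i : ℝ) - A j| ≤ L₁ := by
        have hq : (0 : ℤ) < L₁ := by exact_mod_cast hL₁0
        have e1 := Int.ediv_mul_le (A i) hq.ne'
        have e2 := Int.lt_ediv_add_one_mul_self (A i) hq
        have e3 := Int.ediv_mul_le (A j) hq.ne'
        have e4 := Int.lt_ediv_add_one_mul_self (A j) hq
        rw [hij] at e1 e2
        have : |A i - A j| ≤ (L₁ : ℤ) := by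
          rw [abs_le]; constructor <;> linarith
        exact_mod_cast this
      have hci := hcen i hi
      have hcj := hcen j hj
      have hwide : ∀ c : ℝ, c ∈ Set.Icc (N - L) (κ * N) → c ∈ Set.Icc (N / 2) (2 * κ * N) := by
        intro c hc
        refine ⟨by linarith [hc.1], hc.2.trans ?_⟩
        have : 0 < κ * N := by positivity
        linarith
      have h4 := hsepK N _ _ hN (hwide _ hci) (hwide _ hcj)
      -- If two dual intervals start in the same block of length `L₁`, their centres `t k
      -- (jL)^(k-1)` differ by `O(lam L)`; separation then bounds `|i - j|` by `D`.
      have h5 : |t * (k * ((i : ℝ) * L) ^ (k - 1)) - t * (k * ((j : ℝ) * L) ^ (k - 1))| ≤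
          (C₄ + 4 * C₁) * (lam * L) := by
        rw [abs_le] at h1 h2 h3 ⊢
        have h6 : C₁ * (mu * L) ≤ C₁ * (2 * lam * L) := by gcongr
        constructor <;> linarith [h1.1, h1.2, h2.1, h2.2, h3.1, h3.2]
      rw [← mul_sub, abs_mul, abs_of_pos ht0] at h5
      have h7 : |(i : ℝ) * L - j * L| = |(i : ℝ) - j| * L := by
        rw [← sub_mul, abs_mul, abs_of_pos hL0]
      rw [h7] at h4
      have h8 : mu * L * |(i : ℝ) - j| ≤ D * (lam * L) := by
        calc mu * L * |(i : ℝ) - j| = t * (N ^ (k - 2) * (|(i : ℝ) - j| * L)) := by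
              rw [hmu]; ring
          _ ≤ t * (K₂ * |k * ((i : ℝ) * L) ^ (k - 1) - k * ((j : ℝ) * L) ^ (k - 1)|) := by gcongr
          _ = K₂ * (t * |k * ((i : ℝ) * L) ^ (k - 1) - k * ((j : ℝ) * L) ^ (k - 1)|) := by ring
          _ ≤ K₂ * ((C₄ + 4 * C₁) * (lam * L)) := by gcongr
          _ = _ := by rw [hD]; ring
      have h9 : lam * L * |(i : ℝ) - j| ≤ mu * L * |(i : ℝ) - j| := by gcongr
      have h10 : 0 < lam * L := by positivity
      refine le_of_mul_le_mul_left (a := lam * L) ?_ h10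
      linarith
  have hJcard : (J.card : ℝ) ≤ (κ + 1) * (N / L) := card_image_ediv_le hκ hL (by linarith)
  -- From `M C₁ = t₀ N^(k-1)` one gets `M^β C₁^β = t₀^β N`, so `L₁ ≤ ρN` with `ρP ≤ 1` bounds `a
  -- t₀^β` by `M^β/L₁`.
  have hcount : (closePairs (blockPairs S L₁) (powDiff k') (a * t₀ ^ β)).card ≤
      quadCount k' M (2 * C₁ ^ 2) L₁ := by
    refine closePairs_card_mono (Finset.Subset.refl _) ?_
    rw [hk'1, le_div_iff₀ (by exact_mod_cast hL₁0)]
    have h1 : M ^ β * C₁ ^ β = t₀ ^ β * N := by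
      rw [← Real.mul_rpow hM0.le hC₁0.le, hMC, ← hlamN, Real.mul_rpow ht₀.le hNk.le,
        ← Real.rpow_mul hN.le, hβ, mul_one_div_cancel hk1.ne', Real.rpow_one]
    have h2 : 0 < C₁ ^ β := Real.rpow_pos_of_pos hC₁0 _
    have h3 : 0 < t₀ ^ β := Real.rpow_pos_of_pos ht₀ _
    refine le_of_mul_le_mul_right ?_ h2
    rw [h1]
    calc a * t₀ ^ β * L₁ * C₁ ^ β = t₀ ^ β * (P * L₁) := by rw [hP]; ring
      _ ≤ t₀ ^ β * (P * (ρ * N)) := by gcongr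
      _ = t₀ ^ β * ((ρ * P) * N) := by ring
      _ ≤ t₀ ^ β * (1 * N) := by gcongr
      _ = _ := by ring
  have hd := continuousOn_dualParam (k := k) ht₀
  have hYi : IntervalIntegrable (fun t => Y t ^ 2) volume t₀ (2 * t₀) :=
    (((continuous_twistedBlockSum S L₁ k').pow 2).comp_continuousOn hd).intervalIntegrable
  have hGc : Continuous fun t => (∑ j ∈ J, ‖smoothBlock w k L (j * L) t‖ ^ 2) ^ 2 :=
    (continuous_finsetSum _ fun j _ => ((continuous_smoothBlock w k L _).norm.pow 2)).pow 2
  have hYint := hdual S L₁ K k' t₀ ht₀ hKsum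
  set R : ℝ := ((quadCount k' M (2 * C₁ ^ 2) L₁ : ℕ) : ℝ) with hR
  have hYint' : ∫ t in t₀..(2 * t₀), Y t ^ 2 ≤ C₀ * t₀ * K ^ 2 * R := by
    refine hYint.trans ?_
    have : (((closePairs (blockPairs S L₁) (powDiff k') (a * t₀ ^ β)).card : ℕ) : ℝ) ≤ R :=
      Nat.cast_le.mpr hcount
    gcongr
  set G₀ : ℝ := 2 * C₁ ^ 2 * J.card with hG₀
  set G₁ : ℝ := 32 * V ^ 2 * K * (D + 1) with hG₁
  have hG₁0 : 0 ≤ G₁ := by positivity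
  have hR0 : 0 ≤ R := by positivity
  calc ∫ t in t₀..(2 * t₀), (∑ j ∈ J, ‖smoothBlock w k L (j * L) t‖ ^ 2) ^ 2
      ≤ ∫ t in t₀..(2 * t₀), (2 * G₀ ^ 2 + 2 * G₁ ^ 2 * Y t ^ 2) := by
        refine intervalIntegral.integral_mono_on (by linarith) (hGc.intervalIntegrable _ _)
          (intervalIntegrable_const.add (hYi.const_mul _)) fun t ht => ?_
        have h1 := hpt t ht
        have h2 : (∑ j ∈ J, ‖smoothBlock w k L (j * L) t‖ ^ 2) ^ 2 ≤ (G₀ + G₁ * Y t) ^ 2 := by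
          gcongr
        have h3 := add_sq_le (a := G₀) (b := G₁ * Y t)
        rw [mul_pow] at h3
        linarith
    _ = 2 * G₀ ^ 2 * t₀ + 2 * G₁ ^ 2 * ∫ t in t₀..(2 * t₀), Y t ^ 2 := by
        rw [intervalIntegral.integral_add intervalIntegrable_const (hYi.const_mul _),
          intervalIntegral.integral_const, intervalIntegral.integral_const_mul, smul_eq_mul]
        ring
    _ ≤ 2 * (2 * C₁ ^ 2 * ((κ + 1) * (N / L))) ^ 2 * t₀ + 2 * G₁ ^ 2 * (C₀ * t₀ * K ^ 2 * R) := by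
        rw [hG₀]; gcongr
    -- Both `V⁴ = C₁⁴/lam²` and `(N/M)² = C₁²/lam²` are of order `lam^(-2)`. Two powers of `K` come
    -- from `G₁²` and two from the mean value of `Y²`, hence the fourth power of the logarithm.
    _ = t₀ * (E₁ * (N / L) ^ 2 + E₂ * ((1 + Real.log N) ^ 4 * (N / M) ^ 2 * R)) := by
        have hlam' : N / M = C₁ / lam := by rw [hM]; field_simp
        rw [hG₁, hV2, hlam', hE₁, hE₂, hK]
        field_simp
        ring
    _ ≤ t₀ * (C * (N / L) ^ 2 + C * ((1 + Real.log N) ^ 4 * (N / M) ^ 2 * R)) := by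
        gcongr <;> linarith
    _ = _ := by ring

/-! ### Counting quadruples through block energies -/

/-- The total energy at `t` of the smooth blocks of length `L` meeting `[N, κN]`. -/
noncomputable def blockEnergy (w : ℝ → ℝ) (k N κ : ℝ) (L : ℕ) (t : ℝ) : ℝ :=
  ∑ j ∈ (intRange N κ).image (· / (L : ℤ)), ‖smoothBlock w k L (j * L) t‖ ^ 2

theorem continuous_blockEnergy (w : ℝ → ℝ) (k N κ : ℝ) (L : ℕ) :
    Continuous (blockEnergy w k N κ L) :=
  continuous_finsetSum _ fun _ _ => (continuous_smoothBlock w k L _).norm.pow 2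

theorem blockEnergy_nonneg (w : ℝ → ℝ) (k N κ : ℝ) (L : ℕ) (t : ℝ) :
    0 ≤ blockEnergy w k N κ L t := Finset.sum_nonneg fun _ _ => sq_nonneg _

theorem smoothBlock_neg (w : ℝ → ℝ) (k L c t : ℝ) :
    smoothBlock w k L c (-t) = starRingEnd ℂ (smoothBlock w k L c t) := by
  simp only [smoothBlock, map_sum, map_mul, Complex.conj_ofReal, mul_neg, expTwoPiI_neg]

theorem blockEnergy_neg (w : ℝ → ℝ) (k N κ : ℝ) (L : ℕ) (t : ℝ) :
    blockEnergy w k N κ L (-t) = blockEnergy w k N κ L t := by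
  simp only [blockEnergy, smoothBlock_neg, RCLike.norm_conj]

theorem norm_smoothBlock_le {w w₁ w₂ : ℝ → ℝ} {W k L c t : ℝ} (hw : IsCutoff w w₁ w₂ W)
    (hL : 1 ≤ L) : ‖smoothBlock w k L c t‖ ≤ 5 * W * L := by
  have hW := hw.one_le
  have hcard : ((Finset.Icc ⌈c - 2 * L⌉ ⌊c + 2 * L⌋).card : ℝ) ≤ 4 * L + 1 := by
    refine card_le_of_abs_sub_le (by linarith) fun i hi j hj => ?_
    rw [Finset.mem_Icc, Int.ceil_le, Int.le_floor] at hi hj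
    rw [abs_le]
    constructor <;> linarith [hi.1, hi.2, hj.1, hj.2]
  calc ‖smoothBlock w k L c t‖ ≤ ∑ n ∈ Finset.Icc ⌈c - 2 * L⌉ ⌊c + 2 * L⌋, W := by
        refine norm_sum_le_of_le _ fun n _ => ?_
        rw [norm_mul, norm_expTwoPiI, mul_one, Complex.norm_real]
        exact hw.bound _
    _ = ((Finset.Icc ⌈c - 2 * L⌉ ⌊c + 2 * L⌋).card : ℝ) * W := by
        rw [Finset.sum_const, nsmul_eq_mul]
    _ ≤ (4 * L + 1) * W := by gcongr
    _ ≤ 5 * L * W := by gcongr; linarith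
    _ = _ := by ring

theorem blockEnergy_le {w : ℝ → ℝ} {k N κ D t : ℝ} {L : ℕ} (hκ : 1 ≤ κ) (hL : 1 ≤ L)
    (hLN : (L : ℝ) ≤ N)
    (h : ∀ j ∈ (intRange N κ).image (· / (L : ℤ)), ‖smoothBlock w k L (j * L) t‖ ≤ D) :
    blockEnergy w k N κ L t ≤ (κ + 1) * (N / L) * D ^ 2 := by
  calc blockEnergy w k N κ L t ≤ ∑ j ∈ (intRange N κ).image (· / (L : ℤ)), D ^ 2 :=
        Finset.sum_le_sum fun j hj => by gcongr; exact h j hj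
    _ ≤ _ := by
        rw [Finset.sum_const, nsmul_eq_mul]
        gcongr
        exact card_image_ediv_le hκ hL hLN

theorem smoothBlock_eq_sum {w w₁ w₂ : ℝ → ℝ} {W k L c t : ℝ} (hw : IsCutoff w w₁ w₂ W)
    (hL : 0 < L) {U : Finset ℤ} (hU : Finset.Icc ⌈c - 2 * L⌉ ⌊c + 2 * L⌋ ⊆ U) :
    smoothBlock w k L c t =
      ∑ n ∈ U, (w (((n : ℝ) - c) / L) : ℂ) * expTwoPiI ((n : ℝ) ^ k * t) := by
  rw [smoothBlock]
  refine Finset.sum_subset hU fun n _ hn => ?_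
  rw [cutoff_eq_zero_of_notMem hw hL, Complex.ofReal_zero, zero_mul]
  intro h
  rw [Finset.mem_Icc, Int.ceil_le, Int.le_floor] at hn
  exact hn ⟨h.1.le, h.2.le⟩

/-- The block energy is an exponential sum over pairs with frequencies `powDiff` and nonnegative
coefficients, which are at least `1` on pairs from a common block because the cut-off of that block
equals `1` on it. The Fejér lower bound then counts close pairs, and evenness in `t` halves the
range. -/
theorem card_closePairs_le_integral_blockEnergy {w w₁ w₂ : ℝ → ℝ} {W k N κ T : ℝ}
    (hw : IsCutoff w w₁ w₂ W) {L : ℕ} (hL : 1 ≤ L) (hT : 0 < T) :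
    ((closePairs (blockPairs (intRange N κ) L) (powDiff k) (1 / (8 * T))).card : ℝ) ≤
      4 / T * ∫ t in (0 : ℝ)..T, blockEnergy w k N κ L t ^ 2 := by
  have hL0 : (0 : ℝ) < L := by exact_mod_cast hL
  have hLz : (0 : ℤ) < L := by exact_mod_cast hL
  set J := (intRange N κ).image (· / (L : ℤ)) with hJ
  set U : Finset ℤ :=
    J.biUnion fun j => Finset.Icc ⌈(j : ℝ) * L - 2 * L⌉ ⌊(j : ℝ) * L + 2 * L⌋ with hU
  set v : ℤ → ℤ → ℝ := fun j n => w (((n : ℝ) - j * L) / L) with hv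
  have hv0 : ∀ j n, 0 ≤ v j n := fun j n => hw.nonneg _
  set a : ℤ × ℤ → ℝ := fun p => ∑ j ∈ J, v j p.1 * v j p.2 with ha
  have ha0 : ∀ p, 0 ≤ a p := fun p => Finset.sum_nonneg fun j _ => mul_nonneg (hv0 _ _) (hv0 _ _)
  have henergy : ∀ t, ‖∑ p ∈ U ×ˢ U, (a p : ℂ) * expTwoPiI (powDiff k p * t)‖ =
      blockEnergy w k N κ L t := by
    intro t
    have h1 : ((blockEnergy w k N κ L t : ℝ) : ℂ) =
        ∑ p ∈ U ×ˢ U, (a p : ℂ) * expTwoPiI (powDiff k p * t) := by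
      have h2 : ∀ j ∈ J, ((‖smoothBlock w k L (j * L) t‖ ^ 2 : ℝ) : ℂ) =
          ∑ p ∈ U ×ˢ U, ((v j p.1 * v j p.2 : ℝ) : ℂ) * expTwoPiI (powDiff k p * t) := by
        intro j hj
        have hsub : Finset.Icc ⌈(j : ℝ) * L - 2 * L⌉ ⌊(j : ℝ) * L + 2 * L⌋ ⊆ U :=
          Finset.subset_biUnion_of_mem
            (fun j : ℤ => Finset.Icc ⌈(j : ℝ) * L - 2 * L⌉ ⌊(j : ℝ) * L + 2 * L⌋) hj
        rw [Complex.ofReal_pow, ← Complex.mul_conj', smoothBlock_eq_sum hw hL0 hsub, map_sum,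
          Finset.sum_mul_sum, ← Finset.sum_product']
        refine Finset.sum_congr rfl fun p _ => ?_
        simp only [hv, powDiff, sub_mul, expTwoPiI_sub, map_mul, Complex.conj_ofReal,
          Complex.ofReal_mul]
        ring
      rw [blockEnergy, Complex.ofReal_sum, Finset.sum_congr rfl h2, Finset.sum_comm]
      refine Finset.sum_congr rfl fun p _ => ?_
      rw [← Finset.sum_mul, ha, Complex.ofReal_sum]
    rw [← h1, Complex.norm_real, Real.norm_of_nonneg (blockEnergy_nonneg _ _ _ _ _ _)]
  have hlow := sum_closePairs_le_integral (U ×ˢ U) a (powDiff k) (fun q _ => ha0 q) hT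
  simp only [henergy] at hlow
  have hinR : ∀ n ∈ intRange N κ, n ∈ U ∧ v (n / (L : ℤ)) n = 1 := by
    intro n hn
    have h1 : n / (L : ℤ) * L ≤ n := Int.ediv_mul_le n hLz.ne'
    have h2 : n < (n / (L : ℤ) + 1) * L := Int.lt_ediv_add_one_mul_self n hLz
    have h1' : ((n / (L : ℤ) : ℤ) : ℝ) * L ≤ n := by exact_mod_cast h1
    have h2' : (n : ℝ) < (((n / (L : ℤ) : ℤ) : ℝ) + 1) * L := by exact_mod_cast h2
    constructor
    · rw [hU, Finset.mem_biUnion]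
      refine ⟨n / (L : ℤ), Finset.mem_image_of_mem _ hn, ?_⟩
      rw [Finset.mem_Icc, Int.ceil_le, Int.le_floor]
      constructor <;> linarith
    · refine hw.eq_one _ ?_
      rw [abs_div, abs_of_pos hL0, div_le_one hL0, abs_le]
      constructor <;> linarith
  have hpair : ∀ p ∈ blockPairs (intRange N κ) L, p ∈ U ×ˢ U ∧ 1 ≤ a p := by
    intro p hp
    rw [blockPairs, Finset.mem_filter, Finset.mem_product] at hp
    have h1 := hinR p.1 hp.1.1
    have h2 := hinR p.2 hp.1.2
    refine ⟨Finset.mem_product.mpr ⟨h1.1, h2.1⟩, ?_⟩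
    have h3 : v (p.1 / (L : ℤ)) p.1 * v (p.1 / (L : ℤ)) p.2 = 1 := by
      rw [h1.2, hp.2, h2.2, one_mul]
    rw [← h3]
    exact Finset.single_le_sum (f := fun j => v j p.1 * v j p.2)
      (fun j _ => mul_nonneg (hv0 _ _) (hv0 _ _)) (Finset.mem_image_of_mem _ hp.1.1)
  have hcard : ((closePairs (blockPairs (intRange N κ) L) (powDiff k) (1 / (8 * T))).card : ℝ) ≤
      ∑ p ∈ closePairs (U ×ˢ U) (powDiff k) (1 / (8 * T)), a p.1 * a p.2 := by
    have hsub : closePairs (blockPairs (intRange N κ) L) (powDiff k) (1 / (8 * T)) ⊆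
        closePairs (U ×ˢ U) (powDiff k) (1 / (8 * T)) := by
      intro p hp
      rw [mem_closePairs] at hp ⊢
      exact ⟨⟨(hpair _ hp.1.1).1, (hpair _ hp.1.2).1⟩, hp.2⟩
    refine le_trans ?_ (Finset.sum_le_sum_of_subset_of_nonneg hsub
      fun p _ _ => mul_nonneg (ha0 _) (ha0 _))
    rw [← nsmul_one, ← Finset.sum_const]
    refine Finset.sum_le_sum fun p hp => ?_
    rw [mem_closePairs] at hp
    exact one_le_mul_of_one_le_of_one_le (hpair _ hp.1.1).2 (hpair _ hp.1.2).2
  refine hcard.trans (hlow.trans (le_of_eq ?_))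
  have hc : Continuous fun t => blockEnergy w k N κ L t ^ 2 :=
    (continuous_blockEnergy w k N κ L).pow 2
  have heven : ∫ t in (-T)..0, blockEnergy w k N κ L t ^ 2 =
      ∫ t in (0 : ℝ)..T, blockEnergy w k N κ L t ^ 2 := by
    have := intervalIntegral.integral_comp_neg (a := 0) (b := T)
      (fun t => blockEnergy w k N κ L t ^ 2)
    simp only [blockEnergy_neg, neg_zero] at this
    exact this.symm
  rw [← intervalIntegral.integral_add_adjacent_intervals (hc.intervalIntegrable (-T) 0)
    (hc.intervalIntegrable 0 T), heven]
  ring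

/-- The constant bound is used up to `a` and the inverse square bound beyond it. -/
theorem integral_le_of_le_div_sq {f : ℝ → ℝ} (hf : Continuous f) {P Q a b x : ℝ} (ha : 0 < a)
    (hP0 : 0 ≤ P) (hQ0 : 0 ≤ Q) (hP : ∀ t, f t ≤ P) (hQ : ∀ t, 0 < t → t ≤ b → f t ≤ Q / t ^ 2)
    (hx : 0 ≤ x) (hxb : x ≤ b) : ∫ t in (0 : ℝ)..x, f t ≤ P * a + Q / a := by
  have h1 : ∀ y, 0 ≤ y → ∫ t in (0 : ℝ)..y, f t ≤ P * y := by
    intro y hy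
    have := intervalIntegral.integral_mono_on hy (hf.intervalIntegrable 0 y)
      (intervalIntegrable_const (μ := volume) (c := P)) fun t _ => hP t
    rw [intervalIntegral.integral_const, smul_eq_mul] at this
    linarith
  have hQa : 0 ≤ Q / a := by positivity
  rcases le_total x a with h | h
  · have := h1 x hx
    have : P * x ≤ P * a := by gcongr
    linarith
  · rw [← intervalIntegral.integral_add_adjacent_intervals (hf.intervalIntegrable 0 a)
      (hf.intervalIntegrable a x)]
    refine add_le_add (h1 a ha.le) ?_
    have hc : ContinuousOn (fun t : ℝ => Q * t ^ (-2 : ℤ)) (Set.uIcc a x) := by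
      refine continuousOn_const.mul (continuousOn_id.zpow₀ _ fun t ht => Or.inl ?_)
      rw [Set.uIcc_of_le h] at ht
      exact (show t ≠ 0 by linarith [ht.1])
    have h2 := intervalIntegral.integral_mono_on h (hf.intervalIntegrable a x)
      (hc.intervalIntegrable (μ := volume)) fun t ht => by
        have h3 := hQ t (by linarith [ht.1]) (ht.2.trans hxb)
        rw [div_eq_mul_inv] at h3
        convert h3 using 2
        rw [zpow_neg]; norm_cast
    rw [intervalIntegral.integral_const_mul, integral_zpow (Or.inr ⟨by norm_num, by
      rw [Set.uIcc_of_le h]; intro h0; linarith [h0.1]⟩)] at h2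
    refine h2.trans ?_
    have hx0 : 0 < x := by linarith
    have h4 : ((x ^ (-2 + 1 : ℤ) - a ^ (-2 + 1 : ℤ)) / ((-2 : ℤ) + 1 : ℝ)) = 1 / a - 1 / x := by
      norm_num
      ring
    rw [h4, div_eq_mul_one_div Q a]
    have : 0 < 1 / x := by positivity
    exact mul_le_mul_of_nonneg_left (by linarith) hQ0

/-- Halving the upper limit until it falls below `b` uses `hstep` at lengths `t₀` whose sum is at
most `T`, so no logarithm is lost. -/
theorem integral_le_of_dyadic {f : ℝ → ℝ} (hf : Continuous f) {b T E R : ℝ} (hb : 0 < b)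
    (hE : ∀ x, 0 ≤ x → x ≤ b → x ≤ T → ∫ t in (0 : ℝ)..x, f t ≤ E) (hR : 0 ≤ R)
    (hstep : ∀ t₀, b / 2 ≤ t₀ → t₀ ≤ T → ∫ t in t₀..(2 * t₀), f t ≤ t₀ * R) (hT : 0 ≤ T) :
    ∫ t in (0 : ℝ)..T, f t ≤ E + T * R := by
  have key : ∀ (n : ℕ) (x : ℝ), 0 ≤ x → x ≤ b * 2 ^ n → x ≤ T →
      ∫ t in (0 : ℝ)..x, f t ≤ E + x * R := by
    intro n
    induction n with
    | zero =>
      intro x hx hxb hxT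
      have := hE x hx (by simpa using hxb) hxT
      have : 0 ≤ x * R := by positivity
      linarith
    | succ n ih =>
      intro x hx hxb hxT
      rcases le_total x b with h | h
      · have := hE x hx h hxT
        have : 0 ≤ x * R := by positivity
        linarith
      · rw [← intervalIntegral.integral_add_adjacent_intervals (hf.intervalIntegrable 0 (x / 2))
          (hf.intervalIntegrable (x / 2) x)]
        have h1 := ih (x / 2) (by linarith) (by rw [pow_succ] at hxb; linarith) (by linarith)
        have h2 := hstep (x / 2) (by linarith) (by linarith)
        rw [show 2 * (x / 2) = x by ring] at h2
        linarith
  obtain ⟨n, hn⟩ := pow_unbounded_of_one_lt (T / b) (by norm_num : (1 : ℝ) < 2)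
  refine key n T hT ?_ le_rfl
  rw [div_lt_iff₀ hb] at hn
  linarith

/-! ### The induction for the number of quadruples -/

/-- One step of the recursion: the range `t ≤ 1/(N^(k-2) L)` gives `(N/L)³ N²` directly, and every
dyadic interval beyond it is governed by a dual count. Only the properties of `M` and `L₁` that hold
for all these intervals enter the hypothesis on `R`. -/
theorem exists_quadCount_le_of_dual {w w₁ w₂ : ℝ → ℝ} {W k κ : ℝ} (hw : IsCutoff w w₁ w₂ W)
    (hk : 1 < k) (hκ : 1 ≤ κ) :
    ∃ C ρ κ' : ℝ, 1 ≤ C ∧ 0 < ρ ∧ ρ ≤ 1 ∧ 1 ≤ κ' ∧ ∀ (N R : ℝ) (L : ℕ), 0 < N → 1 ≤ L →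
      (L : ℝ) ≤ ρ * N → 0 ≤ R →
      (∀ (M : ℝ) (L₁ : ℕ), 1 ≤ L₁ → (L₁ : ℝ) ≤ M → M ≤ C * L → L₁ * N ≤ C * L * M →
        M * L ≤ C * N * L₁ →
        (1 + Real.log N) ^ 4 * (N / M) ^ 2 * quadCount (k / (k - 1)) M κ' L₁ ≤ R) →
      (quadCount k N κ L : ℝ) ≤ C * ((N / L) ^ 3 * N ^ 2 + R) := by
  obtain ⟨C₁, ρ₁, hC₁, hρ₁, hblock⟩ := exists_smoothBlock_bounds hw hk hκ
  obtain ⟨C₂, ρ₂, κ', hC₂, hρ₂, hρ₂', hκ', hdyad⟩ := exists_integral_smoothBlock_le hw hk hκ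
  have hW := hw.one_le
  set E₁ : ℝ := 32 * ((κ + 1) * (5 * W) ^ 2) ^ 2 with hE₁
  set E₂ : ℝ := 32 * ((κ + 1) * C₁ ^ 2) ^ 2 with hE₂
  have hE₁0 : 0 ≤ E₁ := by positivity
  have hE₂0 : 0 ≤ E₂ := by positivity
  set C : ℝ := E₁ + E₂ + 4 * C₂ with hC
  have hCC₂ : C₂ ≤ C := by linarith
  have hρmin : 0 < min ρ₁ ρ₂ := lt_min hρ₁ hρ₂
  refine ⟨C, min ρ₁ ρ₂, κ', by linarith, hρmin, by linarith [min_le_right ρ₁ ρ₂], hκ', ?_⟩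
  intro N R L hN hL hLρ hR hdual
  have hL1 : (1 : ℝ) ≤ L := by exact_mod_cast hL
  have hL0 : (0 : ℝ) < L := by linarith
  have hLρ₁ : (L : ℝ) ≤ ρ₁ * N := hLρ.trans (by gcongr; exact min_le_left _ _)
  have hLρ₂ : (L : ℝ) ≤ ρ₂ * N := hLρ.trans (by gcongr; exact min_le_right _ _)
  have hLN : (L : ℝ) ≤ N := by
    have : ρ₂ * N ≤ 1 * N := by gcongr; linarith
    linarith
  have hN1 : 1 ≤ N := by linarith
  set x : ℝ := N ^ (k - 2) with hx
  have hx0 : 0 < x := Real.rpow_pos_of_pos hN _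
  have hNk1 : N ^ (k - 1) = x * N := by
    rw [show k - 1 = (k - 2) + 1 by ring, Real.rpow_add hN, Real.rpow_one]
  -- Chosen so that `1/(8T)` is the tolerance in `quadCount`; it is also the upper limit for `t₀` in
  -- the dual estimate.
  set T : ℝ := L / (8 * N ^ (k - 1)) with hT
  have hT' : T = L / (8 * (x * N)) := by rw [hT, hNk1]
  have hT0 : 0 < T := by rw [hT']; positivity
  have hcount := card_closePairs_le_integral_blockEnergy (k := k) (N := N) (κ := κ) hw hL hT0
  have hthr : 1 / (8 * T) = N ^ (k - 1) / L := by rw [hT', hNk1]; field_simp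
  rw [hthr] at hcount
  set f : ℝ → ℝ := fun t => blockEnergy w k N κ L t ^ 2 with hf
  have hfc : Continuous f := (continuous_blockEnergy w k N κ L).pow 2
  set P : ℝ := ((κ + 1) * (N / L) * (5 * W * L) ^ 2) ^ 2 with hP
  set Q : ℝ := ((κ + 1) * (N / L) * (C₁ ^ 2 / x)) ^ 2 with hQ
  have hfP : ∀ t, f t ≤ P := fun t => by
    have := blockEnergy_le (t := t) (k := k) hκ hL hLN fun j _ => norm_smoothBlock_le hw hL1
    have h0 := blockEnergy_nonneg w k N κ L t
    simp only [hf, hP]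
    gcongr
  have hfQ : ∀ t, 0 < t → t ≤ 1 / (x * L) → f t ≤ Q / t ^ 2 := fun t ht htb => by
    have h1 : t * x * L ≤ 1 := by
      rw [le_div_iff₀ (by positivity)] at htb
      linarith
    have h2 : t * x ≤ 1 := le_trans (le_mul_of_one_le_right (by positivity) hL1) h1
    have h3 := blockEnergy_le (t := t) (k := k) (w := w) hκ hL hLN fun j hj =>
      (hblock N L (j * L) t hN hL1 hLρ₁ (mul_ediv_mem_Icc hL hj) ht).1 h2 h1
    have h0 := blockEnergy_nonneg w k N κ L t
    have h4 : Q / t ^ 2 = ((κ + 1) * (N / L) * (C₁ / √(t * x)) ^ 2) ^ 2 := by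
      rw [div_pow C₁, Real.sq_sqrt (by positivity), hQ]
      field_simp
    rw [h4]
    simp only [hf]
    gcongr
  set R' : ℝ := C₂ * ((N / L) ^ 2 + R) with hR'
  have hR'0 : 0 ≤ R' := by positivity
  -- Splitting at `1/(x N²)` makes the two parts, after multiplication by `4/T`, of order `N L` and
  -- `(N/L)³ N²`.
  have hlow : ∀ y, 0 ≤ y → y ≤ 1 / (x * L) → y ≤ T → ∫ t in (0 : ℝ)..y, f t ≤
      P * (1 / (x * N ^ 2)) + Q / (1 / (x * N ^ 2)) := fun y hy hyb _ =>
    integral_le_of_le_div_sq hfc (by positivity) (sq_nonneg _) (sq_nonneg _) hfP hfQ hy hyb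
  have hint : ∫ t in (0 : ℝ)..T, f t ≤ P * (1 / (x * N ^ 2)) + Q / (1 / (x * N ^ 2)) + T * R' := by
    -- The dyadic steps start at `t₀ ≥ 1/(2xL)`, exactly where the dual description becomes
    -- available.
    refine integral_le_of_dyadic hfc (b := 1 / (x * L)) (by positivity) hlow hR'0 ?_ hT0.le
    intro t₀ hb ht₀T
    have ht₀ : 0 < t₀ := lt_of_lt_of_le (by positivity) hb
    have hb' : 1 / 2 ≤ t₀ * x * L := by
      rw [div_div, div_le_iff₀ (by positivity)] at hb
      linarith
    obtain ⟨M, L₁, hL₁, hL₁M, hM1, hM2, hM3, hMint⟩ := hdyad N t₀ L hN hL hLρ₂ ht₀ hb' ht₀T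
    have hM0 : 0 < M := lt_of_lt_of_le (by exact_mod_cast hL₁) hL₁M
    have h1 := hdual M L₁ hL₁ hL₁M (hM1.trans (by gcongr)) (hM2.trans (by gcongr))
      (hM3.trans (by gcongr))
    refine le_trans hMint ?_
    rw [hR', show C₂ * t₀ * ((N / L) ^ 2 + (1 + Real.log N) ^ 4 * (N / M) ^ 2 *
      quadCount (k / (k - 1)) M κ' L₁) = t₀ * (C₂ * ((N / L) ^ 2 + (1 + Real.log N) ^ 4 *
        (N / M) ^ 2 * quadCount (k / (k - 1)) M κ' L₁)) by ring]
    gcongr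
  have hNL : 1 ≤ N / L := by rw [le_div_iff₀ hL0]; linarith
  have hcub : (1 : ℝ) ≤ (N / L) ^ 3 := one_le_pow₀ hNL
  have hN2 : 1 ≤ N ^ 2 := one_le_pow₀ hN1
  have hNN : (N / L) ^ 2 ≤ (N / L) ^ 3 * N ^ 2 := by
    calc (N / L) ^ 2 ≤ (N / L) ^ 3 := pow_le_pow_right₀ hNL (by norm_num)
      _ ≤ (N / L) ^ 3 * N ^ 2 := le_mul_of_one_le_right (by positivity) hN2
  have hNL2 : N * L ≤ (N / L) ^ 3 * N ^ 2 := by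
    calc N * L ≤ N * N := by gcongr
      _ = 1 * N ^ 2 := by ring
      _ ≤ _ := by gcongr
  calc (quadCount k N κ L : ℝ) ≤ 4 / T * ∫ t in (0 : ℝ)..T, f t := hcount
    _ ≤ 4 / T * (P * (1 / (x * N ^ 2)) + Q / (1 / (x * N ^ 2)) + T * R') := by gcongr
    _ = E₁ * (N * L) + E₂ * ((N / L) ^ 3 * N ^ 2) + 4 * R' := by
        rw [hE₁, hE₂, hP, hQ, hT']
        field_simp
        ring
    _ ≤ E₁ * ((N / L) ^ 3 * N ^ 2) + E₂ * ((N / L) ^ 3 * N ^ 2) +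
        4 * (C₂ * ((N / L) ^ 3 * N ^ 2 + R)) := by
        rw [hR']; gcongr
    _ ≤ C * ((N / L) ^ 3 * N ^ 2 + R) := by
        have h1 : 0 ≤ (E₁ + E₂) * R := by positivity
        rw [hC]
        linarith

theorem exists_one_add_log_pow_le {ζ : ℝ} (hζ : 0 < ζ) :
    ∃ C : ℝ, 1 ≤ C ∧ ∀ N : ℝ, 1 ≤ N → (1 + Real.log N) ^ 4 ≤ C * N ^ ζ := by
  have h4 : 0 < ζ / 4 := by positivity
  refine ⟨(1 + 1 / (ζ / 4)) ^ 4, one_le_pow₀ (le_add_of_nonneg_right (by positivity)), ?_⟩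
  intro N hN
  have hN0 : 0 < N := by linarith
  have h1 := Real.log_le_rpow_div hN0.le h4
  have h2 : 1 ≤ N ^ (ζ / 4) := Real.one_le_rpow hN h4.le
  have h3 : 0 ≤ Real.log N := Real.log_nonneg hN
  have h5 : 1 + Real.log N ≤ (1 + 1 / (ζ / 4)) * N ^ (ζ / 4) := by
    rw [add_mul, one_mul, one_div_mul_eq_div]
    linarith
  calc (1 + Real.log N) ^ 4 ≤ ((1 + 1 / (ζ / 4)) * N ^ (ζ / 4)) ^ 4 := by gcongr
    _ = (1 + 1 / (ζ / 4)) ^ 4 * N ^ ζ := by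
        rw [mul_pow, ← Real.rpow_natCast (N ^ (ζ / 4)), ← Real.rpow_mul hN0.le]
        congr 2
        push_cast
        ring

theorem quadCount_le_pow {k N κ : ℝ} {L : ℕ} (hN : 1 ≤ N) (hκ : 1 ≤ κ) :
    (quadCount k N κ L : ℝ) ≤ (κ * N) ^ 4 := by
  have h1 : ((intRange N κ).card : ℝ) ≤ κ * N := by
    have h0 : N ≤ κ * N := le_mul_of_one_le_left (by linarith) hκ
    refine (card_le_of_abs_sub_le (D := κ * N - N) (by linarith) fun i hi j hj => ?_).trans
      (by linarith)
    rw [mem_intRange] at hi hj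
    rw [abs_le]
    constructor <;> linarith [hi.1, hi.2, hj.1, hj.2]
  have h2 : quadCount k N κ L ≤ (intRange N κ).card ^ 4 := by
    have h3 : (blockPairs (intRange N κ) L).card ≤ (intRange N κ).card ^ 2 := by
      rw [sq, ← Finset.card_product]
      exact Finset.card_filter_le _ _
    have h4 : quadCount k N κ L ≤ (blockPairs (intRange N κ) L).card ^ 2 := by
      rw [sq, ← Finset.card_product]
      exact Finset.card_le_card fun p hp =>
        Finset.mem_product.mpr (mem_closePairs.mp hp).1
    calc _ ≤ (blockPairs (intRange N κ) L).card ^ 2 := h4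
      _ ≤ ((intRange N κ).card ^ 2) ^ 2 := by gcongr
      _ = _ := by ring
  calc (quadCount k N κ L : ℝ) ≤ ((intRange N κ).card : ℝ) ^ 4 := by exact_mod_cast h2
    _ ≤ _ := by gcongr

/-- When `N` is bounded, the trivial count of order `N⁴` is already a constant times `N²`. -/
theorem quadCount_le_of_le {k N κ M₀ B : ℝ} {L : ℕ} (hL : 1 ≤ L) (hLN : (L : ℝ) ≤ N) (hκ : 1 ≤ κ)
    (hNM : N ≤ M₀) (hB : 0 ≤ B) :
    (quadCount k N κ L : ℝ) ≤ κ ^ 4 * M₀ ^ 2 * (N / L) ^ B * N ^ 2 := by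
  have hL1 : (1 : ℝ) ≤ L := by exact_mod_cast hL
  have hN : 1 ≤ N := hL1.trans hLN
  have h1 : 1 ≤ (N / L) ^ B :=
    Real.one_le_rpow (by rw [le_div_iff₀ (by linarith)]; linarith) hB
  calc (quadCount k N κ L : ℝ) ≤ (κ * N) ^ 4 := quadCount_le_pow hN hκ
    _ = κ ^ 4 * N ^ 2 * 1 * N ^ 2 := by ring
    _ ≤ _ := by gcongr

/-- Dualising replaces `N` by `M ≤ C L = C N (L/N)` and keeps the ratio up to constants, so `N
(L/N)^(j+1) ≤ M₀` becomes `M (L₁/M)^j ≤ C^(j+1) M₀`; at `j = 0` the length is bounded. The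
parameters `k, κ, M₀, B` all change at each step and are therefore quantified inside the induction.
The condition `3 < B` reflects the direct term `(N/L)³ N²`. -/
theorem exists_quadCount_le (j : ℕ) : ∀ k κ M₀ B : ℝ, 1 < k → 1 ≤ κ → 3 < B →
    ∃ C : ℝ, 0 ≤ C ∧ ∀ (N : ℝ) (L : ℕ), 1 ≤ L → (L : ℝ) ≤ N → N * (L / N) ^ j ≤ M₀ →
      (quadCount k N κ L : ℝ) ≤ C * (N / L) ^ B * N ^ 2 := by
  induction j with
  | zero =>
    intro k κ M₀ B hk hκ hB
    refine ⟨κ ^ 4 * M₀ ^ 2, by positivity, fun N L hL hLN h => ?_⟩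
    exact quadCount_le_of_le hL hLN hκ (by simpa using h) (by linarith)
  | succ j ih =>
    intro k κ M₀ B hk hκ hB
    obtain ⟨w, w₁, w₂, W, hw⟩ := exists_isCutoff
    obtain ⟨C, ρ, κ', hC, hρ, hρ1, hκ', hstep⟩ := exists_quadCount_le_of_dual hw hk hκ
    -- Half of the excess of `B` over `3` pays for the logarithms of this step; the other half is
    -- kept for the remaining ones.
    set ζ : ℝ := (B - 3) / 2 with hζ
    have hζ0 : 0 < ζ := by rw [hζ]; linarith
    set B' : ℝ := B - ζ with hB'
    have hB'3 : 3 < B' := by rw [hB', hζ]; linarith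
    have hj0 : (0 : ℝ) < (j : ℝ) + 1 := by positivity
    obtain ⟨C', hC'0, hC'⟩ := ih (k / (k - 1)) κ' (C ^ (j + 1) * M₀) B'
      (by rw [lt_div_iff₀ (by linarith)]; linarith) hκ' hB'3
    obtain ⟨Cl, hCl1, hCl⟩ := exists_one_add_log_pow_le (ζ := ζ / (j + 1)) (by positivity)
    set E : ℝ := Cl * |M₀| ^ (ζ / (j + 1)) * C' * C ^ B' with hE
    have hC0 : 0 < C := by linarith
    have hE0 : 0 ≤ E := by positivity
    refine ⟨κ ^ 4 * (|M₀| / ρ ^ (j + 1)) ^ 2 + C * (1 + E), by positivity, ?_⟩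
    intro N L hL hLN hNM
    have hL1 : (1 : ℝ) ≤ L := by exact_mod_cast hL
    have hL0 : (0 : ℝ) < L := by linarith
    have hN1 : 1 ≤ N := by linarith
    have hN0 : 0 < N := by linarith
    have hNL : 1 ≤ N / L := by rw [le_div_iff₀ hL0]; linarith
    have hNL0 : 0 < N / L := by linarith
    have hNM' : N * (L / N) ^ (j + 1) ≤ |M₀| := hNM.trans (le_abs_self _)
    have hNB : 0 < (N / L) ^ B := Real.rpow_pos_of_pos hNL0 _
    -- If `L > ρN`, the hypothesis on `N (L/N)^(j+1)` bounds `N` itself, and the trivial count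
    -- suffices.
    rcases lt_or_ge (ρ * N) L with hcase | hcase
    · have h1 : N ≤ |M₀| / ρ ^ (j + 1) := by
        rw [le_div_iff₀ (by positivity)]
        refine le_trans ?_ hNM'
        gcongr
        rw [le_div_iff₀ hN0]
        exact hcase.le
      refine (quadCount_le_of_le hL hLN hκ h1 (by linarith : 0 ≤ B)).trans ?_
      gcongr
      exact le_add_of_nonneg_right (by positivity)
    · have hdual : ∀ (M : ℝ) (L₁ : ℕ), 1 ≤ L₁ → (L₁ : ℝ) ≤ M → M ≤ C * L → L₁ * N ≤ C * L * M →
          M * L ≤ C * N * L₁ →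
          (1 + Real.log N) ^ 4 * (N / M) ^ 2 * quadCount (k / (k - 1)) M κ' L₁ ≤
            E * (N / L) ^ B * N ^ 2 := by
        intro M L₁ hL₁ hL₁M hM1 hM2 hM3
        have hL₁0 : (0 : ℝ) < L₁ := by exact_mod_cast hL₁
        have hM0 : 0 < M := by linarith
        have h1 : (L₁ : ℝ) / M ≤ C * (L / N) := by
          rw [← mul_div_assoc, div_le_div_iff₀ hM0 hN0]
          exact hM2
        have h2 : M / L₁ ≤ C * (N / L) := by
          rw [← mul_div_assoc, div_le_div_iff₀ hL₁0 hL0]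
          exact hM3
        have h3 : M * (L₁ / M) ^ j ≤ C ^ (j + 1) * M₀ := by
          calc M * (L₁ / M) ^ j ≤ C * L * (C * (L / N)) ^ j := by gcongr
            _ = C ^ (j + 1) * (N * (L / N) ^ (j + 1)) := by
                rw [mul_pow, pow_succ, pow_succ]; field_simp
            _ ≤ _ := by gcongr
        have h4 := hC' M L₁ hL₁ hL₁M h3
        -- The hypothesis gives `N ≤ |M₀| (N/L)^(j+1)`, so a logarithm of `N` costs only a small
        -- power of `N/L`.
        have h5 : (1 + Real.log N) ^ 4 ≤ Cl * (|M₀| ^ (ζ / (j + 1)) * (N / L) ^ ζ) := by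
          refine (hCl N hN1).trans ?_
          have h6 : N ≤ |M₀| * (N / L) ^ (j + 1) := by
            calc N = N * (L / N) ^ (j + 1) * (N / L) ^ (j + 1) := by
                  rw [mul_assoc, ← mul_pow, div_mul_div_comm, mul_comm (L : ℝ) N,
                    div_self (by positivity), one_pow, mul_one]
              _ ≤ _ := by gcongr
          have h7 : N ^ (ζ / (j + 1)) ≤ (|M₀| * (N / L) ^ (j + 1)) ^ (ζ / (j + 1)) := by gcongr
          rw [Real.mul_rpow (abs_nonneg _) (by positivity), ← Real.rpow_natCast (N / L),
            ← Real.rpow_mul hNL0.le] at h7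
          rw [show ((j + 1 : ℕ) : ℝ) * (ζ / (j + 1)) = ζ by push_cast; field_simp] at h7
          gcongr
        have h8 : (M / L₁) ^ B' ≤ C ^ B' * (N / L) ^ B' := by
          rw [← Real.mul_rpow hC0.le hNL0.le]
          gcongr
        have hlog0 : 0 ≤ Real.log N := Real.log_nonneg hN1
        -- The prefactor `(N/M)²` converts the dual `M²` into `N²`, which is why the shape of the
        -- bound is reproduced exactly.
        calc (1 + Real.log N) ^ 4 * (N / M) ^ 2 * quadCount (k / (k - 1)) M κ' L₁
            ≤ Cl * (|M₀| ^ (ζ / (j + 1)) * (N / L) ^ ζ) * (N / M) ^ 2 *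
              (C' * (C ^ B' * (N / L) ^ B') * M ^ 2) := by
              gcongr
              exact h4.trans (by gcongr)
          _ = E * ((N / L) ^ ζ * (N / L) ^ B') * N ^ 2 := by
              rw [hE]; field_simp
          _ = _ := by rw [← Real.rpow_add hNL0, hB']; congr 3; ring
      have h9 := hstep N (E * (N / L) ^ B * N ^ 2) L hN0 hL hcase (by positivity) hdual
      have h10 : (N / L) ^ 3 ≤ (N / L) ^ B := by
        rw [← Real.rpow_natCast (N / L) 3]
        exact Real.rpow_le_rpow_of_exponent_le hNL (by push_cast; linarith)
      calc (quadCount k N κ L : ℝ) ≤ C * ((N / L) ^ 3 * N ^ 2 + E * (N / L) ^ B * N ^ 2) := h9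
        _ ≤ C * ((N / L) ^ B * N ^ 2 + E * (N / L) ^ B * N ^ 2) := by gcongr
        _ = (0 + C * (1 + E)) * (N / L) ^ B * N ^ 2 := by ring
        _ ≤ _ := by gcongr; positivity

/-! ### Fourth moments -/

/-- Cauchy–Schwarz over the blocks, once, followed by squaring: the sum of the squared block norms
is itself an exponential sum over pairs in common blocks. -/
theorem norm_sum_pow_four_le (S : Finset ℤ) (q : ℕ) (c : ℤ → ℂ) (k t : ℝ) :
    ‖∑ n ∈ S, c n * expTwoPiI ((n : ℝ) ^ k * t)‖ ^ 4 ≤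
      ((S.image (· / (q : ℤ))).card : ℝ) ^ 2 * ‖∑ p ∈ blockPairs S q,
        (c p.1 * starRingEnd ℂ (c p.2)) * expTwoPiI (powDiff k p * t)‖ ^ 2 := by
  set f : ℤ → ℂ := fun n => c n * expTwoPiI ((n : ℝ) ^ k * t) with hf
  set J := S.image (· / (q : ℤ)) with hJ
  set G : ℝ := ∑ i ∈ J, ‖∑ m ∈ S with m / (q : ℤ) = i, f m‖ ^ 2 with hG
  have hG0 : 0 ≤ G := Finset.sum_nonneg fun _ _ => sq_nonneg _
  have h1 : ‖∑ p ∈ blockPairs S q,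
      (c p.1 * starRingEnd ℂ (c p.2)) * expTwoPiI (powDiff k p * t)‖ = G := by
    have h2 : ∑ p ∈ blockPairs S q,
        (c p.1 * starRingEnd ℂ (c p.2)) * expTwoPiI (powDiff k p * t) = (G : ℂ) := by
      rw [hG, sum_normSq_blocks]
      refine Finset.sum_congr rfl fun p _ => ?_
      simp only [hf, powDiff, sub_mul, expTwoPiI_sub, map_mul]
      ring
    rw [h2, Complex.norm_real, Real.norm_of_nonneg hG0]
  rw [h1]
  have h3 : ∑ n ∈ S, f n = ∑ i ∈ J, ∑ m ∈ S with m / (q : ℤ) = i, f m :=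
    (Finset.sum_fiberwise_of_maps_to (fun m hm => Finset.mem_image_of_mem _ hm) _).symm
  have h4 : ‖∑ n ∈ S, f n‖ ^ 2 ≤ J.card * G := by
    rw [h3]
    calc _ ≤ (∑ i ∈ J, ‖∑ m ∈ S with m / (q : ℤ) = i, f m‖) ^ 2 := by
          gcongr
          exact norm_sum_le _ _
      _ ≤ _ := sq_sum_le_card_mul_sum_sq
  calc ‖∑ n ∈ S, f n‖ ^ 4 = (‖∑ n ∈ S, f n‖ ^ 2) ^ 2 := by ring
    _ ≤ (J.card * G) ^ 2 := by gcongr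
    _ = _ := by ring

theorem exists_integral_pow_four_le_quadCount :
    ∃ C : ℝ, 0 < C ∧ ∀ (k N κ A a U : ℝ) (L : ℕ) (c : ℤ → ℂ), 1 ≤ κ → 1 ≤ L → (L : ℝ) ≤ N →
      0 < U → (∀ n ∈ intRange N κ, ‖c n‖ ≤ A) →
      ∫ t in (a - U)..(a + U), ‖∑ n ∈ intRange N κ, c n * expTwoPiI ((n : ℝ) ^ k * t)‖ ^ 4 ≤
        C * ((κ + 1) * (N / L)) ^ 2 * A ^ 4 * (U + L / N ^ (k - 1)) * quadCount k N κ L := by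
  obtain ⟨C, hC, hsieve⟩ := integral_normSq_le_card_closePairs
  refine ⟨C, hC, ?_⟩
  intro k N κ A a U L c hκ hL hLN hU hA
  have hL0 : (0 : ℝ) < L := by exact_mod_cast hL
  have hN0 : 0 < N := by linarith
  have hNk : 0 < N ^ (k - 1) := Real.rpow_pos_of_pos hN0 _
  set S := intRange N κ with hS
  -- The interval is enlarged so that the large sieve tolerance `1/V` does not exceed the tolerance
  -- `N^(k-1)/L` of `quadCount`.
  set V : ℝ := U + L / N ^ (k - 1) with hV
  have hLNk : 0 < L / N ^ (k - 1) := by positivity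
  have hV0 : 0 < V := by positivity
  set b : ℤ × ℤ → ℂ := fun p => c p.1 * starRingEnd ℂ (c p.2) with hb
  have hbA : ∀ p ∈ blockPairs S L, ‖b p‖ ≤ A ^ 2 := by
    intro p hp
    rw [blockPairs, Finset.mem_filter, Finset.mem_product] at hp
    have h1 := hA _ hp.1.1
    have h2 := hA _ hp.1.2
    have hA0 : 0 ≤ A := (norm_nonneg _).trans h1
    simp only [hb, norm_mul, RCLike.norm_conj]
    rw [sq]
    gcongr
  have h1 := hsieve (blockPairs S L) b (powDiff k) (A ^ 2) V hV0 hbA a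
  set H : ℝ → ℝ := fun t => ‖∑ p ∈ blockPairs S L, b p * expTwoPiI (powDiff k p * t)‖ ^ 2 with hH
  have hHc : Continuous H := by fun_prop
  have hfc : Continuous fun t => ‖∑ n ∈ S, c n * expTwoPiI ((n : ℝ) ^ k * t)‖ ^ 4 := by fun_prop
  have h2 : (closePairs (blockPairs S L) (powDiff k) (1 / V)).card ≤ quadCount k N κ L := by
    refine closePairs_card_mono (Finset.Subset.refl _) ?_
    have : 1 / V ≤ 1 / (L / N ^ (k - 1)) :=
      one_div_le_one_div_of_le hLNk (by rw [hV]; linarith)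
    rwa [one_div_div] at this
  have hJ := card_image_ediv_le hκ hL hLN
  calc _ ≤ ∫ t in (a - U)..(a + U), ((κ + 1) * (N / L)) ^ 2 * H t := by
        refine intervalIntegral.integral_mono_on (by linarith) (hfc.intervalIntegrable _ _)
          ((continuous_const.mul hHc).intervalIntegrable _ _) fun t _ => ?_
        refine (norm_sum_pow_four_le S L c k t).trans ?_
        gcongr
    _ = ((κ + 1) * (N / L)) ^ 2 * ∫ t in (a - U)..(a + U), H t :=
        intervalIntegral.integral_const_mul _ _
    _ ≤ ((κ + 1) * (N / L)) ^ 2 * ∫ t in (a - V)..(a + V), H t := by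
        gcongr
        exact intervalIntegral.integral_mono_interval (by linarith) (by linarith) (by linarith)
          (Filter.Eventually.of_forall fun t => sq_nonneg _) (hHc.intervalIntegrable _ _)
    _ ≤ ((κ + 1) * (N / L)) ^ 2 * (C * (A ^ 2) ^ 2 * V * quadCount k N κ L) := by
        gcongr
        refine h1.trans ?_
        gcongr
    _ = _ := by ring

theorem exists_integral_pow_four_le {k κ η : ℝ} (hk : 1 < k) (hκ : 1 ≤ κ) (hη : 0 < η) :
    ∃ C : ℝ, 0 ≤ C ∧ ∀ (N A a U : ℝ) (c : ℤ → ℂ), 1 ≤ N → 0 < U →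
      (∀ n ∈ intRange N κ, ‖c n‖ ≤ A) →
      ∫ t in (a - U)..(a + U), ‖∑ n ∈ intRange N κ, c n * expTwoPiI ((n : ℝ) ^ k * t)‖ ^ 4 ≤
        C * A ^ 4 * N ^ η * (U * N ^ 2 + N ^ (4 - k)) := by
  obtain ⟨C₁, hC₁, h1⟩ := exists_integral_pow_four_le_quadCount
  -- With `L ≈ N^(1-1/j)` the total loss is `(N/L)^6`: two powers from Cauchy–Schwarz and four from
  -- `exists_quadCount_le` with `B = 4`. It is of order `N^(6/j) ≤ N^η`.
  set j : ℕ := ⌈6 / η⌉₊ + 1 with hj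
  have hj1 : 1 ≤ j := by omega
  have hj0 : (0 : ℝ) < j := by exact_mod_cast hj1
  have hjη : 6 / (j : ℝ) ≤ η := by
    have h2 : 6 / η ≤ j := (Nat.le_ceil _).trans (by rw [hj]; push_cast; linarith)
    rw [div_le_iff₀ hη] at h2
    rw [div_le_iff₀ hj0]
    linarith
  obtain ⟨C₂, hC₂, h2⟩ := exists_quadCount_le j k κ 1 4 hk hκ (by norm_num)
  refine ⟨C₁ * (κ + 1) ^ 2 * C₂ * 2 ^ 6, by positivity, ?_⟩
  intro N A a U c hN hU hA
  have hN0 : 0 < N := by linarith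
  set y : ℝ := N ^ (1 - 1 / (j : ℝ)) with hy
  have hj1' : 1 / (j : ℝ) ≤ 1 := by
    rw [div_le_one hj0]; exact_mod_cast hj1
  have hy1 : 1 ≤ y := Real.one_le_rpow hN (by linarith)
  set L : ℕ := ⌊y⌋₊ with hL
  have hL1 : 1 ≤ L := Nat.one_le_floor_iff _ |>.mpr hy1
  have hLr : (1 : ℝ) ≤ L := by exact_mod_cast hL1
  have hL0 : (0 : ℝ) < L := by linarith
  have hLy : (L : ℝ) ≤ y := Nat.floor_le (by linarith)
  have hyL : y ≤ 2 * L := by linarith [(Nat.lt_floor_add_one y).le]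
  set z : ℝ := N ^ (1 / (j : ℝ)) with hz
  have hz0 : 0 < z := Real.rpow_pos_of_pos hN0 _
  have hyz : y * z = N := by
    rw [hy, hz, ← Real.rpow_add hN0, sub_add_cancel, Real.rpow_one]
  have hz1 : 1 ≤ z := Real.one_le_rpow hN (by positivity)
  have hzj : z ^ j = N := by
    rw [hz, ← Real.rpow_natCast, ← Real.rpow_mul hN0.le, one_div_mul_cancel hj0.ne', Real.rpow_one]
  have hz6 : z ^ 6 ≤ N ^ η := by
    rw [hz, ← Real.rpow_natCast, ← Real.rpow_mul hN0.le]
    refine Real.rpow_le_rpow_of_exponent_le hN (le_trans (le_of_eq ?_) hjη)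
    push_cast
    ring
  have hLN : (L : ℝ) ≤ N := by
    rw [← hyz]
    exact hLy.trans (le_mul_of_one_le_right (by linarith) hz1)
  -- Rounding `L` down keeps `L/N ≤ N^(-1/j)`, so `j` dualisations are enough with `M₀ = 1`.
  have hsmall : N * (L / N) ^ j ≤ 1 := by
    have h3 : (L : ℝ) / N ≤ 1 / z := by
      rw [div_le_div_iff₀ hN0 hz0, one_mul, ← hyz]
      gcongr
    calc N * (L / N) ^ j ≤ N * (1 / z) ^ j := by gcongr
      _ = 1 := by rw [div_pow, one_pow, hzj, mul_one_div_cancel hN0.ne']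
  have hNL : N / L ≤ 2 * z := by
    rw [div_le_iff₀ hL0, ← hyz]
    nlinarith
  have h3 := h2 N L hL1 hLN hsmall
  rw [show (4 : ℝ) = ((4 : ℕ) : ℝ) by norm_num, Real.rpow_natCast] at h3
  have hk2 : N * N / N ^ (k - 1) * N ^ 2 = N * N ^ (4 - k) := by
    have h4 : N ^ (4 - k) * N ^ (k - 1) = N ^ 3 := by
      rw [← Real.rpow_add hN0, show 4 - k + (k - 1) = ((3 : ℕ) : ℝ) by push_cast; ring,
        Real.rpow_natCast]
    have h5 : 0 < N ^ (k - 1) := Real.rpow_pos_of_pos hN0 _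
    field_simp
    linear_combination -h4
  have hk3 : L / N ^ (k - 1) * N ^ 2 ≤ N ^ (4 - k) := by
    have h5 : 0 < N ^ (k - 1) := Real.rpow_pos_of_pos hN0 _
    have h6 : N * (N / N ^ (k - 1) * N ^ 2) = N * N ^ (4 - k) := by rw [← hk2]; ring
    rw [← mul_left_cancel₀ hN0.ne' h6]
    gcongr
  have hNk : 0 < N ^ (k - 1) := Real.rpow_pos_of_pos hN0 _
  have hA4 : 0 ≤ A ^ 4 := by positivity
  calc _ ≤ C₁ * ((κ + 1) * (N / L)) ^ 2 * A ^ 4 * (U + L / N ^ (k - 1)) * quadCount k N κ L :=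
        h1 k N κ A a U L c hκ hL1 hLN hU hA
    _ ≤ C₁ * ((κ + 1) * (N / L)) ^ 2 * A ^ 4 * (U + L / N ^ (k - 1)) *
        (C₂ * (N / L) ^ 4 * N ^ 2) := by gcongr
    _ = C₁ * (κ + 1) ^ 2 * C₂ * A ^ 4 * (N / L) ^ 6 * (U * N ^ 2 + L / N ^ (k - 1) * N ^ 2) := by
        ring
    _ ≤ C₁ * (κ + 1) ^ 2 * C₂ * A ^ 4 * (2 * z) ^ 6 * (U * N ^ 2 + N ^ (4 - k)) := by gcongr
    _ = C₁ * (κ + 1) ^ 2 * C₂ * 2 ^ 6 * A ^ 4 * z ^ 6 * (U * N ^ 2 + N ^ (4 - k)) := by ring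
    _ ≤ _ := by gcongr

/-! ### The exponential sum over primes -/

theorem continuous_primeExpSum (k δ X : ℝ) : Continuous (primeExpSum k δ X) := by
  unfold primeExpSum
  fun_prop

theorem mem_primePowerRange_bounds {k δ X : ℝ} (hk : 0 < k) (hδ : 0 < δ) (hX : 0 < X) {p : ℕ}
    (hp : p ∈ primePowerRange k δ X) :
    p.Prime ∧ (δ * X) ^ (1 / k) ≤ p ∧ (p : ℝ) ≤ X ^ (1 / k) := by
  rw [mem_primePowerRange hk] at hp
  have hp0 : (0 : ℝ) ≤ p := Nat.cast_nonneg p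
  have hinv : ((p : ℝ) ^ k) ^ (1 / k) = p := by
    rw [← Real.rpow_mul hp0, mul_one_div_cancel hk.ne', Real.rpow_one]
  have hk' : 0 ≤ 1 / k := by positivity
  refine ⟨hp.1, ?_, ?_⟩
  · rw [← hinv]
    exact Real.rpow_le_rpow (by positivity) hp.2.1 hk'
  · conv_lhs => rw [← hinv]
    exact Real.rpow_le_rpow (by positivity) hp.2.2 hk'

/-- Extending the coefficients `log p` by zero to all integers of the range; the bound on `κ` says
that `κ (δX)^(1/k)` reaches `X^(1/k)`. -/
theorem exists_primeExpSum_eq_sum_intRange {k δ X κ : ℝ} (hk : 0 < k) (hδ : 0 < δ) (hX : 0 < X)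
    (hκ : δ ^ (-(1 / k)) ≤ κ) :
    ∃ c : ℤ → ℂ, (∀ n ∈ intRange ((δ * X) ^ (1 / k)) κ, ‖c n‖ ≤ |Real.log n|) ∧
      ∀ t, primeExpSum k δ X t =
        ∑ n ∈ intRange ((δ * X) ^ (1 / k)) κ, c n * expTwoPiI ((n : ℝ) ^ k * t) := by
  classical
  set P : Finset ℤ := (primePowerRange k δ X).map Nat.castEmbedding with hP
  refine ⟨fun n => if n ∈ P then (Real.log n : ℂ) else 0, fun n _ => ?_, fun t => ?_⟩
  · beta_reduce
    split_ifs
    · rw [Complex.norm_real, Real.norm_eq_abs]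
    · rw [norm_zero]; exact abs_nonneg _
  · have hsub : P ⊆ intRange ((δ * X) ^ (1 / k)) κ := by
      intro n hn
      rw [hP, Finset.mem_map] at hn
      obtain ⟨p, hp, rfl⟩ := hn
      have h := mem_primePowerRange_bounds hk hδ hX hp
      rw [mem_intRange]
      refine ⟨by simpa using h.2.1, ?_⟩
      have h2 : X ^ (1 / k) = δ ^ (-(1 / k)) * (δ * X) ^ (1 / k) := by
        rw [Real.mul_rpow hδ.le hX.le, ← mul_assoc, ← Real.rpow_add hδ, neg_add_cancel,
          Real.rpow_zero, one_mul]
      have h3 : (p : ℝ) ≤ κ * (δ * X) ^ (1 / k) := by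
        refine h.2.2.trans ?_
        rw [h2]
        gcongr
      simpa using h3
    rw [← Finset.sum_subset hsub (fun n _ hn => by beta_reduce; rw [if_neg hn, zero_mul]), hP,
      Finset.sum_map, primeExpSum]
    refine Finset.sum_congr rfl fun p hp => ?_
    beta_reduce
    rw [if_pos (Finset.mem_map_of_mem _ hp)]
    simp

theorem norm_primeExpSum_le {k δ X t : ℝ} (hk : 0 < k) (hδ : 0 < δ) (hX : 0 < X) :
    ‖primeExpSum k δ X t‖ ≤ (X ^ (1 / k) + 1) * X ^ (1 / k) := by
  have hY : 0 ≤ X ^ (1 / k) := by positivity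
  have hcard : ((primePowerRange k δ X).card : ℝ) ≤ X ^ (1 / k) + 1 := by
    have h1 : (primePowerRange k δ X).card ≤ ⌊X ^ (1 / k)⌋₊ + 1 := by
      unfold primePowerRange
      exact (Finset.card_filter_le _ _).trans (by rw [Finset.card_range])
    have h2 : ((primePowerRange k δ X).card : ℝ) ≤ (⌊X ^ (1 / k)⌋₊ : ℝ) + 1 := by exact_mod_cast h1
    linarith [Nat.floor_le hY]
  calc ‖primeExpSum k δ X t‖ ≤ ∑ p ∈ primePowerRange k δ X, X ^ (1 / k) := by
        refine norm_sum_le_of_le _ fun p hp => ?_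
        have h := mem_primePowerRange_bounds hk hδ hX hp
        have hp1 : (1 : ℝ) ≤ p := by exact_mod_cast h.1.one_lt.le
        rw [norm_mul, norm_expTwoPiI, mul_one, Complex.norm_real,
          Real.norm_of_nonneg (Real.log_nonneg hp1)]
        have := Real.log_le_sub_one_of_pos (by linarith : (0 : ℝ) < p)
        linarith [h.2.2]
    _ ≤ _ := by
        rw [Finset.sum_const, nsmul_eq_mul]
        gcongr

theorem exists_integral_primeExpSum_le {k ε δ : ℝ} (hk : 1 < k) (hε : 0 < ε) (hδ : 0 < δ) :
    ∃ C : ℝ, 0 < C ∧ ∀ X a U : ℝ, 1 ≤ X → 0 < U →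
      ∫ t in (a - U)..(a + U), ‖primeExpSum k δ X t‖ ^ 4 ≤
        C * ((U * X ^ (2 / k) + X ^ (4 / k - 1)) * X ^ ε) := by
  have hk0 : 0 < k := by linarith
  -- The loss `N^η` occurs twice, once in the fourth moment and once for the logarithms, and
  -- `N^(2η)` is a constant times `X^ε`.
  set η : ℝ := k * ε / 2 with hη
  have hη0 : 0 < η := by positivity
  set κ : ℝ := max 1 (δ ^ (-(1 / k))) with hκ
  have hκ1 : 1 ≤ κ := le_max_left _ _
  obtain ⟨C₁, hC₁, h1⟩ := exists_integral_pow_four_le hk hκ1 hη0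
  obtain ⟨C₂, hC₂, h2⟩ := exists_one_add_log_pow_le hη0
  set E : ℝ := δ ^ (2 / k) + δ ^ (4 / k - 1) with hE
  have hE0 : 0 < E := add_pos (Real.rpow_pos_of_pos hδ _) (Real.rpow_pos_of_pos hδ _)
  set D : ℝ := 2 * ((κ + 1) * κ) ^ 4 with hD
  have hD0 : 0 < D := by positivity
  set F : ℝ := C₁ * ((1 + Real.log κ) ^ 4 * C₂) * δ ^ ε * E with hF
  have hlogκ : 0 ≤ Real.log κ := Real.log_nonneg hκ1
  have hF0 : 0 ≤ F := by positivity
  refine ⟨D + F, by linarith, ?_⟩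
  intro X a U hX hU
  have hX0 : 0 < X := by linarith
  have hXε : 1 ≤ X ^ ε := Real.one_le_rpow hX hε.le
  have hX2 : 1 ≤ X ^ (2 / k) := Real.one_le_rpow hX (by positivity)
  have hX4 : 0 < X ^ (4 / k - 1) := Real.rpow_pos_of_pos hX0 _
  set R : ℝ := (U * X ^ (2 / k) + X ^ (4 / k - 1)) * X ^ ε with hR
  have hR0 : 0 < R := by positivity
  set N : ℝ := (δ * X) ^ (1 / k) with hN
  have hδX : 0 < δ * X := by positivity
  -- If `N < 1`, then `X` is bounded in terms of `δ` and `k`, and the trivial bound for the sum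
  -- suffices.
  rcases lt_or_ge N 1 with hcase | hcase
  · have hXκ : X ^ (1 / k) ≤ κ := by
      have h3 : X ^ (1 / k) = δ ^ (-(1 / k)) * N := by
        rw [hN, Real.mul_rpow hδ.le hX0.le, ← mul_assoc, ← Real.rpow_add hδ, neg_add_cancel,
          Real.rpow_zero, one_mul]
      rw [h3]
      calc δ ^ (-(1 / k)) * N ≤ δ ^ (-(1 / k)) * 1 := by gcongr
        _ ≤ κ := by rw [mul_one]; exact le_max_right _ _
    have hb : ∀ t, ‖primeExpSum k δ X t‖ ^ 4 ≤ ((κ + 1) * κ) ^ 4 := fun t => by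
      have h3 := norm_primeExpSum_le (t := t) hk0 hδ hX0
      gcongr
      exact h3.trans (by gcongr)
    have h4 := intervalIntegral.integral_mono_on (by linarith : a - U ≤ a + U)
      (((continuous_primeExpSum k δ X).norm.pow 4).intervalIntegrable (μ := volume) _ _)
      (intervalIntegrable_const (μ := volume) (c := ((κ + 1) * κ) ^ 4)) fun t _ => hb t
    rw [intervalIntegral.integral_const, smul_eq_mul] at h4
    have h5 : U ≤ R := by
      calc U = U * 1 * 1 := by ring
        _ ≤ U * X ^ (2 / k) * X ^ ε := by gcongr
        _ ≤ R := by rw [hR]; gcongr; linarith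
    calc _ ≤ (a + U - (a - U)) * ((κ + 1) * κ) ^ 4 := h4
      _ = D * U := by rw [hD]; ring
      _ ≤ D * R := by gcongr
      _ ≤ (D + F) * R := by gcongr; linarith
  · obtain ⟨c, hc, hsum⟩ := exists_primeExpSum_eq_sum_intRange hk0 hδ hX0
      (le_max_right 1 (δ ^ (-(1 / k))))
    have hN0 : 0 < N := by linarith
    have hlogN : 0 ≤ Real.log N := Real.log_nonneg hcase
    set A : ℝ := (1 + Real.log κ) * (1 + Real.log N) with hA
    have hcA : ∀ n ∈ intRange N κ, ‖c n‖ ≤ A := by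
      intro n hn
      refine (hc n hn).trans ?_
      rw [mem_intRange] at hn
      have hn1 : (1 : ℝ) ≤ n := hcase.trans hn.1
      rw [abs_of_nonneg (Real.log_nonneg hn1)]
      have h3 := Real.log_le_log (by linarith) hn.2
      rw [Real.log_mul (by linarith) (by linarith)] at h3
      rw [hA]
      nlinarith [mul_nonneg hlogκ hlogN]
    have h3 := h1 N A a U c hcase hU hcA
    have hA4 : A ^ 4 ≤ (1 + Real.log κ) ^ 4 * C₂ * N ^ η := by
      rw [hA, mul_pow, mul_assoc]
      gcongr
      exact h2 N hcase
    have hpow : ∀ s : ℝ, N ^ s = δ ^ (s / k) * X ^ (s / k) := fun s => by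
      rw [hN, ← Real.rpow_mul hδX.le, one_div_mul_eq_div, Real.mul_rpow hδ.le hX0.le]
    have hNη : N ^ η * N ^ η = δ ^ ε * X ^ ε := by
      rw [← Real.rpow_add hN0, hpow, show (η + η) / k = ε by rw [hη]; field_simp; ring]
    have hN2 : N ^ 2 = δ ^ (2 / k) * X ^ (2 / k) := by
      rw [← Real.rpow_natCast, hpow]; norm_num
    have hN4 : N ^ (4 - k) = δ ^ (4 / k - 1) * X ^ (4 / k - 1) := by
      rw [hpow, show (4 - k) / k = 4 / k - 1 by field_simp]
    have hδ2 : 0 < δ ^ (2 / k) := Real.rpow_pos_of_pos hδ _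
    have hδ4 : 0 < δ ^ (4 / k - 1) := Real.rpow_pos_of_pos hδ _
    have hsize : U * N ^ 2 + N ^ (4 - k) ≤ E * (U * X ^ (2 / k) + X ^ (4 / k - 1)) := by
      rw [hN2, hN4, hE]
      have h4 : 0 ≤ δ ^ (4 / k - 1) * (U * X ^ (2 / k)) := by positivity
      have h5 : 0 ≤ δ ^ (2 / k) * X ^ (4 / k - 1) := by positivity
      linarith
    simp only [hsum]
    calc _ ≤ C₁ * A ^ 4 * N ^ η * (U * N ^ 2 + N ^ (4 - k)) := h3
      _ ≤ C₁ * ((1 + Real.log κ) ^ 4 * C₂ * N ^ η) * N ^ η *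
          (E * (U * X ^ (2 / k) + X ^ (4 / k - 1))) := by gcongr
      _ = C₁ * ((1 + Real.log κ) ^ 4 * C₂) * (N ^ η * N ^ η) * E *
          (U * X ^ (2 / k) + X ^ (4 / k - 1)) := by ring
      _ = F * R := by rw [hNη, hF, hR]; ring
      _ ≤ (D + F) * R := by gcongr; linarith

theorem lemma3p4 (k ε δ : ℝ) (hk : 1 < k) (hε : 0 < ε) (hδ : 0 < δ) :
    ∃ C : ℝ, 0 < C ∧ ∀ X : ℝ, 1 ≤ X →
      (∀ τ : ℝ, 0 < τ →
        ∫ α in (-τ)..τ, ‖primeExpSum k δ X α‖ ^ 4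
          ≤ C * ((τ * X ^ (2 / k) + X ^ (4 / k - 1)) * X ^ ε)) ∧
      (∀ n : ℤ,
        ∫ α in (n : ℝ)..((n : ℝ) + 1), ‖primeExpSum k δ X α‖ ^ 4
          ≤ C * ((X ^ (2 / k) + X ^ (4 / k - 1)) * X ^ ε)) := by
  obtain ⟨C, hC, h⟩ := exists_integral_primeExpSum_le hk hε hδ
  refine ⟨C, hC, fun X hX => ⟨fun τ hτ => ?_, fun n => ?_⟩⟩
  · simpa using h X 0 τ hX hτ
  -- The estimate is uniform in the centre of the interval, so `[n, n + 1]` is covered by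
  -- half-length `1/2` about its midpoint.
  · have h1 := h X (n + 1 / 2) (1 / 2) hX (by norm_num)
    rw [show (n : ℝ) + 1 / 2 - 1 / 2 = n by ring,
      show (n : ℝ) + 1 / 2 + 1 / 2 = n + 1 by ring] at h1
    refine h1.trans ?_
    have hX0 : 0 < X := by linarith
    have h2 : 0 < X ^ (2 / k) := Real.rpow_pos_of_pos hX0 _
    gcongr
    linarith
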